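/- **Lemma 5.1.** Let $g,g'\ge 0$, $h,h'\ge 1$ and $r,r'\ge 2$ be integers. If $r=r'$, then the graph Houghton groups $B(g,h,r)$ and $B(g',h',r')$ are commensurable (they have isomorphic subgroups of finite index), and the doubled handlebody Houghton groups $\mathcal B(g,h,r)$ and $\mathcal B(g',h',r')$ are commensurable. This holds for every choice of the rigid structures that define these groups. *Graphs.* $\Gamma_r$ is the graph consisting of $r$ rays issuing from a center $x_0$, with infinitely many loops attached along each ray, and $\mathrm{Map}(\Gamma_r)$ is the group of proper homotopy equivalences $\Gamma_r\to\Gamma_r$ up to proper homotopy. $Y^h$ is a segment with end points $\partial_-Y^h,\partial_+Y^h$ and $h$ loops attached at interior points. A $(g,h)$-rigid structure on $\Gamma_r$ is a decomposition into a core $C$, that is, a connected subgraph of rank $g$ containing $x_0$ with $r$ valence one vertices, one on each ray, and pieces $Y_{i,j}$ ($i\ge 0$, $1\le j\le r$), where $Y_{0,j},Y_{1,j},\dots$ are successive copies of $Y^h$ along the $j$-th ray, starting at the boundary vertex of $C$ on that ray, with $\partial_-$ being the end point nearer to the core; each piece $Y_p$ carries a marking $\phi_p\colon Y_p\to Y^h$,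 a homotopy equivalence preserving $\partial_\pm$, with a chosen homotopy inverse $\phi_p^{-1}$, also preserving $\partial_\pm$ (homotopies relative to the end points). A suited subgraph is a connected union of $C$ and finitely many pieces. $B(g,h,r)\le \mathrm{Map}(\Gamma_r)$ is the group of classes of proper homotopy equivalences $f$ for which there is a suited subgraph $Z$ such that $f(Z)$ is suited, $f|_Z\colon Z\to f(Z)$ is a homotopy equivalence, and for every piece $Y_p\subset\overline{\Gamma_r\setminus Z}$ there is a piece $Y_q\subset\overline{\Gamma_r\setminus f(Z)}$ with $f(Y_p)=Y_q$ and $f|_{Y_p}=\phi_q^{-1}\phi_p$. *Doubled handlebodies.* $M_{\Gamma_r}$ is the double of a regular neighborhood of $\Gamma_r$ in $3$-space, and $\mathrm{Map}(M_{\Gamma_r})$ is the group of its orientation preserving homeomorphisms up to isotopy. Fix reference manifolds with parametrized boundary spheres: $\mathcal C^{g}$, a doubled handlebody of rank $g$ with $r$ boundary spheres, and $\mathcal Y^h$, a doubled handlebody of rank $h$ with two boundary spheres $\partial_\pm$, namely the parts of $M_{\Gamma_r}$ over a rank $g$ core (all of whose $g$ loops lie on the first ray) and over a chain of $h$ loops.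 A $(g,h)$-rigid structure on $M_{\Gamma_r}$ is a decomposition into a core homeomorphic to $\mathcal C^{g}$ and pieces $\mathcal Y_{i,j}$ ($i\ge0$, $1\le j\le r$) with markings $\phi_{i,j}\colon\mathcal Y_{i,j}\cong\mathcal Y^h$, where $\mathcal Y_{0,j},\mathcal Y_{1,j},\dots$ form a chain starting at the $j$-th boundary sphere of the core, consecutive members being glued along $\partial_+$ and $\partial_-$ in the standard parametrizations, and where there are no other intersections. Suited submanifolds are the connected unions of the core and finitely many pieces. $\mathcal B(g,h,r)\le\mathrm{Map}(M_{\Gamma_r})$ is the group of classes of homeomorphisms $f$ for which there is a suited submanifold $\mathcal Z$ with suited image such that every piece $\mathcal Y_p$ outside $\mathcal Z$ is mapped to a piece $\mathcal Y_q$ outside $f(\mathcal Z)$ by $\phi_q^{-1}\phi_p$. -/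

import Mathlib

open Topology
open scoped unitInterval ContinuousMap

noncomputable section

namespace Houghton

/-! ## Commensurability of abstract groups -/

/-- Two groups are commensurable if they have isomorphic subgroups of finite index. -/
def Commensurable (G H : Type*) [Group G] [Group H] : Prop :=
  ∃ (A : Subgroup G) (B : Subgroup H),
    A.FiniteIndex ∧ B.FiniteIndex ∧ Nonempty (A ≃* B)

/-! ## The mapping class group of a graph: proper homotopy equivalences up to proper homotopy -/

/-- Two maps are properly homotopic if there is a homotopy `I × X → X` between them that is
itself a proper map. -/
def ProperHomotopic {X : Type*} [TopologicalSpace X] (f g : C(X, X)) : Prop :=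
  ∃ H : ContinuousMap.Homotopy f g, IsProperMap H

theorem ProperHomotopic.refl {X : Type*} [TopologicalSpace X] {f : C(X, X)}
    (hf : IsProperMap f) : ProperHomotopic f f :=
  ⟨ContinuousMap.Homotopy.refl f, hf.comp isProperMap_snd_of_compactSpace⟩

theorem ProperHomotopic.symm {X : Type*} [TopologicalSpace X] {f g : C(X, X)}
    (h : ProperHomotopic f g) : ProperHomotopic g f := by
  obtain ⟨H, hH⟩ := h
  exact ⟨H.symm, hH.comp
    ((unitInterval.symmHomeomorph.prodCongr (Homeomorph.refl X)).isProperMap)⟩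

theorem isProperMap_of_reparam {Y Z : Type*} [TopologicalSpace Y] [TopologicalSpace Z]
    [T2Space Z] (K F G : Y → Z) (a b a' b' : Y → Y) (S : Set Y) (hK : Continuous K)
    (hF : IsProperMap F) (hG : IsProperMap G) (ca : Continuous a') (cb : Continuous b')
    (h1 : ∀ p ∈ S, K p = F (a p)) (h2 : ∀ p ∈ S, a' (a p) = p)
    (h3 : ∀ p ∈ Sᶜ, K p = G (b p)) (h4 : ∀ p ∈ Sᶜ, b' (b p) = p) : IsProperMap K := by
  have key : ∀ (F : Y → Z) (a a' : Y → Y) (T : Set Y), IsProperMap F → Continuous a' →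
      (∀ p ∈ T, K p = F (a p)) → (∀ p ∈ T, a' (a p) = p) →
      ∀ (U : Ultrafilter Y) (y : Z), T ∈ U → Filter.Tendsto K U (𝓝 y) →
      ∃ x, K x = y ∧ (U : Filter Y) ≤ 𝓝 x := by
    intro F a a' T hF ca h1 h2 U y hU hy
    rw [isProperMap_iff_ultrafilter] at hF
    have t1 : Filter.Tendsto F (U.map a : Ultrafilter Y) (𝓝 y) := by
      rw [Ultrafilter.coe_map, Filter.tendsto_map'_iff]
      exact hy.congr' (Filter.eventually_of_mem hU h1)
    obtain ⟨p, -, hle⟩ := hF.2 t1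
    have t2 : Filter.Tendsto (a' ∘ a) (U : Filter Y) (𝓝 (a' p)) := (ca.tendsto p).comp hle
    have t3 : Filter.Tendsto id (U : Filter Y) (𝓝 (a' p)) :=
      t2.congr' (Filter.eventually_of_mem hU h2)
    exact ⟨a' p, tendsto_nhds_unique ((hK.tendsto _).comp t3) hy, t3⟩
  rw [isProperMap_iff_ultrafilter]
  refine ⟨hK, fun U y hy => ?_⟩
  rcases U.mem_or_compl_mem S with hU | hU
  · exact key F a a' S hF ca h1 h2 U y hU hy
  · exact key G b b' Sᶜ hG cb h3 h4 U y hU hy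

theorem ProperHomotopic.trans {X : Type*} [TopologicalSpace X] [T2Space X] {f g k : C(X, X)}
    (h₁ : ProperHomotopic f g) (h₂ : ProperHomotopic g k) : ProperHomotopic f k := by
  obtain ⟨F, hF⟩ := h₁
  obtain ⟨G, hG⟩ := h₂
  refine ⟨F.trans G, isProperMap_of_reparam (F.trans G) F G
    (fun p => (Set.projIcc 0 1 zero_le_one (2 * (p.1 : ℝ)), p.2))
    (fun p => (Set.projIcc 0 1 zero_le_one (2 * (p.1 : ℝ) - 1), p.2))
    (fun p => (Set.projIcc 0 1 zero_le_one ((p.1 : ℝ) / 2), p.2))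
    (fun p => (Set.projIcc 0 1 zero_le_one (((p.1 : ℝ) + 1) / 2), p.2))
    {p : I × X | (p.1 : ℝ) ≤ 1 / 2} (F.trans G).continuous hF hG
    (by fun_prop) (by fun_prop) ?_ ?_ ?_ ?_⟩
  · rintro ⟨t, x⟩ (ht : (t : ℝ) ≤ 1 / 2)
    have : (2 * (t : ℝ)) ∈ Set.Icc (0 : ℝ) 1 := ⟨by have := t.2.1; linarith, by linarith⟩
    rw [ContinuousMap.Homotopy.trans_apply, dif_pos ht]
    simp only [Set.projIcc_of_mem zero_le_one this]
  · rintro ⟨t, x⟩ (ht : (t : ℝ) ≤ 1 / 2)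
    have : (2 * (t : ℝ)) ∈ Set.Icc (0 : ℝ) 1 := ⟨by have := t.2.1; linarith, by linarith⟩
    simp [Set.projIcc_of_mem zero_le_one this]
  · rintro ⟨t, x⟩ (ht : ¬ (t : ℝ) ≤ 1 / 2)
    have : (2 * (t : ℝ) - 1) ∈ Set.Icc (0 : ℝ) 1 :=
      ⟨by linarith, by have := t.2.2; linarith⟩
    rw [ContinuousMap.Homotopy.trans_apply, dif_neg ht]
    simp only [Set.projIcc_of_mem zero_le_one this]
  · rintro ⟨t, x⟩ (ht : ¬ (t : ℝ) ≤ 1 / 2)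
    have : (2 * (t : ℝ) - 1) ∈ Set.Icc (0 : ℝ) 1 :=
      ⟨by linarith, by have := t.2.2; linarith⟩
    simp [Set.projIcc_of_mem zero_le_one this]

theorem ProperHomotopic.comp {X : Type*} [TopologicalSpace X] [T2Space X] {f f' g g' : C(X, X)}
    (hf : ProperHomotopic f f') (hg : ProperHomotopic g g') :
    ProperHomotopic (f.comp g) (f'.comp g') := by
  obtain ⟨F, hF⟩ := hf
  obtain ⟨G, hG⟩ := hg
  refine ⟨⟨⟨fun p => F (p.1, G p), by fun_prop⟩, fun x => by simp, fun x => by simp⟩, ?_⟩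
  have h : IsProperMap (fun p : I × X => (p.1, G p)) :=
    isProperMap_of_comp_of_t2 (g := Prod.snd) (by fun_prop) continuous_snd hG
  exact hF.comp h

/-- Proper homotopy classes of proper self-maps of a Hausdorff space. -/
def properHomotopySetoid (X : Type*) [TopologicalSpace X] [T2Space X] :
    Setoid {f : C(X, X) // IsProperMap f} where
  r f g := ProperHomotopic f.1 g.1
  iseqv := ⟨fun f => .refl f.2, fun h => h.symm, fun h h' => h.trans h'⟩

/-- The monoid (under composition) of proper homotopy classes of proper self-maps. -/
def ProperHomotopyClass (X : Type*) [TopologicalSpace X] [T2Space X] : Type _ :=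
  Quotient (properHomotopySetoid X)

/-- The class of a proper map. -/
def ProperHomotopyClass.mk {X : Type*} [TopologicalSpace X] [T2Space X] (f : C(X, X))
    (hf : IsProperMap f) : ProperHomotopyClass X :=
  Quotient.mk (properHomotopySetoid X) ⟨f, hf⟩

instance (X : Type*) [TopologicalSpace X] [T2Space X] : Monoid (ProperHomotopyClass X) where
  mul := Quotient.map₂ (fun f g => ⟨f.1.comp g.1, f.2.comp g.2⟩)
    (fun _ _ h _ _ h' => ProperHomotopic.comp h h')
  one := ProperHomotopyClass.mk (ContinuousMap.id X) isProperMap_id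
  mul_assoc := by
    rintro ⟨f⟩ ⟨g⟩ ⟨k⟩
    rfl
  one_mul := by
    rintro ⟨f⟩
    rfl
  mul_one := by
    rintro ⟨f⟩
    rfl

/-- `Map(X)`: the invertible proper homotopy classes, i.e. the proper homotopy equivalences
`X → X` up to proper homotopy. -/
abbrev MapGraph (X : Type*) [TopologicalSpace X] [T2Space X] : Type _ :=
  (ProperHomotopyClass X)ˣ

/-! ## The graph `Γ_r` and graph Houghton groups -/

/-- The half-line `[0, ∞) ⊆ ℂ` with a loop (a circle of radius `1/2`) attached at each of the
points `2, 4, 6, …`. -/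
def loopedRay : Set ℂ :=
  {z | (z.im = 0 ∧ 0 ≤ z.re) ∨
    ∃ k : ℕ, ‖z - ((2 * k + 2 : ℝ) + (1 / 2 : ℝ) * Complex.I)‖ = 1 / 2}

/-- The graph `Γ_r`: the wedge at the center vertex `0` of `r` copies of the looped ray, one in
each coordinate axis of `ℂ ^ r`. It has `r` ends, all of them accumulated by loops. Besides the
center and the points where the loops are attached, the points at distance `1, 3, 5, …` along each
ray are regarded as (valence two) vertices. -/
def Graph (r : ℕ) : Set (Fin r → ℂ) :=
  {x | ∃ (j : Fin r) (z : ℂ), z ∈ loopedRay ∧ x = Pi.single j z}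

/-- The `k`-th valence two vertex of the `j`-th ray; exactly `k` loops of this ray lie between it
and the center. -/
def cutVertex {r : ℕ} (j : Fin r) (k : ℕ) : Graph r :=
  ⟨Pi.single j ((2 * k + 1 : ℝ) : ℂ), j, _, Or.inl ⟨by simp, by
    rw [Complex.ofReal_re]; positivity⟩, rfl⟩

/-- The part of the `j`-th ray between its `a`-th and its `b`-th valence two vertex: a segment with
`b - a` loops attached. -/
def raySegment {r : ℕ} (j : Fin r) (a b : ℕ) : Set (Graph r) :=
  {x | ∃ z : ℂ, x.1 = Pi.single j z ∧ 2 * (a : ℝ) + 1 ≤ z.re ∧ z.re ≤ 2 * (b : ℝ) + 1}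

theorem cutVertex_mem_left {r : ℕ} (j : Fin r) {a b : ℕ} (h : a ≤ b) :
    cutVertex j a ∈ raySegment j a b :=
  ⟨_, rfl, by simp, by simpa using h⟩

theorem cutVertex_mem_right {r : ℕ} (j : Fin r) {a b : ℕ} (h : a ≤ b) :
    cutVertex j b ∈ raySegment j a b :=
  ⟨_, rfl, by simpa using h, by simp⟩

/-- The reference piece `Y^h`: the segment `[0, 2h]` with loops attached at the `h` points
`1, 3, …, 2h - 1`. -/
def refPiece (h : ℕ) : Set ℂ :=
  {z | (z.im = 0 ∧ 0 ≤ z.re ∧ z.re ≤ 2 * h) ∨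
    ∃ k : ℕ, k < h ∧ ‖z - ((2 * k + 1 : ℝ) + (1 / 2 : ℝ) * Complex.I)‖ = 1 / 2}

/-- The boundary vertex `∂₋ Y^h`. -/
def refPieceMinus (h : ℕ) : refPiece h := ⟨0, Or.inl (by simp)⟩

/-- The boundary vertex `∂₊ Y^h`. -/
def refPiecePlus (h : ℕ) : refPiece h := ⟨((2 * h : ℝ) : ℂ), Or.inl ⟨by simp, by simp, by simp⟩⟩

/-- A marking of `A` (with boundary points `a₀`, `a₁`) by `B` (with boundary points `b₀`, `b₁`): a
homotopy equivalence respecting the boundary points, together with a chosen homotopy inverse. As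
for homotopy equivalences of pieces, everything is relative to the boundary points. -/
structure Marking (A B : Type*) [TopologicalSpace A] [TopologicalSpace B]
    (a₀ a₁ : A) (b₀ b₁ : B) where
  toRef : C(A, B)
  ofRef : C(B, A)
  toRef_minus : toRef a₀ = b₀
  toRef_plus : toRef a₁ = b₁
  ofRef_minus : ofRef b₀ = a₀
  ofRef_plus : ofRef b₁ = a₁
  left_inv : (ofRef.comp toRef).HomotopicRel (ContinuousMap.id A) {a₀, a₁}
  right_inv : (toRef.comp ofRef).HomotopicRel (ContinuousMap.id B) {b₀, b₁}

/-- A `(g,h)`-rigid structure on `Γ_r`. A connected subgraph containing the center, with one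
valence one vertex on each ray and complement consisting of pieces, is cut off on each ray at one
of the valence two vertices, so it is determined by the number `coreLoops j` of loops it contains
on each ray; its rank is the total number of these loops. The pieces are then the successive
segments with `h` loops; `(i, j)` is the `i`-th piece on the `j`-th ray, counted from the core, and
`∂₋` is its boundary point nearer to the core. -/
structure GraphRigidStructure (g h r : ℕ) where
  coreLoops : Fin r → ℕ
  rank_core : ∑ j, coreLoops j = g
  marking : ∀ (i : ℕ) (j : Fin r),
    Marking (raySegment j (coreLoops j + h * i) (coreLoops j + h * (i + 1))) (refPiece h)
      ⟨cutVertex j (coreLoops j + h * i), cutVertex_mem_left j (by gcongr; omega)⟩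
      ⟨cutVertex j (coreLoops j + h * (i + 1)), cutVertex_mem_right j (by gcongr; omega)⟩
      (refPieceMinus h) (refPiecePlus h)

namespace GraphRigidStructure

variable {g h r : ℕ}

/-- The core `C`. -/
def core (R : GraphRigidStructure g h r) : Set (Graph r) :=
  {x | ∀ j, (x.1 j).re ≤ 2 * (R.coreLoops j : ℝ) + 1}

/-- The `i`-th piece on the `j`-th ray. -/
def piece (R : GraphRigidStructure g h r) (p : ℕ × Fin r) : Set (Graph r) :=
  raySegment p.2 (R.coreLoops p.2 + h * p.1) (R.coreLoops p.2 + h * (p.1 + 1))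

/-- A suited subgraph: a connected union of the core and finitely many pieces. -/
def IsSuited (R : GraphRigidStructure g h r) (Z : Set (Graph r)) : Prop :=
  IsConnected Z ∧ ∃ T : Finset (ℕ × Fin r), Z = R.core ∪ ⋃ p ∈ T, R.piece p

/-- `f` is rigid outside some defining graph `Z`: `Z` and `f(Z)` are suited, `f` restricts to a
homotopy equivalence `Z → f(Z)` (these are compact, so properness is automatic), and each piece
`p` outside `Z` is mapped onto a piece `q` outside `f(Z)` by `φ_q⁻¹ ∘ φ_p`. -/
def IsAsymptoticallyRigid (R : GraphRigidStructure g h r) (f : C(Graph r, Graph r)) : Prop :=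
  ∃ Z : Set (Graph r), R.IsSuited Z ∧ R.IsSuited (f '' Z) ∧
    (∃ e : Z ≃ₕ (f '' Z), ∀ x : Z, (e x : Graph r) = f x) ∧
    ∀ p, R.piece p ⊆ closure Zᶜ → ∃ q, R.piece q ⊆ closure (f '' Z)ᶜ ∧
      f '' R.piece p = R.piece q ∧
      ∀ x : R.piece p, f x = ((R.marking q.1 q.2).ofRef ((R.marking p.1 p.2).toRef x)).1

/-- The graph Houghton group `B(g,h,r)` of a rigid structure: the group of those classes in
`Map(Γ_r)` that are represented by an asymptotically rigid proper homotopy equivalence. These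
classes are closed under products and inverses; writing the group as the subgroup generated by
them only serves to have the group laws for free. -/
def houghtonGroup (R : GraphRigidStructure g h r) : Subgroup (MapGraph (Graph r)) :=
  Subgroup.closure {u | ∃ (f : C(Graph r, Graph r)) (hf : IsProperMap f),
    (u : ProperHomotopyClass (Graph r)) = ProperHomotopyClass.mk f hf ∧
      R.IsAsymptoticallyRigid f}

end GraphRigidStructure

/-! ## The mapping class group of a manifold: homeomorphisms up to isotopy -/

/-- Homeomorphisms isotopic to the identity. An isotopy is a level preserving homeomorphism of
`I × M`. -/
def isotopicToId (M : Type*) [TopologicalSpace M] : Subgroup (M ≃ₜ M) where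
  carrier := {f | ∃ H : (I × M) ≃ₜ (I × M), (∀ p, (H p).1 = p.1) ∧
    (∀ x, H (0, x) = (0, x)) ∧ ∀ x, H (1, x) = (1, f x)}
  one_mem' := ⟨Homeomorph.refl _, fun _ => rfl, fun _ => rfl, fun _ => rfl⟩
  mul_mem' := by
    rintro f g ⟨F, hF, hF0, hF1⟩ ⟨G, hG, hG0, hG1⟩
    refine ⟨G.trans F, fun p => ?_, fun x => ?_, fun x => ?_⟩
    · simp [hF, hG]
    · simp [hF0, hG0]
    · simp [hF1, hG1]
  inv_mem' := by
    rintro f ⟨F, hF, hF0, hF1⟩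
    refine ⟨F.symm, fun p => ?_, fun x => ?_, fun x => ?_⟩
    · have := hF (F.symm p)
      simpa using this.symm
    · rw [Homeomorph.symm_apply_eq, hF0]
    · rw [Homeomorph.symm_apply_eq, hF1]
      exact congrArg _ (f.apply_symm_apply x).symm

instance (M : Type*) [TopologicalSpace M] : (isotopicToId M).Normal where
  conj_mem := by
    rintro f ⟨F, hF, hF0, hF1⟩ k
    let K : (I × M) ≃ₜ (I × M) := (Homeomorph.refl I).prodCongr k
    refine ⟨(K.symm.trans F).trans K, fun p => ?_, fun x => ?_, fun x => ?_⟩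
    · simp [K, hF]
    · simp [K, hF0]
    · simp only [K, Homeomorph.trans_apply, Homeomorph.prodCongr_symm, Homeomorph.coe_prodCongr,
        Prod.map_apply, Homeomorph.refl_symm, Homeomorph.refl_apply, id, hF1]
      rfl

/-- Homeomorphisms of `M` up to isotopy. For an orientable `M` this contains `Map(M)`, the group of
isotopy classes of orientation preserving homeomorphisms. -/
abbrev MapManifold (M : Type*) [TopologicalSpace M] : Type _ := (M ≃ₜ M) ⧸ isotopicToId M

/-! ## The doubled handlebody `M_{Γ_r}` and doubled handlebody Houghton groups

The double of the handlebody `{(t, y, z) | z² ≤ F(t, y)}` (a thickening of the planar surface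
`F ≥ 0`) along the surface `z² = F(t, y)` is `{(t, y, w) ∈ ℝ × ℝ × ℂ | |w|² = F(t, y)}`. -/

/-- The region `profile ≥ 0` is the strip `|y| ≤ 1` with an open oval hole around each point
`(k, 0)`, `k` odd, which is contained in `(k - 1, k + 1) × (-1, 1)`. At even `t` its value is
`1 - y ^ 2`. -/
def profile (t y : ℝ) : ℝ := min (1 - y ^ 2) (4 * y ^ 2 + 1 + 2 * Real.cos (Real.pi * t))

theorem profile_even (k : ℕ) (y : ℝ) : profile (2 * k) y = 1 - y ^ 2 := by
  have : Real.cos (Real.pi * (2 * k)) = 1 := by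
    rw [show Real.pi * (2 * (k : ℝ)) = k * (2 * Real.pi) by ring]
    exact Real.cos_nat_mul_two_pi k
  rw [profile, this, min_eq_left]
  nlinarith [sq_nonneg y]

/-- The double of the regular neighborhood of a ray with loops at `1, 3, 5, …`, beginning with a
boundary sphere at `t = 0`. -/
def rayDouble : Set (ℝ × ℝ × ℂ) :=
  {q | 0 ≤ q.1 ∧ ‖q.2.2‖ ^ 2 = profile q.1 q.2.1}

/-- The reference piece: the part of `rayDouble` with `t ≤ 2h`, a doubled handlebody of rank `h`
with two boundary spheres, at `t = 0` and `t = 2h`. -/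
def refDoublePiece (h : ℕ) : Set (ℝ × ℝ × ℂ) := {q | q ∈ rayDouble ∧ q.1 ≤ 2 * h}

/-- The unit sphere of `ℝ × ℂ`. -/
def UnitSphere : Set (ℝ × ℂ) := {u | u.1 ^ 2 + ‖u.2‖ ^ 2 = 1}

theorem mem_rayDouble_of_sphere (k : ℕ) (u : UnitSphere) :
    ((2 * k : ℝ), u.1.1, u.1.2) ∈ rayDouble := by
  have : u.1.1 ^ 2 + ‖u.1.2‖ ^ 2 = 1 := u.2
  refine ⟨by positivity, ?_⟩
  simp only [profile_even]
  linarith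

/-- The parametrized boundary sphere `∂₋` of the reference piece. -/
def refDoublePieceMinus (h : ℕ) (u : UnitSphere) : refDoublePiece h :=
  ⟨(0, u.1.1, u.1.2), by simpa using mem_rayDouble_of_sphere 0 u, by positivity⟩

/-- The parametrized boundary sphere `∂₊` of the reference piece. -/
def refDoublePiecePlus (h : ℕ) (u : UnitSphere) : refDoublePiece h :=
  ⟨(2 * h, u.1.1, u.1.2), mem_rayDouble_of_sphere h u, le_rfl⟩

/-- The `j`-th `r`-th root of unity. -/
def rootOfUnity {r : ℕ} (j : Fin r) : ℂ := Complex.exp (2 * Real.pi * Complex.I * (j : ℕ) / r)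

/-- The `3`-sphere of radius `√(r² + 1)` in `ℂ²`, with `r` disjoint open balls removed that have
unit spheres as boundaries and are centered in the directions of the `r`-th roots of unity. It is
the double of a regular neighborhood of the star with center and `r` legs. -/
def star (r : ℕ) : Set (ℂ × ℂ × (Fin r → ℝ)) :=
  {x | x.2.2 = 0 ∧ ‖x.1‖ ^ 2 + ‖x.2.1‖ ^ 2 = (r : ℝ) ^ 2 + 1 ∧
    ∀ j : Fin r, (x.1 * (starRingEnd ℂ) (rootOfUnity j)).re ≤ r}

/-- The embedding of the `j`-th copy of `rayDouble`; at `t = 0` its boundary sphere is glued to the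
`j`-th boundary sphere of the star. The last component records the distance along the ray. -/
def rayPoint {r : ℕ} (j : Fin r) (q : ℝ × ℝ × ℂ) : ℂ × ℂ × (Fin r → ℝ) :=
  (rootOfUnity j * ((r : ℝ) + q.2.1 * Complex.I), q.2.2, Pi.single j q.1)

/-- The doubled handlebody `M_{Γ_r}`: the double of a regular neighborhood of `Γ_r`. -/
def DoubledHandlebody (r : ℕ) : Set (ℂ × ℂ × (Fin r → ℝ)) :=
  star r ∪ {x | ∃ (j : Fin r) (q : ℝ × ℝ × ℂ), q ∈ rayDouble ∧ x = rayPoint j q}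

/-- Number of loops of the reference core on the `j`-th ray: all `g` loops are on the first ray. -/
def refCoreLoops {r : ℕ} (g : ℕ) (j : Fin r) : ℕ := if (j : ℕ) = 0 then g else 0

/-- The reference core: a doubled handlebody of rank `g` with `r` boundary spheres, namely the
double of a regular neighborhood of the center star together with the first `g` loops of the first
ray. -/
def refDoubleCore (g r : ℕ) : Set (DoubledHandlebody r) :=
  {x | ∀ j, x.1.2.2 j ≤ 2 * (refCoreLoops g j : ℝ)}

/-- The `j`-th parametrized boundary sphere of the reference core. -/
def refDoubleCoreBoundary {r : ℕ} (g : ℕ) (j : Fin r) (u : UnitSphere) : refDoubleCore g r :=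
  ⟨⟨rayPoint j (2 * refCoreLoops g j, u.1.1, u.1.2),
    Or.inr ⟨j, _, mem_rayDouble_of_sphere _ u, rfl⟩⟩, by
      intro k
      by_cases hk : k = j
      · subst hk
        simp [rayPoint]
      · simp [rayPoint, Pi.single_eq_of_ne hk]⟩

/-- A `(g,h)`-rigid structure on the doubled handlebody `M_{Γ_r}`: a decomposition into a core,
homeomorphic to the reference core, and pieces, homeomorphic to the reference piece by markings
`φ_{i,j}`. Recorded are the inverses of these homeomorphisms, i.e. the embeddings of the reference
pieces. The pieces `(0, j), (1, j), …` form a chain starting at the `j`-th boundary sphere of the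
core, each being glued to the next one by identifying `∂₊` with `∂₋` in their standard
parametrizations; there are no other intersections. -/
structure DoubledRigidStructure (g h r : ℕ) where
  coreMap : refDoubleCore g r → DoubledHandlebody r
  pieceMap : ℕ × Fin r → refDoublePiece h → DoubledHandlebody r
  coreMap_isEmbedding : IsEmbedding coreMap
  pieceMap_isEmbedding : ∀ p, IsEmbedding (pieceMap p)
  cover : Set.range coreMap ∪ ⋃ p, Set.range (pieceMap p) = Set.univ
  locallyFinite : LocallyFinite fun p => Set.range (pieceMap p)
  core_inter_piece : ∀ (i : ℕ) (j : Fin r) (x : refDoubleCore g r) (y : refDoublePiece h),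
    coreMap x = pieceMap (i, j) y ↔
      i = 0 ∧ ∃ u, x = refDoubleCoreBoundary g j u ∧ y = refDoublePieceMinus h u
  piece_inter_piece : ∀ (i i' : ℕ) (j j' : Fin r) (x y : refDoublePiece h),
    (i, j) ≠ (i', j') → (pieceMap (i, j) x = pieceMap (i', j') y ↔
      j = j' ∧
        ((i' = i + 1 ∧ ∃ u, x = refDoublePiecePlus h u ∧ y = refDoublePieceMinus h u) ∨
          (i = i' + 1 ∧ ∃ u, x = refDoublePieceMinus h u ∧ y = refDoublePiecePlus h u)))

namespace DoubledRigidStructure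

variable {g h r : ℕ}

/-- The core of the rigid structure. -/
def core (R : DoubledRigidStructure g h r) : Set (DoubledHandlebody r) := Set.range R.coreMap

/-- The pieces of the rigid structure. -/
def piece (R : DoubledRigidStructure g h r) (p : ℕ × Fin r) : Set (DoubledHandlebody r) :=
  Set.range (R.pieceMap p)

/-- A suited submanifold: a connected union of the core and finitely many pieces. -/
def IsSuited (R : DoubledRigidStructure g h r) (Z : Set (DoubledHandlebody r)) : Prop :=
  IsConnected Z ∧ ∃ T : Finset (ℕ × Fin r), Z = R.core ∪ ⋃ p ∈ T, R.piece p

/-- `f` is rigid outside some suited submanifold `Z` with suited image: each piece `p` outside `Z`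
is mapped to a piece `q` by `φ_q⁻¹ ∘ φ_p`. -/
def IsAsymptoticallyRigid (R : DoubledRigidStructure g h r)
    (f : DoubledHandlebody r ≃ₜ DoubledHandlebody r) : Prop :=
  ∃ Z : Set (DoubledHandlebody r), R.IsSuited Z ∧ R.IsSuited (f '' Z) ∧
    ∀ p, R.piece p ⊆ closure Zᶜ → ∃ q, R.piece q ⊆ closure (f '' Z)ᶜ ∧
      ∀ y, f (R.pieceMap p y) = R.pieceMap q y

/-- The doubled handlebody Houghton group of a rigid structure: the group of isotopy classes of
asymptotically rigid homeomorphisms of `M_{Γ_r}`. Such homeomorphisms automatically preserve the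
orientation, because the markings of all pieces are compatible with one orientation. The classes are
closed under products and inverses; writing the group as the subgroup generated by them only serves
to have the group laws for free. -/
def houghtonGroup (R : DoubledRigidStructure g h r) :
    Subgroup (MapManifold (DoubledHandlebody r)) :=
  Subgroup.closure {u | ∃ f : DoubledHandlebody r ≃ₜ DoubledHandlebody r,
    u = QuotientGroup.mk f ∧ R.IsAsymptoticallyRigid f}

end DoubledRigidStructure

end Houghton

end

/-! After conjugation, each of these groups is generated by classes that, far out, permute the rays
and translate along them. A rigid structure yields a standardizing element F of the mapping class
group, which carries the decomposition into translated copies of the reference piece to the given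
marked decomposition. Conjugation with F turns "φ_q⁻¹ φ_p on all distant pieces" into "translation
by n_j loops from the j-th to the ρ(j)-th ray, beyond some level". Such a translation takes distant
pieces to pieces exactly if c_j + n_j ≡ c_{ρ(j)} modulo h for all j, where c_j is the number of
loops of the standard core on the j-th ray. So the group depends on the rigid structure, up to
conjugation, only through h and c (`congruentTranslations`).

Now let N = h h'. Translations with ρ = 1 and all n_j divisible by N satisfy the congruences for
both structures, whatever c and c' are. The subgroup A that they generate lies in both conjugated
groups, and it has finite index in each, because the generators act on the N residue classes of
levels on each ray and those of A are the ones that act trivially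
(`commensurable_closure_congruentTranslations`). It is never needed that (ρ, n) is an invariant of
the class: labels are a relation, closed under products, between group elements and a finite group.

What remains is to identify the conjugated generators in the two geometric settings. For graphs, F
is glued from the homotopy inverses of the markings, and markings are removed by homotopies relative
to end points, which are proper since they move points a bounded distance
(`mem_congruentTranslations_of_rigid`). The converse must produce a representative that maps a
suited subgraph exactly onto a suited subgraph and pieces exactly onto pieces. The first is arranged
by letting one edge of the core run through the whole target (`exists_surjective_edge`), the second
holds because markings are surjective (`surjective_of_homotopic_id`). For doubled handlebodies, F is
a homeomorphism glued from the parametrizations (`exists_standardizer`), and bijectivity makes both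
directions direct. -/

namespace Houghton

/-! ### Finite index from labels in a finite group -/

section Algebra

variable {M D : Type*} [Group M] [Group D] [Finite D]

/-- The elements of `T` with trivial label generate a subgroup of finite index in the group
generated by all elements of `T`, if the labels lie in a finite group. -/
theorem exists_mem_mul_closure (T : Submonoid (M × D)) {b : M}
    (hb : b ∈ Subgroup.closure {u : M | ∃ d, (u, d) ∈ T}) :
    ∃ t ∈ T, t.1⁻¹ * b ∈ Subgroup.closure {u : M | (u, (1 : D)) ∈ T} := by
  set A := Subgroup.closure {u : M | (u, (1 : D)) ∈ T} with hA
  have hm : 0 < Nat.card D := Nat.card_pos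
  -- `T` contains no inverses, but in a group of order m + 1 the inverse of a label is its m-th
  -- power. Below, t ^ m takes the place of t⁻¹.
  obtain ⟨m, hm⟩ : ∃ m, Nat.card D = m + 1 := ⟨Nat.card D - 1, by omega⟩
  have pow_mem : ∀ t ∈ T, t.1 ^ (m + 1) ∈ A := fun t ht => by
    refine Subgroup.subset_closure ?_
    have h2 : t.2 ^ (m + 1) = 1 := hm ▸ pow_card_eq_one'
    have := T.pow_mem ht (m + 1)
    rw [Prod.pow_def, h2] at this
    exact this
  -- t⁻¹ k t = (t ^ (m + 1))⁻¹ (t ^ m k t), and both t ^ (m + 1) and t ^ m k t have trivial label.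
  have conj_mem : ∀ t ∈ T, ∀ a ∈ A, t.1⁻¹ * a * t.1 ∈ A := by
    intro t ht a ha
    induction ha using Subgroup.closure_induction with
    | mem k hk =>
      have h2 : t.2 ^ (m + 1) = 1 := hm ▸ pow_card_eq_one'
      have h1 : t.1 ^ m * k * t.1 ∈ A := by
        refine Subgroup.subset_closure ?_
        have := T.mul_mem (T.mul_mem (T.pow_mem ht m) hk) ht
        have e : t ^ m * (k, (1 : D)) * t = (t.1 ^ m * k * t.1, 1) := by
          ext
          · simp
          · simp [← pow_succ, h2]
        rwa [e] at this
      have := A.mul_mem (A.inv_mem (pow_mem t ht)) h1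
      convert this using 1
      rw [pow_succ]
      group
    | one => simp
    | mul x y _ _ hx hy =>
      have := A.mul_mem hx hy
      convert this using 1
      group
    | inv x _ hx =>
      have := A.inv_mem hx
      convert this using 1
      group
  induction hb using Subgroup.closure_induction_left with
  | one => exact ⟨1, T.one_mem, by simp⟩
  | mul_left x hx y _ ih =>
    obtain ⟨d, hd⟩ := hx
    obtain ⟨t, ht, h⟩ := ih
    exact ⟨(x, d) * t, T.mul_mem hd ht, by simpa [mul_assoc] using h⟩
  | inv_mul_cancel x hx y _ ih =>
    obtain ⟨d, hd⟩ := hx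
    obtain ⟨t, ht, h⟩ := ih
    -- The representative x ^ m t replaces x⁻¹ t. They differ by x ^ (m + 1) ∈ A, conjugated by an
    -- element of `T`, which is harmless by `conj_mem`.
    have hs : (x, d) ^ m * t ∈ T := T.mul_mem (T.pow_mem hd m) ht
    refine ⟨_, hs, ?_⟩
    have h3 := A.mul_mem (conj_mem _ hs _ (A.inv_mem (pow_mem _ hd))) h
    convert h3 using 1
    simp only [Prod.fst_mul, Prod.pow_fst, pow_succ]
    group

/-- Elements s, t with a common label lie in the same left coset of A, since s⁻¹ t = (s ^ (m + 1))⁻¹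
(s ^ m t). Every left coset in B has a representative from `T` by `exists_mem_mul_closure`, so there
are at most as many cosets as labels. An element may carry several labels; a choice of one for each
coset suffices. -/
theorem finiteIndex_closure_trivial_label (T : Submonoid (M × D)) :
    ((Subgroup.closure {u : M | (u, (1 : D)) ∈ T}).subgroupOf
      (Subgroup.closure {u : M | ∃ d, (u, d) ∈ T})).FiniteIndex := by
  set A := Subgroup.closure {u : M | (u, (1 : D)) ∈ T} with hA
  set B := Subgroup.closure {u : M | ∃ d, (u, d) ∈ T} with hB
  have hm : 0 < Nat.card D := Nat.card_pos
  obtain ⟨m, hm⟩ : ∃ m, Nat.card D = m + 1 := ⟨Nat.card D - 1, by omega⟩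
  have key : ∀ s ∈ T, ∀ t ∈ T, s.2 = t.2 → s.1⁻¹ * t.1 ∈ A := by
    intro s hs t ht hst
    have h2 : s.2 ^ (m + 1) = 1 := hm ▸ pow_card_eq_one'
    have h1 : (s.1 ^ (m + 1))⁻¹ ∈ A := by
      refine A.inv_mem (Subgroup.subset_closure ?_)
      have := T.pow_mem hs (m + 1)
      rw [Prod.pow_def, h2] at this
      exact this
    have h3 : s.1 ^ m * t.1 ∈ A := by
      refine Subgroup.subset_closure ?_
      have := T.mul_mem (T.pow_mem hs m) ht
      have e : s ^ m * t = (s.1 ^ m * t.1, 1) := by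
        ext
        · simp
        · simp [← hst, ← pow_succ, h2]
      rwa [e] at this
    convert A.mul_mem h1 h3 using 1
    rw [pow_succ]
    group
  choose t ht hA' using fun b : B => exists_mem_mul_closure T b.2
  have : Finite (B ⧸ A.subgroupOf B) := by
    refine Finite.of_injective (fun q => (t q.out).2) fun q q' hq => ?_
    rw [← q.out_eq, ← q'.out_eq]
    refine QuotientGroup.eq.2 ?_
    rw [Subgroup.mem_subgroupOf]
    have h1 := A.mul_mem (A.mul_mem (A.inv_mem (hA' q.out)) (key _ (ht _) _ (ht _) hq)) (hA' q'.out)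
    convert h1 using 1
    simp only [Subgroup.coe_mul, InvMemClass.coe_inv]
    group
  exact Subgroup.finiteIndex_of_finite_quotient

/-- Subgroups of finite index in conjugates of two subgroups of a group make them commensurable. -/
theorem commensurable_of_conj {G : Type*} [Group G] {A B B' : Subgroup G} (F F' : G)
    (hA : A ≤ B) (hA' : A ≤ B') (fi : (A.subgroupOf B).FiniteIndex)
    (fi' : (A.subgroupOf B').FiniteIndex) :
    Commensurable (B.map (MulAut.conj F).toMonoidHom) (B'.map (MulAut.conj F').toMonoidHom) := by
  have aux : ∀ (B : Subgroup G) (F : G), A ≤ B → (A.subgroupOf B).FiniteIndex →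
      ∃ C : Subgroup (B.map (MulAut.conj F).toMonoidHom), C.FiniteIndex ∧ Nonempty (C ≃* A) := by
    intro B F hA fi
    let e : B ≃* B.map (MulAut.conj F).toMonoidHom :=
      (MulAut.conj F).subgroupMap B
    refine ⟨(A.subgroupOf B).map e.toMonoidHom, ?_, ⟨?_⟩⟩
    · refine ⟨?_⟩
      have := Subgroup.index_map_equiv (A.subgroupOf B) e
      have h2 := fi.index_ne_zero
      intro h
      apply h2
      rw [← this]
      exact h
    · exact (e.subgroupMap (A.subgroupOf B)).symm.trans (Subgroup.subgroupOfEquivOfLe hA)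
  obtain ⟨C, hC, ⟨e⟩⟩ := aux B F hA fi
  obtain ⟨C', hC', ⟨e'⟩⟩ := aux B' F' hA' fi'
  exact ⟨C, C', hC, hC', ⟨e.trans e'.symm⟩⟩

end Algebra

/-! ### Permuting the rays and translating along them -/

section Translations

variable {M : Type*} [Group M] {r : ℕ}

/-- The elements that permute the rays and translate along them, such that points at distances
`c j` modulo `h` along the `j`-th ray are sent to such points. -/
def congruentTranslations (Tr : M → Equiv.Perm (Fin r) → (Fin r → ℤ) → Prop) (h : ℕ)
    (c : Fin r → ℕ) : Set M :=
  {u | ∃ ρ n, Tr u ρ n ∧ ∀ j, (h : ℤ) ∣ c j + n j - c (ρ j)}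

/-- The action of a permutation of the rays and translations on `N` residue classes on each ray. -/
def residueAction (N : ℕ) (ρ : Equiv.Perm (Fin r)) (n : Fin r → ℤ) :
    Equiv.Perm (Fin r × ZMod N) where
  toFun p := (ρ p.1, p.2 + n p.1)
  invFun p := (ρ.symm p.1, p.2 - n (ρ.symm p.1))
  left_inv p := by simp
  right_inv p := by simp

/-- The label of (ρ, n) is its action on N = h h' residue classes on each ray. The elements with
trivial label form the same set for both structures, so the two groups share a subgroup of finite
index. -/
theorem commensurable_closure_congruentTranslations
    (Tr : M → Equiv.Perm (Fin r) → (Fin r → ℤ) → Prop) (one : Tr 1 1 0)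
    (mul : ∀ u v ρ τ n k, Tr u ρ n → Tr v τ k → Tr (u * v) (ρ * τ) fun j => k j + n (τ j))
    {h h' : ℕ} (hh : 1 ≤ h) (hh' : 1 ≤ h') (c c' : Fin r → ℕ) (F F' : M) :
    Commensurable
      ((Subgroup.closure (congruentTranslations Tr h c)).map (MulAut.conj F).toMonoidHom)
      ((Subgroup.closure (congruentTranslations Tr h' c')).map (MulAut.conj F').toMonoidHom) := by
  set N := h * h' with hN
  have : NeZero N := ⟨by positivity⟩
  have key : ∀ (h : ℕ) (c : Fin r → ℕ), h ∣ N →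
      Subgroup.closure {u | ∃ n, Tr u 1 n ∧ ∀ j, (N : ℤ) ∣ n j} ≤
        Subgroup.closure (congruentTranslations Tr h c) ∧
      ((Subgroup.closure {u | ∃ n, Tr u 1 n ∧ ∀ j, (N : ℤ) ∣ n j}).subgroupOf
        (Subgroup.closure (congruentTranslations Tr h c))).FiniteIndex := by
    intro h c hd
    let T : Submonoid (M × Equiv.Perm (Fin r × ZMod N)) :=
      { carrier := {p | ∃ ρ n, Tr p.1 ρ n ∧ (∀ j, (h : ℤ) ∣ c j + n j - c (ρ j)) ∧
          p.2 = residueAction N ρ n}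
        one_mem' := ⟨1, 0, one, fun j => by simp, by ext <;> simp [residueAction]⟩
        mul_mem' := by
          rintro ⟨u, _⟩ ⟨v, _⟩ ⟨ρ, n, hu, hn, rfl⟩ ⟨τ, k, hv, hk, rfl⟩
          refine ⟨ρ * τ, _, mul _ _ _ _ _ _ hu hv, fun j => ?_, ?_⟩
          · refine (dvd_add (hn (τ j)) (hk j)).trans (dvd_of_eq ?_)
            rw [Equiv.Perm.mul_apply]
            ring
          · refine Equiv.ext fun p => ?_
            simp [residueAction, add_assoc] }
    -- Trivial action means ρ = 1 and N ∣ n j. Since h ∣ N, the congruences modulo h are then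
    -- automatic, so this set no longer depends on h and c.
    have e1 : {u : M | (u, (1 : Equiv.Perm (Fin r × ZMod N))) ∈ T} =
        {u | ∃ n, Tr u 1 n ∧ ∀ j, (N : ℤ) ∣ n j} := by
      ext u
      constructor
      · rintro ⟨ρ, n, hu, -, hρ⟩
        have h1 : ∀ j, (ρ j, ((n j : ℤ) : ZMod N)) = (j, 0) := fun j => by
          have := DFunLike.congr_fun hρ (j, 0)
          simpa [residueAction] using this.symm
        have h2 : ρ = 1 := Equiv.ext fun j => congrArg Prod.fst (h1 j)
        subst h2
        exact ⟨n, hu, fun j => (ZMod.intCast_zmod_eq_zero_iff_dvd _ _).1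
          (congrArg Prod.snd (h1 j))⟩
      · rintro ⟨n, hu, hn⟩
        refine ⟨1, n, hu, fun j => ?_, ?_⟩
        · simpa using (Int.natCast_dvd_natCast.2 hd).trans (hn j)
        · refine Equiv.ext fun p => ?_
          have := (ZMod.intCast_zmod_eq_zero_iff_dvd _ _).2 (hn p.1)
          simp [residueAction, this]
    have e2 : {u : M | ∃ d, (u, d) ∈ T} = congruentTranslations Tr h c := by
      ext u
      constructor
      · rintro ⟨_, ρ, n, hu, hn, -⟩
        exact ⟨ρ, n, hu, hn⟩
      · rintro ⟨ρ, n, hu, hn⟩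
        exact ⟨_, ρ, n, hu, hn, rfl⟩
    have := finiteIndex_closure_trivial_label T
    rw [e1, e2] at this
    refine ⟨?_, this⟩
    rw [← e1, ← e2]
    exact Subgroup.closure_mono fun u hu => ⟨1, hu⟩
  obtain ⟨a, b⟩ := key h c ⟨h', rfl⟩
  obtain ⟨a', b'⟩ := key h' c' ⟨h, by rw [hN, mul_comm]⟩
  exact commensurable_of_conj F F' a a' b b'

/-- Groups generated by conjugates of `congruentTranslations` are commensurable. -/
theorem commensurable_closure_of_conj
    (Tr : M → Equiv.Perm (Fin r) → (Fin r → ℤ) → Prop) (one : Tr 1 1 0)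
    (mul : ∀ u v ρ τ n k, Tr u ρ n → Tr v τ k → Tr (u * v) (ρ * τ) fun j => k j + n (τ j))
    {h h' : ℕ} (hh : 1 ≤ h) (hh' : 1 ≤ h') (c c' : Fin r → ℕ) (F F' : M) {S S' : Set M}
    (hS : ∀ u, F * u * F⁻¹ ∈ S ↔ u ∈ congruentTranslations Tr h c)
    (hS' : ∀ u, F' * u * F'⁻¹ ∈ S' ↔ u ∈ congruentTranslations Tr h' c') :
    Commensurable (Subgroup.closure S) (Subgroup.closure S') := by
  have aux : ∀ (F : M) (S S₀ : Set M), (∀ u, F * u * F⁻¹ ∈ S ↔ u ∈ S₀) →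
      Subgroup.closure S = (Subgroup.closure S₀).map (MulAut.conj F).toMonoidHom := by
    intro F S S₀ hS
    rw [MonoidHom.map_closure]
    congr 1
    ext u
    constructor
    · intro hu
      refine ⟨F⁻¹ * u * F, (hS _).1 ?_, ?_⟩
      · convert hu using 1
        group
      · simp [mul_assoc]
    · rintro ⟨v, hv, rfl⟩
      simpa using (hS v).2 hv
  rw [aux F S _ hS, aux F' S' _ hS']
  exact commensurable_closure_congruentTranslations Tr one mul hh hh' c c' F F'

end Translations

/-! ### Proper maps -/

/-- The preimage of a compact set under `k` lies in the preimage under `f` of its closed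
`B`-neighborhood, which is compact in a proper space. All homotopies of the graph below are shown to
be proper by bounding displacements in this way. -/
theorem isProperMap_of_dist_le {Y X : Type*} [TopologicalSpace Y] [MetricSpace X] [ProperSpace X]
    {f k : Y → X} (hf : IsProperMap f) (hk : Continuous k) {B : ℝ}
    (h : ∀ y, dist (k y) (f y) ≤ B) : IsProperMap k := by
  rw [isProperMap_iff_isCompact_preimage]
  refine ⟨hk, fun K hK => ?_⟩
  have h1 : IsCompact (f ⁻¹' Metric.cthickening B K) := hf.isCompact_preimage hK.cthickening
  refine h1.of_isClosed_subset (hK.isClosed.preimage hk) fun y hy => ?_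
  exact Metric.mem_cthickening_of_dist_le (f y) (k y) B K hy (by rw [dist_comm]; exact h y)

theorem ProperHomotopic.of_dist_le {X : Type*} [MetricSpace X] [ProperSpace X] {f k : C(X, X)}
    (hf : IsProperMap f) (H : C(I × X, X)) (h0 : ∀ x, H (0, x) = f x) (h1 : ∀ x, H (1, x) = k x)
    {B : ℝ} (h : ∀ p, dist (H p) (f p.2) ≤ B) : ProperHomotopic f k :=
  ⟨⟨H, h0, h1⟩, isProperMap_of_dist_le (f := fun p : I × X => f p.2)
    (hf.comp isProperMap_snd_of_compactSpace) H.continuous h⟩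

/-! ### The looped ray and the graph -/

theorem re_sub_le_of_loop {z : ℂ} {a : ℝ} (h : ‖z - ((a : ℝ) + (1 / 2 : ℝ) * Complex.I)‖ = 1 / 2) :
    |z.re - a| ≤ 1 / 2 := by
  have := Complex.abs_re_le_norm (z - ((a : ℝ) + (1 / 2 : ℝ) * Complex.I))
  rw [h] at this
  simpa using this

theorem norm_im_le_of_loop {z : ℂ} {a : ℝ}
    (h : ‖z - ((a : ℝ) + (1 / 2 : ℝ) * Complex.I)‖ = 1 / 2) : |z.im - 1 / 2| ≤ 1 / 2 := by
  have := Complex.abs_im_le_norm (z - ((a : ℝ) + (1 / 2 : ℝ) * Complex.I))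
  rw [h] at this
  simpa using this

theorem mem_loopedRay {z : ℂ} : z ∈ loopedRay ↔ (z.im = 0 ∧ 0 ≤ z.re) ∨
    ∃ k : ℕ, ‖z - (((2 * k + 2 : ℝ) : ℝ) + (1 / 2 : ℝ) * Complex.I)‖ = 1 / 2 := by
  simp [loopedRay]

theorem mem_refPiece {h : ℕ} {z : ℂ} : z ∈ refPiece h ↔ (z.im = 0 ∧ 0 ≤ z.re ∧ z.re ≤ 2 * h) ∨
    ∃ k : ℕ, k < h ∧ ‖z - (((2 * k + 1 : ℝ) : ℝ) + (1 / 2 : ℝ) * Complex.I)‖ = 1 / 2 := by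
  simp [refPiece]

theorem re_nonneg_of_mem_loopedRay {z : ℂ} (hz : z ∈ loopedRay) : 0 ≤ z.re := by
  rcases mem_loopedRay.1 hz with h | ⟨k, h⟩
  · exact h.2
  · have := abs_le.1 (re_sub_le_of_loop h)
    have : (0 : ℝ) ≤ k := k.cast_nonneg
    linarith

theorem abs_im_le_of_mem_loopedRay {z : ℂ} (hz : z ∈ loopedRay) : |z.im| ≤ 1 := by
  rcases mem_loopedRay.1 hz with h | ⟨k, h⟩
  · simp [h.1]
  · have := abs_le.1 (norm_im_le_of_loop h)
    rw [abs_le]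
    constructor <;> linarith

/-- The loops have radius 1/2 and even attaching points, so none of them meets a line Re z = 2a + 1.
Hence the valence two vertices are cut points, and they are the only places where core and pieces
meet. -/
theorem eq_of_re_eq_odd {z : ℂ} (hz : z ∈ loopedRay) {a : ℕ} (ha : z.re = 2 * a + 1) :
    z = ((2 * a + 1 : ℝ) : ℂ) := by
  rcases mem_loopedRay.1 hz with h | ⟨k, h⟩
  · exact Complex.ext (by simpa using ha) (by simpa using h.1)
  · exfalso
    have := abs_le.1 (re_sub_le_of_loop h)
    rw [ha] at this
    have h1 : (2 * k : ℝ) < 2 * a := by linarith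
    have h2 : (2 * a : ℝ) < 2 * k + 2 := by linarith
    norm_cast at h1 h2
    omega

theorem isClosed_loopedRay : IsClosed loopedRay := by
  have e : loopedRay = {z : ℂ | z.im = 0 ∧ 0 ≤ z.re} ∪
      ⋃ k : ℕ, {z : ℂ | ‖z - (((2 * k + 2 : ℝ) : ℝ) + (1 / 2 : ℝ) * Complex.I)‖ = 1 / 2} := by
    ext z
    simp only [mem_loopedRay, Set.mem_union, Set.mem_iUnion, Set.mem_ofPred_eq]
  rw [e]
  refine IsClosed.union ?_ (LocallyFinite.isClosed_iUnion ?_ fun k => ?_)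
  · exact (isClosed_eq Complex.continuous_im continuous_const).inter
      (isClosed_le continuous_const Complex.continuous_re)
  · intro z
    refine ⟨{w | w.re < z.re + 1}, (isOpen_lt Complex.continuous_re continuous_const).mem_nhds
      (by simp), (Set.finite_lt_nat ⌈z.re + 1⌉₊).subset ?_⟩
    rintro k ⟨w, hw, hw'⟩
    have h1 := abs_le.1 (re_sub_le_of_loop hw)
    have h2 : w.re < z.re + 1 := hw'
    rw [Set.mem_ofPred_eq, Nat.lt_ceil]
    have : (0 : ℝ) ≤ k := k.cast_nonneg
    linarith
  · exact isClosed_eq (by fun_prop) continuous_const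

theorem isClosed_graph (r : ℕ) : IsClosed (Graph r) := by
  have e : Graph r = ⋃ j : Fin r, {x : Fin r → ℂ | x j ∈ loopedRay ∧ ∀ i, i ≠ j → x i = 0} := by
    ext x
    simp only [Graph, Set.mem_iUnion, Set.mem_ofPred_eq]
    refine exists_congr fun j => ?_
    constructor
    · rintro ⟨z, hz, rfl⟩
      exact ⟨by simpa using hz, fun i hi => by simp [hi]⟩
    · rintro ⟨hz, h⟩
      refine ⟨_, hz, funext fun i => ?_⟩
      by_cases hi : i = j
      · subst hi
        simp
      · rw [h i hi, Pi.single_eq_of_ne hi]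
  rw [e]
  refine isClosed_iUnion_of_finite fun j => ?_
  refine IsClosed.and ?_ ?_
  · exact isClosed_loopedRay.preimage (f := fun x : Fin r → ℂ => x j) (continuous_apply j)
  · have : {x : Fin r → ℂ | ∀ i, i ≠ j → x i = 0} = ⋂ (i : Fin r) (_ : i ≠ j), {x | x i = 0} := by
      ext x
      simp
    rw [this]
    exact isClosed_iInter fun i => isClosed_iInter fun _ =>
      isClosed_eq (continuous_apply i) continuous_const

instance (r : ℕ) : ProperSpace (Graph r) := 
  ⟨fun x R =>
    (isClosed_graph r).isClosedEmbedding_subtypeVal.isCompact_preimage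
      (isCompact_closedBall x.1 R)⟩

/-- The point `z` of the `j`-th looped ray. -/
def rayPt {r : ℕ} (j : Fin r) (z : ℂ) (hz : z ∈ loopedRay) : Graph r :=
  ⟨Pi.single j z, j, z, hz, rfl⟩

variable {r : ℕ}

theorem exists_rayPt (x : Graph r) : ∃ j z hz, x = rayPt j z hz := by
  obtain ⟨x, j, z, hz, rfl⟩ := x
  exact ⟨j, z, hz, rfl⟩

@[simp] theorem rayPt_val (j : Fin r) (z : ℂ) (hz) : (rayPt j z hz).1 = Pi.single j z := rfl

theorem continuous_coord (j : Fin r) : Continuous fun x : Graph r => x.1 j :=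
  (continuous_apply j).comp continuous_subtype_val

theorem continuous_coord_re (j : Fin r) : Continuous fun x : Graph r => (x.1 j).re :=
  Complex.continuous_re.comp (continuous_coord j)

theorem mem_loopedRay_of_mem (x : Graph r) (j : Fin r) : x.1 j ∈ loopedRay := by
  obtain ⟨i, z, hz, rfl⟩ := exists_rayPt x
  by_cases h : j = i
  · subst h
    simpa using hz
  · simp [Pi.single_eq_of_ne h, loopedRay]

theorem eq_single_of_re_pos {x : Graph r} {j : Fin r} (h : 0 < (x.1 j).re) :
    x.1 = Pi.single j (x.1 j) := by
  obtain ⟨i, z, hz, rfl⟩ := exists_rayPt x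
  by_cases hi : j = i
  · subst hi
    simp
  · simp [Pi.single_eq_of_ne hi] at h

/-- On all other rays the j-th coordinate vanishes, so a positive lower bound for its real part
already forces a point onto the j-th ray. -/
theorem mem_raySegment {x : Graph r} {j : Fin r} {a b : ℕ} :
    x ∈ raySegment j a b ↔ 2 * (a : ℝ) + 1 ≤ (x.1 j).re ∧ (x.1 j).re ≤ 2 * (b : ℝ) + 1 := by
  constructor
  · rintro ⟨z, hz, h1, h2⟩
    rw [hz]
    simpa using ⟨h1, h2⟩
  · rintro ⟨h1, h2⟩
    exact ⟨_, eq_single_of_re_pos (lt_of_lt_of_le (by positivity) h1), h1, h2⟩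

theorem isClosed_raySegment (j : Fin r) (a b : ℕ) : IsClosed (raySegment j a b) := by
  have : raySegment j a b =
      {x : Graph r | 2 * (a : ℝ) + 1 ≤ (x.1 j).re ∧ (x.1 j).re ≤ 2 * (b : ℝ) + 1} :=
    Set.ext fun _ => mem_raySegment
  rw [this]
  have hc := continuous_coord_re (r := r) j
  exact (isClosed_le continuous_const hc).inter (isClosed_le hc continuous_const)

theorem eq_cutVertex_of_re {x : Graph r} {j : Fin r} {a : ℕ} (h : (x.1 j).re = 2 * a + 1) :
    x = cutVertex j a := by
  have h1 := eq_of_re_eq_odd (mem_loopedRay_of_mem x j) h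
  refine Subtype.ext ?_
  rw [eq_single_of_re_pos (x := x) (j := j) (by rw [h]; positivity), h1]
  simp [cutVertex]

@[simp] theorem cutVertex_re (j : Fin r) (a : ℕ) : ((cutVertex j a).1 j).re = 2 * a + 1 := by
  simp [cutVertex]

theorem cutVertex_inj {j j' : Fin r} {a a' : ℕ} (h : cutVertex j a = cutVertex j' a') :
    j = j' ∧ a = a' := by
  have h1 := cutVertex_re j a
  rw [h] at h1
  by_cases hj : j = j'
  · subst hj
    rw [cutVertex_re] at h1
    refine ⟨rfl, ?_⟩
    have : (a' : ℝ) = a := by linarith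
    exact_mod_cast this.symm
  · simp [cutVertex, Pi.single_eq_of_ne hj] at h1
    have : (0 : ℝ) ≤ a := a.cast_nonneg
    linarith

theorem dist_le_of_mem_raySegment {j : Fin r} {a b : ℕ} {x y : Graph r} (hx : x ∈ raySegment j a b)
    (hy : y ∈ raySegment j a b) : dist x y ≤ 2 * ((b : ℝ) - a) + 2 := by
  rw [mem_raySegment] at hx hy
  have h0 : (0 : ℝ) ≤ 2 * ((b : ℝ) - a) + 2 := by linarith
  rw [Subtype.dist_eq, dist_pi_le_iff h0]
  intro i
  by_cases hi : i = j
  · subst hi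
    rw [Complex.dist_eq]
    refine (Complex.norm_le_abs_re_add_abs_im _).trans ?_
    have h1 := abs_le.1 (abs_im_le_of_mem_loopedRay (mem_loopedRay_of_mem x i))
    have h2 := abs_le.1 (abs_im_le_of_mem_loopedRay (mem_loopedRay_of_mem y i))
    have h3 : |(x.1 i - y.1 i).re| ≤ 2 * ((b : ℝ) - a) := by
      rw [Complex.sub_re, abs_le]
      constructor <;> linarith
    have h4 : |(x.1 i - y.1 i).im| ≤ 2 := by
      rw [Complex.sub_im, abs_le]
      constructor <;> linarith
    linarith
  · rw [eq_single_of_re_pos (x := x) (j := j) (lt_of_lt_of_le (by positivity) hx.1),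
      eq_single_of_re_pos (x := y) (j := j) (lt_of_lt_of_le (by positivity) hy.1)]
    simpa [Pi.single_eq_of_ne hi] using h0

theorem add_mem_loopedRay {z : ℂ} {h a : ℕ} (hz : z ∈ refPiece h) :
    z + ((2 * a + 1 : ℝ) : ℂ) ∈ loopedRay := by
  rcases mem_refPiece.1 hz with h | ⟨k, hk, hn⟩
  · refine Or.inl ⟨by simpa using h.1, ?_⟩
    have : (0 : ℝ) ≤ a := a.cast_nonneg
    rw [Complex.add_re, Complex.ofReal_re]
    linarith [h.2.1]
  · refine mem_loopedRay.2 (Or.inr ⟨k + a, ?_⟩)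
    refine (congrArg norm ?_).trans hn
    push_cast
    ring

theorem re_mem_of_mem_refPiece {z : ℂ} {h : ℕ} (hz : z ∈ refPiece h) :
    0 ≤ z.re ∧ z.re ≤ 2 * h := by
  rcases mem_refPiece.1 hz with h | ⟨k, hk, hn⟩
  · exact h.2
  · have h1 := abs_le.1 (re_sub_le_of_loop hn)
    have : (0 : ℝ) ≤ k := k.cast_nonneg
    have : (k : ℝ) + 1 ≤ h := by exact_mod_cast hk
    constructor <;> linarith

theorem sub_mem_refPiece {z : ℂ} {h a : ℕ} (hz : z ∈ loopedRay) (h1 : 2 * (a : ℝ) + 1 ≤ z.re)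
    (h2 : z.re ≤ 2 * ((a + h : ℕ) : ℝ) + 1) : z - ((2 * a + 1 : ℝ) : ℂ) ∈ refPiece h := by
  push_cast at h2
  rcases mem_loopedRay.1 hz with h | ⟨k, hn⟩
  · refine Or.inl ⟨by simpa using h.1, ?_, ?_⟩ <;>
    · rw [Complex.sub_re, Complex.ofReal_re]
      linarith
  · have h3 := abs_le.1 (re_sub_le_of_loop hn)
    have h4 : (2 * a : ℝ) < 2 * k + 2 := by linarith
    have h5 : (2 * k : ℝ) < 2 * a + 2 * h := by linarith
    norm_cast at h4 h5
    obtain ⟨l, rfl⟩ : ∃ l, k = a + l := ⟨k - a, by omega⟩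
    refine mem_refPiece.2 (Or.inr ⟨l, by omega, ?_⟩)
    refine (congrArg norm ?_).trans hn
    push_cast
    ring

theorem rayPt_add_mem_raySegment (j : Fin r) {a b h : ℕ} (e : b = a + h) {y : ℂ}
    (hy : y ∈ refPiece h) :
    rayPt j (y + ((2 * a + 1 : ℝ) : ℂ)) (add_mem_loopedRay hy) ∈ raySegment j a b := by
  have := re_mem_of_mem_refPiece hy
  rw [mem_raySegment, rayPt_val, Pi.single_eq_same, Complex.add_re, Complex.ofReal_re, e]
  push_cast
  constructor <;> linarith

theorem coord_sub_mem_refPiece {j : Fin r} {a b h : ℕ} (e : b = a + h) {x : Graph r}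
    (hx : x ∈ raySegment j a b) : x.1 j - ((2 * a + 1 : ℝ) : ℂ) ∈ refPiece h := by
  have := mem_raySegment.1 hx
  subst e
  exact sub_mem_refPiece (mem_loopedRay_of_mem _ _) this.1 this.2

/-- The translation of a segment of a ray to the reference piece. -/
def segmentHomeo (j : Fin r) {a b h : ℕ} (e : b = a + h) : raySegment j a b ≃ₜ refPiece h where
  toFun x := ⟨x.1.1 j - ((2 * a + 1 : ℝ) : ℂ), coord_sub_mem_refPiece e x.2⟩
  invFun y := ⟨rayPt j (y.1 + ((2 * a + 1 : ℝ) : ℂ)) (add_mem_loopedRay y.2),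
    rayPt_add_mem_raySegment j e y.2⟩
  left_inv x := by
    refine Subtype.ext (Subtype.ext ?_)
    have := mem_raySegment.1 x.2
    rw [eq_single_of_re_pos (x := x.1) (j := j) (lt_of_lt_of_le (by positivity) this.1)]
    simp
  right_inv y := by
    refine Subtype.ext ?_
    simp
  continuous_toFun :=
    (((continuous_coord j).comp continuous_subtype_val).sub continuous_const).subtype_mk _
  continuous_invFun := by
    refine Continuous.subtype_mk (Continuous.subtype_mk ?_ _) _
    exact (continuous_single j).comp (by fun_prop)

theorem segmentHomeo_minus (j : Fin r) {a b h : ℕ} (e : b = a + h) :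
    segmentHomeo j e ⟨cutVertex j a, cutVertex_mem_left j (by omega)⟩ = refPieceMinus h :=
  Subtype.ext (by simp [segmentHomeo, cutVertex, refPieceMinus])

theorem segmentHomeo_plus (j : Fin r) {a b h : ℕ} (e : b = a + h) :
    segmentHomeo j e ⟨cutVertex j b, cutVertex_mem_right j (by omega)⟩ = refPiecePlus h :=
  Subtype.ext (by simp [segmentHomeo, cutVertex, refPiecePlus, e]; ring)

namespace GraphRigidStructure

variable {g h r : ℕ} (R : GraphRigidStructure g h r)

/-! ### The decomposition into core and pieces -/

theorem mem_piece {x : Graph r} {p : ℕ × Fin r} : x ∈ R.piece p ↔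
    2 * ((R.coreLoops p.2 + h * p.1 : ℕ) : ℝ) + 1 ≤ (x.1 p.2).re ∧
      (x.1 p.2).re ≤ 2 * ((R.coreLoops p.2 + h * (p.1 + 1) : ℕ) : ℝ) + 1 :=
  mem_raySegment

/-- The end points of a piece. -/
def ends (p : ℕ × Fin r) : Set (Graph r) :=
  {cutVertex p.2 (R.coreLoops p.2 + h * p.1), cutVertex p.2 (R.coreLoops p.2 + h * (p.1 + 1))}

theorem isClosed_piece (p : ℕ × Fin r) : IsClosed (R.piece p) := isClosed_raySegment _ _ _

theorem isClosed_core : IsClosed R.core := by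
  have : R.core = ⋂ j, {x : Graph r | (x.1 j).re ≤ 2 * (R.coreLoops j : ℝ) + 1} := by
    ext x
    simp [core]
  rw [this]
  exact isClosed_iInter fun j => isClosed_le (continuous_coord_re j) continuous_const

/-- The core and the pieces. -/
def part : Option (ℕ × Fin r) → Set (Graph r)
  | none => R.core
  | some p => R.piece p

theorem isClosed_part (o) : IsClosed (R.part o) := by
  cases o
  · exact R.isClosed_core
  · exact R.isClosed_piece _

theorem mem_ends_of_mem_core {x : Graph r} {p : ℕ × Fin r} (hx : x ∈ R.core)
    (hp : x ∈ R.piece p) : x ∈ R.ends p := by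
  rw [mem_piece] at hp
  refine Or.inl (eq_cutVertex_of_re (le_antisymm ?_ hp.1))
  refine (hx p.2).trans ?_
  push_cast
  have : (0 : ℝ) ≤ h * p.1 := by positivity
  linarith

theorem mem_ends_of_mem_piece {x : Graph r} {p q : ℕ × Fin r} (hpq : p ≠ q)
    (hp : x ∈ R.piece p) (hq : x ∈ R.piece q) : x ∈ R.ends p := by
  obtain ⟨i, j⟩ := p
  obtain ⟨i', j'⟩ := q
  have hp' := hp
  rw [mem_piece] at hp hq
  have h1 : j = j' := by
    by_contra hne
    have h0 : 0 < (x.1 j).re := lt_of_lt_of_le (by positivity) hp.1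
    have h0' : 0 < (x.1 j').re := lt_of_lt_of_le (by positivity) hq.1
    rw [eq_single_of_re_pos h0] at h0'
    simp [Pi.single_eq_of_ne (Ne.symm hne)] at h0'
  subst h1
  rcases lt_trichotomy i i' with hi | hi | hi
  · refine Or.inr (eq_cutVertex_of_re (le_antisymm hp.2 (le_trans ?_ hq.1)))
    have : R.coreLoops j + h * (i + 1) ≤ R.coreLoops j + h * i' := by gcongr; omega
    have : ((R.coreLoops j + h * (i + 1) : ℕ) : ℝ) ≤ (R.coreLoops j + h * i' : ℕ) := by
      exact_mod_cast this
    simp only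
    linarith
  · exact absurd (by rw [hi]) hpq
  · refine Or.inl (eq_cutVertex_of_re (le_antisymm (hq.2.trans ?_) hp.1))
    have : R.coreLoops j + h * (i' + 1) ≤ R.coreLoops j + h * i := by gcongr; omega
    have : ((R.coreLoops j + h * (i' + 1) : ℕ) : ℝ) ≤ (R.coreLoops j + h * i : ℕ) := by
      exact_mod_cast this
    simp only
    linarith

theorem exists_mem_piece (hh : 1 ≤ h) {x : Graph r} {j : Fin r}
    (hx : 2 * (R.coreLoops j : ℝ) + 1 ≤ (x.1 j).re) : ∃ i, x ∈ R.piece (i, j) := by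
  have hpos : (0 : ℝ) < 2 * h := by positivity
  set y := ((x.1 j).re - (2 * (R.coreLoops j : ℝ) + 1)) / (2 * h) with hy
  have hy0 : 0 ≤ y := div_nonneg (by linarith) hpos.le
  have hxy : (x.1 j).re = y * (2 * h) + (2 * (R.coreLoops j : ℝ) + 1) := by
    rw [hy]
    field_simp
    ring
  refine ⟨⌊y⌋₊, (R.mem_piece).2 ⟨?_, ?_⟩⟩
  · have h1 := Nat.floor_le hy0
    have := mul_le_mul_of_nonneg_right h1 hpos.le
    rw [hxy]
    push_cast
    linarith
  · have h1 := (Nat.lt_floor_add_one y).le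
    have := mul_le_mul_of_nonneg_right h1 hpos.le
    rw [hxy]
    push_cast
    linarith

theorem iUnion_part (hh : 1 ≤ h) : ⋃ o, R.part o = Set.univ := by
  refine Set.eq_univ_of_forall fun x => ?_
  by_cases hx : x ∈ R.core
  · exact Set.mem_iUnion.2 ⟨none, hx⟩
  · simp only [core, Set.mem_ofPred_eq, not_forall, not_le] at hx
    obtain ⟨j, hj⟩ := hx
    obtain ⟨i, hi⟩ := R.exists_mem_piece hh hj.le
    exact Set.mem_iUnion.2 ⟨some (i, j), hi⟩

theorem exists_mem_piece_of_re (hh : 1 ≤ h) {x : Graph r} {j : Fin r} {m : ℕ}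
    (hx : 2 * ((R.coreLoops j + h * m : ℕ) : ℝ) + 1 ≤ (x.1 j).re) :
    ∃ i, m ≤ i ∧ x ∈ R.piece (i, j) := by
  have hx' : 2 * (R.coreLoops j : ℝ) + 1 ≤ (x.1 j).re := by
    refine le_trans ?_ hx
    push_cast
    have : (0 : ℝ) ≤ h * m := by positivity
    linarith
  obtain ⟨i, hi⟩ := R.exists_mem_piece hh hx'
  rcases le_or_gt m i with hmi | hmi
  · exact ⟨i, hmi, hi⟩
  · have h2 := (R.mem_piece.1 hi).2
    have h1 : R.coreLoops j + h * (i + 1) ≤ R.coreLoops j + h * m := by gcongr; omega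
    have h3 : ((R.coreLoops j + h * (i + 1) : ℕ) : ℝ) ≤ (R.coreLoops j + h * m : ℕ) := by
      exact_mod_cast h1
    simp only at h2
    -- The piece found ends at or before the level m, so x can only be the cut vertex at this level,
    -- which also begins the m-th piece.
    have h4 : (x.1 j).re = 2 * ((R.coreLoops j + h * m : ℕ) : ℝ) + 1 := by linarith
    rw [eq_cutVertex_of_re h4]
    exact ⟨m, le_rfl, cutVertex_mem_left _ (by gcongr; omega)⟩

theorem locallyFinite_part (hh : 1 ≤ h) : LocallyFinite R.part := by
  intro x
  have hU : IsOpen {y : Graph r | ∀ j, (y.1 j).re < (x.1 j).re + 1} := by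
    have : {y : Graph r | ∀ j, (y.1 j).re < (x.1 j).re + 1} =
        ⋂ j, {y : Graph r | (y.1 j).re < (x.1 j).re + 1} := by
      ext y
      simp
    rw [this]
    exact isOpen_iInter_of_finite fun j => isOpen_lt (continuous_coord_re j) continuous_const
  refine ⟨_, hU.mem_nhds (by simp), ?_⟩
  have hfin : (Set.insert none (some '' {p : ℕ × Fin r | p.1 < ⌈(x.1 p.2).re + 1⌉₊})).Finite := by
    refine Set.Finite.insert _ (Set.Finite.image _ ?_)
    refine (Set.finite_iUnion fun j : Fin r =>
      ((Set.finite_lt_nat ⌈(x.1 j).re + 1⌉₊).image fun i => (i, j))).subset ?_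
    rintro ⟨i, j⟩ hi
    exact Set.mem_iUnion.2 ⟨j, i, hi, rfl⟩
  refine hfin.subset ?_
  rintro (_ | ⟨i, j⟩) ⟨y, hy, hy'⟩
  · exact Or.inl rfl
  · refine Or.inr ⟨_, ?_, rfl⟩
    have h1 := (R.mem_piece.1 hy).1
    have h2 := hy' j
    have h3 : (i : ℝ) ≤ (h : ℝ) * i := by
      have : i ≤ h * i := Nat.le_mul_of_pos_left i hh
      exact_mod_cast this
    rw [Set.mem_ofPred_eq, Nat.lt_ceil]
    push_cast at h1
    have : (0 : ℝ) ≤ R.coreLoops j := by positivity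
    have : (0 : ℝ) ≤ i := by positivity
    linarith

/-- Maps on the pieces that agree with a given map at the end points of the pieces can be glued,
with the given map on the core. -/
theorem exists_glue (hh : 1 ≤ h) {X Y : Type*} [TopologicalSpace X] [TopologicalSpace Y]
    (π : C(X, Graph r)) (base : C(X, Y)) (K : ∀ p, C({x : X // π x ∈ R.piece p}, Y))
    (hK : ∀ p x, π x.1 ∈ R.ends p → K p x = base x.1) :
    ∃ k : C(X, Y), (∀ x, π x ∈ R.core → k x = base x) ∧
      ∀ p (x : {x : X // π x ∈ R.piece p}), k x.1 = K p x := by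
  classical
  -- The choice of the piece does not matter: different pieces, or a piece and the core, meet only
  -- in end points, where all maps agree with `base`. The map π allows gluing homotopies too, with X
  -- = I × Γ_r and π the projection.
  let k : X → Y := fun x =>
    if hx : ∃ p, π x ∈ R.piece p then K hx.choose ⟨x, hx.choose_spec⟩ else base x
  have k2 : ∀ p (x : {x : X // π x ∈ R.piece p}), k x.1 = K p x := by
    rintro p ⟨x, hx⟩
    have hx' : ∃ p, π x ∈ R.piece p := ⟨p, hx⟩
    have e : k x = K hx'.choose ⟨x, hx'.choose_spec⟩ := dif_pos hx'
    by_cases hp : hx'.choose = p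
    · rw [e]
      subst hp
      rfl
    · rw [e, hK _ _ (R.mem_ends_of_mem_piece hp hx'.choose_spec hx),
        hK _ _ (R.mem_ends_of_mem_piece (Ne.symm hp) hx hx'.choose_spec)]
  have k1 : ∀ x, π x ∈ R.core → k x = base x := by
    intro x hx
    by_cases hx' : ∃ p, π x ∈ R.piece p
    · obtain ⟨p, hp⟩ := hx'
      rw [k2 p ⟨x, hp⟩, hK _ _ (R.mem_ends_of_mem_core hx hp)]
    · exact dif_neg hx'
  refine ⟨⟨k, ?_⟩, k1, k2⟩
  refine LocallyFinite.continuous (f := fun o => π ⁻¹' R.part o)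
    ((R.locallyFinite_part hh).preimage_continuous π.continuous) ?_
    (fun o => (R.isClosed_part o).preimage π.continuous) ?_
  · rw [← Set.preimage_iUnion, R.iUnion_part hh, Set.preimage_univ]
  · rintro (_ | p)
    · exact base.continuous.continuousOn.congr k1
    · rw [continuousOn_iff_continuous_domRestrict]
      exact (K p).continuous.congr fun x => (k2 p x).symm

theorem forall_of_part (hh : 1 ≤ h) {P : Graph r → Prop} (h1 : ∀ x ∈ R.core, P x)
    (h2 : ∀ p, ∀ x ∈ R.piece p, P x) (x : Graph r) : P x := by
  have := (Set.ext_iff.1 (R.iUnion_part hh) x).2 trivial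
  obtain ⟨_ | p, hp⟩ := Set.mem_iUnion.1 this
  · exact h1 x hp
  · exact h2 p x hp

theorem dist_le_of_mem_piece {p : ℕ × Fin r} {x y : Graph r} (hx : x ∈ R.piece p)
    (hy : y ∈ R.piece p) : dist x y ≤ 2 * h + 2 := by
  refine (dist_le_of_mem_raySegment hx hy).trans (le_of_eq ?_)
  push_cast
  ring

/-! ### Standardizing the markings -/

/-- The translation of a piece to the reference piece. -/
def shift (p : ℕ × Fin r) : R.piece p ≃ₜ refPiece h :=
  segmentHomeo p.2 (by ring)

/-- The end point of a piece that is nearer to the core. -/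
def minusPt (p : ℕ × Fin r) : R.piece p :=
  ⟨cutVertex p.2 (R.coreLoops p.2 + h * p.1), cutVertex_mem_left _ (by gcongr; omega)⟩

/-- The end point of a piece that is farther from the core. -/
def plusPt (p : ℕ × Fin r) : R.piece p :=
  ⟨cutVertex p.2 (R.coreLoops p.2 + h * (p.1 + 1)), cutVertex_mem_right _ (by gcongr; omega)⟩

theorem mem_ends {p : ℕ × Fin r} {x : R.piece p} :
    x.1 ∈ R.ends p ↔ x ∈ ({R.minusPt p, R.plusPt p} : Set (R.piece p)) := by
  simp only [ends, Set.mem_insert_iff, Set.mem_singleton_iff, Subtype.ext_iff]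
  rfl

theorem shift_minus (p : ℕ × Fin r) : R.shift p (R.minusPt p) = refPieceMinus h :=
  segmentHomeo_minus _ _

theorem shift_plus (p : ℕ × Fin r) : R.shift p (R.plusPt p) = refPiecePlus h :=
  segmentHomeo_plus _ _

theorem shift_symm_minus (p : ℕ × Fin r) :
    (R.shift p).symm (refPieceMinus h) = R.minusPt p := by
  rw [Homeomorph.symm_apply_eq, shift_minus]

theorem shift_symm_plus (p : ℕ × Fin r) :
    (R.shift p).symm (refPiecePlus h) = R.plusPt p := by
  rw [Homeomorph.symm_apply_eq, shift_plus]

theorem shift_mem_iff (p : ℕ × Fin r) (x : R.piece p) : x.1 ∈ R.ends p ↔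
    R.shift p x ∈ ({refPieceMinus h, refPiecePlus h} : Set (refPiece h)) := by
  rw [mem_ends]
  simp only [Set.mem_insert_iff, Set.mem_singleton_iff]
  rw [← R.shift_symm_minus, ← R.shift_symm_plus, Homeomorph.eq_symm_apply,
    Homeomorph.eq_symm_apply]

/-- The marking of a piece. -/
def mark (p : ℕ × Fin r) : C(R.piece p, refPiece h) := (R.marking p.1 p.2).toRef

/-- The chosen homotopy inverse of the marking of a piece. -/
def unmark (p : ℕ × Fin r) : C(refPiece h, R.piece p) := (R.marking p.1 p.2).ofRef

theorem mark_minus (p : ℕ × Fin r) : R.mark p (R.minusPt p) = refPieceMinus h :=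
  (R.marking p.1 p.2).toRef_minus

theorem mark_plus (p : ℕ × Fin r) : R.mark p (R.plusPt p) = refPiecePlus h :=
  (R.marking p.1 p.2).toRef_plus

theorem unmark_minus (p : ℕ × Fin r) : R.unmark p (refPieceMinus h) = R.minusPt p :=
  (R.marking p.1 p.2).ofRef_minus

theorem unmark_plus (p : ℕ × Fin r) : R.unmark p (refPiecePlus h) = R.plusPt p :=
  (R.marking p.1 p.2).ofRef_plus

/-- The homotopy from `φ_p⁻¹ ∘ φ_p` to the identity. -/
noncomputable def unmarkMark (p : ℕ × Fin r) : ((R.unmark p).comp (R.mark p)).HomotopyRel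
    (ContinuousMap.id _) {R.minusPt p, R.plusPt p} := (R.marking p.1 p.2).left_inv.some

/-- The homotopy from `φ_p ∘ φ_p⁻¹` to the identity. -/
noncomputable def markUnmark (p : ℕ × Fin r) : ((R.mark p).comp (R.unmark p)).HomotopyRel
    (ContinuousMap.id _) {refPieceMinus h, refPiecePlus h} := (R.marking p.1 p.2).right_inv.some

/-- The map that is the identity on the core and `φ_p⁻¹` after the translation on each piece `p`. -/
theorem exists_fromStandard (hh : 1 ≤ h) : ∃ F : C(Graph r, Graph r), (∀ x ∈ R.core, F x = x) ∧
    ∀ p (x : R.piece p), F x = R.unmark p (R.shift p x) := by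
  obtain ⟨F, h1, h2⟩ := R.exists_glue hh (ContinuousMap.id _) (ContinuousMap.id _)
    (fun p => ⟨fun x : R.piece p => (R.unmark p (R.shift p x)).1, by fun_prop⟩) (by
      intro p x hx
      rcases R.mem_ends.1 hx with rfl | rfl
      · exact congrArg Subtype.val
          ((congrArg (R.unmark p) (R.shift_minus p)).trans (R.unmark_minus p))
      · exact congrArg Subtype.val
          ((congrArg (R.unmark p) (R.shift_plus p)).trans (R.unmark_plus p)))
  exact ⟨F, h1, h2⟩

theorem exists_toStandard (hh : 1 ≤ h) : ∃ F : C(Graph r, Graph r), (∀ x ∈ R.core, F x = x) ∧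
    ∀ p (x : R.piece p), F x = (R.shift p).symm (R.mark p x) := by
  obtain ⟨F, h1, h2⟩ := R.exists_glue hh (ContinuousMap.id _) (ContinuousMap.id _)
    (fun p => ⟨fun x : R.piece p => ((R.shift p).symm (R.mark p x)).1,
      continuous_subtype_val.comp ((R.shift p).symm.continuous.comp (R.mark p).continuous)⟩) (by
      intro p x hx
      rcases R.mem_ends.1 hx with rfl | rfl
      · exact congrArg Subtype.val
          ((congrArg (R.shift p).symm (R.mark_minus p)).trans (R.shift_symm_minus p))
      · exact congrArg Subtype.val
          ((congrArg (R.shift p).symm (R.mark_plus p)).trans (R.shift_symm_plus p)))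
  exact ⟨F, h1, h2⟩

/-- The standardizing map. -/
noncomputable def fromStandard (hh : 1 ≤ h) : C(Graph r, Graph r) := (R.exists_fromStandard hh).choose

/-- The proper homotopy inverse of the standardizing map. -/
noncomputable def toStandard (hh : 1 ≤ h) : C(Graph r, Graph r) := (R.exists_toStandard hh).choose

variable (hh : 1 ≤ h)

theorem fromStandard_core {x : Graph r} (hx : x ∈ R.core) : R.fromStandard hh x = x :=
  (R.exists_fromStandard hh).choose_spec.1 x hx

theorem fromStandard_piece {p : ℕ × Fin r} (x : R.piece p) :
    R.fromStandard hh x = R.unmark p (R.shift p x) :=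
  (R.exists_fromStandard hh).choose_spec.2 p x

theorem toStandard_core {x : Graph r} (hx : x ∈ R.core) : R.toStandard hh x = x :=
  (R.exists_toStandard hh).choose_spec.1 x hx

theorem toStandard_piece {p : ℕ × Fin r} (x : R.piece p) :
    R.toStandard hh x = (R.shift p).symm (R.mark p x) :=
  (R.exists_toStandard hh).choose_spec.2 p x

theorem fromStandard_mem_piece {p : ℕ × Fin r} {x : Graph r} (hx : x ∈ R.piece p) :
    R.fromStandard hh x ∈ R.piece p := by
  rw [R.fromStandard_piece hh ⟨x, hx⟩]
  exact Subtype.prop _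

theorem toStandard_mem_piece {p : ℕ × Fin r} {x : Graph r} (hx : x ∈ R.piece p) :
    R.toStandard hh x ∈ R.piece p := by
  rw [R.toStandard_piece hh ⟨x, hx⟩]
  exact Subtype.prop _

theorem isProperMap_fromStandard : IsProperMap (R.fromStandard hh) := by
  refine isProperMap_of_dist_le isProperMap_id (map_continuous _) (B := 2 * h + 2) ?_
  refine R.forall_of_part hh (fun x hx => ?_) fun p x hx => ?_
  · rw [fromStandard_core _ _ hx, id, dist_self]
    positivity
  · exact R.dist_le_of_mem_piece (R.fromStandard_mem_piece hh hx) hx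

theorem isProperMap_toStandard : IsProperMap (R.toStandard hh) := by
  refine isProperMap_of_dist_le isProperMap_id (map_continuous _) (B := 2 * h + 2) ?_
  refine R.forall_of_part hh (fun x hx => ?_) fun p x hx => ?_
  · rw [toStandard_core _ _ hx, id, dist_self]
    positivity
  · exact R.dist_le_of_mem_piece (R.toStandard_mem_piece hh hx) hx

/-- Homotopies relative to the end points on all pieces give a proper homotopy, if they do not
leave sets of bounded size. -/
theorem properHomotopic_of_pieces (hh : 1 ≤ h) {f k : C(Graph r, Graph r)} (hf : IsProperMap f)
    (K : ∀ p, C(I × R.piece p, Graph r)) (B : ℝ)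
    (hK0 : ∀ p x, K p (0, x) = f x) (hK1 : ∀ p x, K p (1, x) = k x)
    (hKe : ∀ p t (x : R.piece p), x.1 ∈ R.ends p → K p (t, x) = f x)
    (hd : ∀ p t x, dist (K p (t, x)) (f x) ≤ B) (hc : ∀ x ∈ R.core, k x = f x) :
    ProperHomotopic f k := by
  obtain ⟨H, h1, h2⟩ := R.exists_glue hh (X := I × Graph r) ⟨Prod.snd, continuous_snd⟩
    (f.comp ⟨Prod.snd, continuous_snd⟩)
    (fun p => ⟨fun x => K p (x.1.1, ⟨x.1.2, x.2⟩), by fun_prop⟩)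
    (fun p x hx => hKe p x.1.1 ⟨x.1.2, x.2⟩ hx)
  refine ProperHomotopic.of_dist_le hf H (R.forall_of_part hh (fun x hx => h1 (0, x) hx)
    fun p x hx => (h2 p ⟨(0, x), hx⟩).trans (hK0 p ⟨x, hx⟩))
    (R.forall_of_part hh (fun x hx => (h1 (1, x) hx).trans (hc x hx).symm)
    fun p x hx => (h2 p ⟨(1, x), hx⟩).trans (hK1 p ⟨x, hx⟩)) (B := max B 0) ?_
  rintro ⟨t, x⟩
  refine R.forall_of_part hh (P := fun x => dist (H (t, x)) (f x) ≤ max B 0) (fun x hx => ?_)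
    (fun p x hx => ?_) x
  · rw [h1 (t, x) hx]
    simp
  · rw [h2 p ⟨(t, x), hx⟩]
    exact (hd p t ⟨x, hx⟩).trans (le_max_left _ _)

/-- On each piece the translations cancel, and the composite φ_p⁻¹ φ_p is deformed to the identity
by the homotopy that belongs to the marking. It fixes the end points, so these homotopies glue, and
it stays in the piece, so the result is proper. In the opposite order, φ_p φ_p⁻¹ appears conjugated
by the translation. -/
theorem properHomotopic_from_to : ProperHomotopic
    ((R.fromStandard hh).comp (R.toStandard hh)) (ContinuousMap.id _) := by
  have e : ∀ p (x : R.piece p), R.fromStandard hh (R.toStandard hh x) = R.unmark p (R.mark p x) := by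
    intro p x
    rw [R.toStandard_piece hh x, R.fromStandard_piece hh, Homeomorph.apply_symm_apply]
  refine R.properHomotopic_of_pieces hh
    ((R.isProperMap_fromStandard hh).comp (R.isProperMap_toStandard hh))
    (fun p => ⟨fun y => (R.unmarkMark p y).1,
      continuous_subtype_val.comp (map_continuous (R.unmarkMark p))⟩) (2 * h + 2) (fun p x => ?_)
    (fun p x => ?_) (fun p t x hx => ?_) (fun p t x => ?_) (fun x hx => ?_)
  · simp only [ContinuousMap.coe_mk, ContinuousMap.comp_apply]
    rw [e, ContinuousMap.HomotopyWith.apply_zero]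
    rfl
  · simp only [ContinuousMap.coe_mk]
    rw [ContinuousMap.HomotopyWith.apply_one]
    rfl
  · simp only [ContinuousMap.coe_mk, ContinuousMap.comp_apply]
    rw [e, (R.unmarkMark p).eq_fst t (R.mem_ends.1 hx)]
    rfl
  · exact R.dist_le_of_mem_piece (Subtype.prop _)
      (R.fromStandard_mem_piece hh (R.toStandard_mem_piece hh x.2))
  · rw [ContinuousMap.comp_apply, R.toStandard_core hh hx, R.fromStandard_core hh hx]
    rfl

theorem properHomotopic_to_from : ProperHomotopic
    ((R.toStandard hh).comp (R.fromStandard hh)) (ContinuousMap.id _) := by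
  have e : ∀ p (x : R.piece p), R.toStandard hh (R.fromStandard hh x) =
      (R.shift p).symm (R.mark p (R.unmark p (R.shift p x))) := by
    intro p x
    rw [R.fromStandard_piece hh x, R.toStandard_piece hh]
  refine R.properHomotopic_of_pieces hh
    ((R.isProperMap_toStandard hh).comp (R.isProperMap_fromStandard hh))
    (fun p => ⟨fun y => ((R.shift p).symm (R.markUnmark p (y.1, R.shift p y.2))).1, by fun_prop⟩)
    (2 * h + 2) (fun p x => ?_)
    (fun p x => ?_) (fun p t x hx => ?_) (fun p t x => ?_) (fun x hx => ?_)
  · simp only [ContinuousMap.coe_mk, ContinuousMap.comp_apply]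
    rw [e, ContinuousMap.HomotopyWith.apply_zero]
    rfl
  · simp only [ContinuousMap.coe_mk]
    rw [ContinuousMap.HomotopyWith.apply_one]
    simp
  · simp only [ContinuousMap.coe_mk, ContinuousMap.comp_apply]
    rw [e, (R.markUnmark p).eq_fst t ((R.shift_mem_iff p x).1 hx)]
    rfl
  · exact R.dist_le_of_mem_piece (Subtype.prop _)
      (R.toStandard_mem_piece hh (R.fromStandard_mem_piece hh x.2))
  · rw [ContinuousMap.comp_apply, R.fromStandard_core hh hx, R.toStandard_core hh hx]
    rfl

/-- The class of the standardizing map. -/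
noncomputable def standardizer : MapGraph (Graph r) where
  val := ProperHomotopyClass.mk (R.fromStandard hh) (R.isProperMap_fromStandard hh)
  inv := ProperHomotopyClass.mk (R.toStandard hh) (R.isProperMap_toStandard hh)
  val_inv := Quotient.sound (R.properHomotopic_from_to hh)
  inv_val := Quotient.sound (R.properHomotopic_to_from hh)

end GraphRigidStructure

end Houghton

namespace Houghton

variable {r : ℕ}

theorem ProperHomotopic.isProperMap_right {X : Type*} [TopologicalSpace X] [T2Space X]
    {f k : C(X, X)} (hfk : ProperHomotopic f k) : IsProperMap k := by
  obtain ⟨H, hH⟩ := hfk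
  have h1 : IsProperMap fun x : X => ((1 : I), x) :=
    isProperMap_of_comp_of_t2 (g := Prod.snd) (by fun_prop) continuous_snd isProperMap_id
  have e : (H ∘ fun x : X => ((1 : I), x)) = k := funext fun x => by simp
  exact e ▸ hH.comp h1

theorem isCompact_trunc (B : Fin r → ℝ) : IsCompact {x : Graph r | ∀ j, (x.1 j).re ≤ B j} := by
  refine Metric.isCompact_of_isClosed_isBounded ?_ ?_
  · have : {x : Graph r | ∀ j, (x.1 j).re ≤ B j} = ⋂ j, {x : Graph r | (x.1 j).re ≤ B j} := by
      ext x
      simp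
    rw [this]
    exact isClosed_iInter fun j => isClosed_le (continuous_coord_re j) continuous_const
  · refine Metric.isBounded_iff.2 ⟨∑ j, |B j| + 2, fun x hx y hy => ?_⟩
    have h0 : 0 ≤ ∑ j, |B j| := Finset.sum_nonneg fun _ _ => abs_nonneg _
    rw [Subtype.dist_eq, dist_pi_le_iff (by linarith)]
    intro j
    have hj : |B j| ≤ ∑ j, |B j| :=
      Finset.single_le_sum (f := fun j => |B j|) (fun _ _ => abs_nonneg _) (Finset.mem_univ j)
    have h1 := (hx j).trans ((le_abs_self _).trans hj)
    have h2 := (hy j).trans ((le_abs_self _).trans hj)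
    have h3 := re_nonneg_of_mem_loopedRay (mem_loopedRay_of_mem x j)
    have h4 := re_nonneg_of_mem_loopedRay (mem_loopedRay_of_mem y j)
    have h5 := abs_le.1 (abs_im_le_of_mem_loopedRay (mem_loopedRay_of_mem x j))
    have h6 := abs_le.1 (abs_im_le_of_mem_loopedRay (mem_loopedRay_of_mem y j))
    rw [Complex.dist_eq]
    refine (Complex.norm_le_abs_re_add_abs_im _).trans (add_le_add ?_ ?_)
    · rw [Complex.sub_re, abs_le]
      constructor <;> linarith
    · rw [Complex.sub_im, abs_le]
      constructor <;> linarith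

/-! ### Eventual translations -/

/-- `f` maps the part of the `j`-th ray beyond level `m` to the `ρ j`-th ray, translating it by
`n j` loops. -/
def IsEventualTranslation (f : Graph r → Graph r) (ρ : Fin r → Fin r) (n : Fin r → ℤ) (m : ℕ) :
    Prop :=
  ∀ (x : Graph r) j, 2 * (m : ℝ) + 1 ≤ (x.1 j).re → (f x).1 = Pi.single (ρ j) (x.1 j + 2 * n j)

/-- Proper homotopy classes of eventual translations. -/
def IsGraphTranslation (u : MapGraph (Graph r)) (ρ : Equiv.Perm (Fin r)) (n : Fin r → ℤ) : Prop :=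
  ∃ (f : C(Graph r, Graph r)) (hf : IsProperMap f) (m : ℕ),
    (u : ProperHomotopyClass (Graph r)) = ProperHomotopyClass.mk f hf ∧
      IsEventualTranslation f ρ n m

theorem isGraphTranslation_one : IsGraphTranslation (1 : MapGraph (Graph r)) 1 0 := by
  refine ⟨ContinuousMap.id _, isProperMap_id, 0, rfl, fun x j hx => ?_⟩
  have h0 : 0 < (x.1 j).re := lt_of_lt_of_le (by norm_num) hx
  simpa using eq_single_of_re_pos h0

theorem isGraphTranslation_mul (u v : MapGraph (Graph r)) (ρ τ : Equiv.Perm (Fin r))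
    (n k : Fin r → ℤ) (hu : IsGraphTranslation u ρ n) (hv : IsGraphTranslation v τ k) :
    IsGraphTranslation (u * v) (ρ * τ) fun j => k j + n (τ j) := by
  obtain ⟨f, hf, m, hu, h⟩ := hu
  obtain ⟨f', hf', m', hv, h'⟩ := hv
  -- The last summand keeps a point beyond level m after it has been moved by k j loops, which may
  -- be towards the center.
  refine ⟨f.comp f', hf.comp hf', m + m' + ∑ j, (k j).natAbs, ?_, fun x j hx => ?_⟩
  · rw [Units.val_mul, hu, hv]
    rfl
  · have hm : (0 : ℝ) ≤ m := m.cast_nonneg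
    have hm' : (0 : ℝ) ≤ m' := m'.cast_nonneg
    have hk : |(k j : ℝ)| ≤ ((∑ j, (k j).natAbs : ℕ) : ℝ) := by
      have := Finset.single_le_sum (f := fun j => (k j).natAbs) (fun _ _ => Nat.zero_le _)
        (Finset.mem_univ j)
      rw [← Int.cast_abs, ← Nat.cast_natAbs]
      exact_mod_cast this
    rw [Nat.cast_add, Nat.cast_add] at hx
    have hk' := (abs_nonneg _).trans hk
    have hk'' := abs_le.1 hk
    have e := h' x j (by linarith)
    have h1 := h (f' x) (τ j) (by
      rw [e]
      simp
      linarith)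
    rw [ContinuousMap.comp_apply, h1, e]
    simp
    ring

/-! ### Ends -/

/-- Let g be an inverse of f and H a proper homotopy from f ∘ g to the identity. The preimage under
H of the cut vertex at level L is compact, so the track of a distant vertex v of the k-th ray avoids
it. The track ends at v, beyond level L, hence it also begins beyond level L, at f (g v). -/
theorem exists_re_gt {f : C(Graph r, Graph r)} {hf : IsProperMap f} {u : MapGraph (Graph r)}
    (hu : (u : ProperHomotopyClass (Graph r)) = ProperHomotopyClass.mk f hf) (k : Fin r) (L : ℕ) :
    ∃ x, 2 * (L : ℝ) + 1 < ((f x).1 k).re := by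
  obtain ⟨⟨g, hg⟩, hg'⟩ := Quotient.exists_rep (u⁻¹ : MapGraph (Graph r)).1
  have h1 : ProperHomotopyClass.mk (f.comp g) (hf.comp hg) =
      ProperHomotopyClass.mk (ContinuousMap.id _) isProperMap_id := by
    have := u.mul_inv
    rw [hu, ← hg'] at this
    exact this
  obtain ⟨H, hH⟩ : ProperHomotopic (f.comp g) (ContinuousMap.id _) := Quotient.exact h1
  have hK : IsCompact (H ⁻¹' {cutVertex k L}) := hH.isCompact_preimage isCompact_singleton
  obtain ⟨B, hB⟩ := hK.bddAbove_image
    (f := fun p : I × Graph r => (p.2.1 k).re) ((continuous_coord_re k).comp continuous_snd).continuousOn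
  obtain ⟨a, ha⟩ := exists_nat_gt (max B L)
  rw [max_lt_iff] at ha
  have hne : ∀ t, ((H (t, cutVertex k a)).1 k).re ≠ 2 * L + 1 := by
    intro t ht
    have := hB ⟨(t, cutVertex k a), eq_cutVertex_of_re ht, rfl⟩
    simp only [cutVertex_re] at this
    have : (0 : ℝ) ≤ a := a.cast_nonneg
    linarith [ha.1]
  refine ⟨g (cutVertex k a), ?_⟩
  have e0 : H (0, cutVertex k a) = f (g (cutVertex k a)) := by simp
  have e1 : H (1, cutVertex k a) = cutVertex k a := by simp
  rw [← e0]
  by_contra hlt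
  rw [not_lt] at hlt
  have hc : Continuous fun t : I => ((H (t, cutVertex k a)).1 k).re :=
    (continuous_coord_re k).comp (by fun_prop)
  obtain ⟨t, ht⟩ := mem_range_of_exists_le_of_exists_ge hc ⟨0, hlt⟩
    ⟨1, by rw [e1, cutVertex_re]; linarith [ha.2]⟩
  exact hne t ht

/-- If ρ missed k, then f would have k-th coordinate 0 outside a compact set and bounded on it,
contrary to `exists_re_gt`. -/
theorem surjective_of_maps_rays {f : C(Graph r, Graph r)} {hf : IsProperMap f}
    {u : MapGraph (Graph r)}
    (hu : (u : ProperHomotopyClass (Graph r)) = ProperHomotopyClass.mk f hf) {ρ : Fin r → Fin r}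
    {B : Fin r → ℝ} (h : ∀ (x : Graph r) j k, B j ≤ (x.1 j).re → k ≠ ρ j → (f x).1 k = 0) :
    Function.Surjective ρ := by
  intro k
  by_contra! hk
  obtain ⟨b, hb⟩ := (isCompact_trunc B).bddAbove_image (f := fun x => ((f x).1 k).re)
    ((continuous_coord_re k).comp f.continuous).continuousOn
  obtain ⟨L, hL⟩ := exists_nat_gt b
  obtain ⟨x, hx⟩ := exists_re_gt hu k L
  have hL0 : (0 : ℝ) ≤ L := L.cast_nonneg
  by_cases hx' : ∀ j, (x.1 j).re ≤ B j
  · have := hb ⟨x, hx', rfl⟩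
    simp only at this
    linarith
  · push Not at hx'
    obtain ⟨j, hj⟩ := hx'
    rw [h x j k hj.le (hk j).symm, Complex.zero_re] at hx
    linarith

/-! ### Asymptotically rigid maps of the graph are eventual translations -/

namespace GraphRigidStructure

variable {g h r : ℕ} (R : GraphRigidStructure g h r)

theorem snd_eq_of_mem_piece {x : Graph r} {p q : ℕ × Fin r} (hp : x ∈ R.piece p)
    (hq : x ∈ R.piece q) : p.2 = q.2 := by
  rw [mem_piece] at hp hq
  by_contra hne
  have h0 : 0 < (x.1 p.2).re := lt_of_lt_of_le (by positivity) hp.1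
  have h0' : 0 < (x.1 q.2).re := lt_of_lt_of_le (by positivity) hq.1
  rw [eq_single_of_re_pos h0] at h0'
  simp [Pi.single_eq_of_ne (Ne.symm hne)] at h0'

theorem exists_bound_of_isSuited (hh : 1 ≤ h) {Z : Set (Graph r)} (hZ : R.IsSuited Z) :
    ∃ M, ∀ p : ℕ × Fin r, M ≤ p.1 → R.piece p ⊆ closure Zᶜ := by
  obtain ⟨-, T, rfl⟩ := hZ
  -- One more than the last index would still allow a common end point with Z; with two more the
  -- piece is disjoint from Z.
  refine ⟨T.sup Prod.fst + 2, fun p hp x hx => subset_closure fun hx' => ?_⟩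
  rcases hx' with hx' | hx'
  · have h1 := (R.mem_piece.1 hx).1
    have h2 := hx' p.2
    have h3 : R.coreLoops p.2 < R.coreLoops p.2 + h * p.1 := by
      have : 1 * 1 ≤ h * p.1 := Nat.mul_le_mul hh (by omega)
      omega
    have h3' : (R.coreLoops p.2 : ℝ) < (R.coreLoops p.2 + h * p.1 : ℕ) := by exact_mod_cast h3
    linarith
  · simp only [Set.mem_iUnion] at hx'
    obtain ⟨q, hq, hx'⟩ := hx'
    have e := R.snd_eq_of_mem_piece hx hx'
    have h0 : q.1 ≤ T.sup Prod.fst := Finset.le_sup (f := Prod.fst) hq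
    have h1 := (R.mem_piece.1 hx).1
    have h2 := (R.mem_piece.1 hx').2
    rw [← e] at h2
    have h3 : R.coreLoops p.2 + h * (q.1 + 1) < R.coreLoops p.2 + h * p.1 := by
      have : h * (q.1 + 1) < h * p.1 := Nat.mul_lt_mul_of_pos_left (by omega) hh
      omega
    have h3' : ((R.coreLoops p.2 + h * (q.1 + 1) : ℕ) : ℝ) < (R.coreLoops p.2 + h * p.1 : ℕ) := by
      exact_mod_cast h3
    linarith

theorem fst_snd_of_plusPt_eq (hh : 1 ≤ h) {p q : ℕ × Fin r}
    (e : (R.plusPt p).1 = (R.minusPt q).1) : q = (p.1 + 1, p.2) := by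
  obtain ⟨h1, h2⟩ := cutVertex_inj e
  rw [← h1] at h2
  have h3 := Nat.eq_of_mul_eq_mul_left hh (Nat.add_left_cancel h2)
  exact Prod.ext h3.symm h1.symm

theorem shift_symm_shift_val (p q : ℕ × Fin r) (x : R.piece p) :
    ((R.shift q).symm (R.shift p x)).1.1 = Pi.single q.2 (x.1.1 p.2 +
      2 * (((R.coreLoops q.2 + h * q.1 : ℕ) : ℤ) - ((R.coreLoops p.2 + h * p.1 : ℕ) : ℤ) : ℤ)) := by
  have : ((R.shift q).symm (R.shift p x)).1.1 = Pi.single q.2 ((x.1.1 p.2 -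
      ((2 * (R.coreLoops p.2 + h * p.1 : ℕ) + 1 : ℝ) : ℂ)) +
      ((2 * (R.coreLoops q.2 + h * q.1 : ℕ) + 1 : ℝ) : ℂ)) := rfl
  rw [this]
  congr 1
  push_cast
  ring

/-- Consecutive pieces share a cut vertex, and φ_q⁻¹ φ_p preserves ∂₋ and ∂₊. So ∂₊ of the image of
one piece is ∂₋ of the image of the next, which makes the image pieces consecutive on one ray. -/
theorem exists_eventual_pieces (hh : 1 ≤ h) {f : C(Graph r, Graph r)}
    (hf : R.IsAsymptoticallyRigid f) : ∃ (M : ℕ) (ρ : Fin r → Fin r) (b : Fin r → ℕ),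
      ∀ i j (x : R.piece (M + i, j)),
        f x = (R.unmark (b j + i, ρ j) (R.mark (M + i, j) x)).1 := by
  obtain ⟨Z, hZ, -, -, hp⟩ := hf
  obtain ⟨M, hM⟩ := R.exists_bound_of_isSuited hh hZ
  choose q hq using fun p : {p : ℕ × Fin r // M ≤ p.1} => hp p.1 (hM p.1 p.2)
  have hq' : ∀ p (hp : M ≤ p.1) (x : R.piece p), f x = (R.unmark (q ⟨p, hp⟩) (R.mark p x)).1 :=
    fun p hp x => (hq ⟨p, hp⟩).2.2 x
  have hstep : ∀ i j (hi : M ≤ i), q ⟨(i + 1, j), by simp; omega⟩ =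
      ((q ⟨(i, j), hi⟩).1 + 1, (q ⟨(i, j), hi⟩).2) := by
    intro i j hi
    apply R.fst_snd_of_plusPt_eq hh
    have e1 := hq' (i, j) hi (R.plusPt (i, j))
    have e2 := hq' (i + 1, j) (by simp; omega) (R.minusPt (i + 1, j))
    rw [R.mark_plus, R.unmark_plus] at e1
    rw [R.mark_minus, R.unmark_minus] at e2
    rw [← e1, ← e2]
    rfl
  refine ⟨M, fun j => (q ⟨(M, j), le_rfl⟩).2, fun j => (q ⟨(M, j), le_rfl⟩).1, fun i j => ?_⟩
  have hi : ∀ i, q ⟨(M + i, j), by simp⟩ =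
      ((q ⟨(M, j), le_rfl⟩).1 + i, (q ⟨(M, j), le_rfl⟩).2) := by
    intro i
    induction i with
    | zero => rfl
    | succ i ih =>
      have := hstep (M + i) j (by omega)
      rw [ih] at this
      exact this
  rw [← hi]
  exact hq' _ _

/-- After conjugation back to the standard decomposition, f is on each distant piece a translation
with one factor φ φ⁻¹ for the source and one for the target inserted. Contracting both relative to
the end points leaves the translation from level c_j + h (M + i) to level c_{ρ j} + h (b_j + i),
whose length satisfies the congruence modulo h. -/
theorem mem_congruentTranslations_of_rigid (hh : 1 ≤ h) {u : MapGraph (Graph r)}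
    {f : C(Graph r, Graph r)} {hf : IsProperMap f}
    (hu : (R.standardizer hh * u * (R.standardizer hh)⁻¹ : MapGraph (Graph r)).1 =
      ProperHomotopyClass.mk f hf) (hR : R.IsAsymptoticallyRigid f) :
    u ∈ congruentTranslations IsGraphTranslation h R.coreLoops := by
  obtain ⟨M, ρ, b, hb⟩ := R.exists_eventual_pieces hh hR
  have hfar : ∀ (x : Graph r) j, 2 * ((R.coreLoops j + h * M : ℕ) : ℝ) + 1 ≤ (x.1 j).re →
      ∃ i, x ∈ R.piece (M + i, j) := by
    intro x j hx
    obtain ⟨i, hi, hx⟩ := R.exists_mem_piece_of_re hh hx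
    obtain ⟨i, rfl⟩ := Nat.exists_eq_add_of_le hi
    exact ⟨i, hx⟩
  have hρ : Function.Surjective ρ := by
    refine surjective_of_maps_rays hu (B := fun j => 2 * ((R.coreLoops j + h * M : ℕ) : ℝ) + 1)
      fun x j k hx hk => ?_
    obtain ⟨i, hx⟩ := hfar x j hx
    have h1 := (R.unmark (b j + i, ρ j) (R.mark (M + i, j) ⟨x, hx⟩)).2
    rw [← hb] at h1
    rw [mem_piece] at h1
    rw [eq_single_of_re_pos (x := f x) (j := ρ j) (lt_of_lt_of_le (by positivity) h1.1)]
    simp [Pi.single_eq_of_ne hk]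
  let ρ' : Equiv.Perm (Fin r) := Equiv.ofBijective ρ (Finite.surjective_iff_bijective.1 hρ)
  set f₁ : C(Graph r, Graph r) := ((R.toStandard hh).comp f).comp (R.fromStandard hh) with hf₁
  have hf₁p : IsProperMap f₁ :=
    ((R.isProperMap_toStandard hh).comp hf).comp (R.isProperMap_fromStandard hh)
  have hu₁ : u.1 = ProperHomotopyClass.mk f₁ hf₁p := by
    have e : u = (R.standardizer hh)⁻¹ * (R.standardizer hh * u * (R.standardizer hh)⁻¹) *
        R.standardizer hh := by group
    rw [e, Units.val_mul, Units.val_mul, hu]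
    rfl
  have e₁ : ∀ i j (x : R.piece (M + i, j)), f₁ x = ((R.shift (b j + i, ρ j)).symm
      (R.mark (b j + i, ρ j) (R.unmark (b j + i, ρ j) (R.mark (M + i, j)
        (R.unmark (M + i, j) (R.shift (M + i, j) x)))))).1 := by
    intro i j x
    simp only [hf₁, ContinuousMap.comp_apply]
    rw [R.fromStandard_piece hh x, hb, R.toStandard_piece]
  -- The contractions for the source and the target piece run simultaneously. On the finitely many
  -- pieces before M the homotopy is constant.
  let K : ∀ p, C(I × R.piece p, Graph r) := fun p =>
    if hp : M ≤ p.1 then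
      ⟨fun y => ((R.shift (b p.2 + (p.1 - M), ρ p.2)).symm
        (R.markUnmark (b p.2 + (p.1 - M), ρ p.2) (y.1, R.markUnmark p (y.1, R.shift p y.2)))).1,
        by
          refine continuous_subtype_val.comp ((Homeomorph.continuous _).comp
            ((map_continuous (R.markUnmark _)).comp (continuous_fst.prodMk
              ((map_continuous (R.markUnmark p)).comp (by fun_prop)))))⟩
    else f₁.comp ⟨fun y => y.2.1, by fun_prop⟩
  have Kfar : ∀ i j t (x : R.piece (M + i, j)), K (M + i, j) (t, x) =
      ((R.shift (b j + i, ρ j)).symm (R.markUnmark (b j + i, ρ j)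
        (t, R.markUnmark (M + i, j) (t, R.shift (M + i, j) x)))).1 := by
    intro i j t x
    have e : M + i - M = i := by omega
    have hi : M ≤ (M + i, j).1 := by simp
    simp only [K, dif_pos hi, ContinuousMap.coe_mk]
    rw [e]
  have Knear : ∀ p (hp : ¬ M ≤ p.1) t (x : R.piece p), K p (t, x) = f₁ x := by
    intro p hp t x
    simp only [K, dif_neg hp]
    rfl
  have hKe : ∀ p t (x : R.piece p), x.1 ∈ R.ends p → K p (t, x) = f₁ x := by
    rintro ⟨i, j⟩ t x hx
    by_cases hi : M ≤ i
    · obtain ⟨i, rfl⟩ := Nat.exists_eq_add_of_le hi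
      rw [Kfar, e₁]
      rcases R.mem_ends.1 hx with rfl | rfl
      · have h1 := (R.markUnmark (M + i, j)).eq_fst t (x := refPieceMinus h) (by simp)
        have h2 := (R.markUnmark (b j + i, ρ j)).eq_fst t (x := refPieceMinus h) (by simp)
        simp only [ContinuousMap.comp_apply] at h1 h2
        rw [R.shift_minus, h1, R.unmark_minus, R.mark_minus, h2]
      · have h1 := (R.markUnmark (M + i, j)).eq_fst t (x := refPiecePlus h) (by simp)
        have h2 := (R.markUnmark (b j + i, ρ j)).eq_fst t (x := refPiecePlus h) (by simp)
        simp only [ContinuousMap.comp_apply] at h1 h2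
        rw [R.shift_plus, h1, R.unmark_plus, R.mark_plus, h2]
    · exact Knear _ hi t x
  obtain ⟨k, hk1, hk2⟩ := R.exists_glue hh (ContinuousMap.id _) f₁
    (fun p => (K p).comp ⟨fun x : R.piece p => ((1 : I), x), by fun_prop⟩)
    (fun p x hx => hKe p 1 x hx)
  have hk2' : ∀ p (x : R.piece p), k x.1 = K p (1, x) := hk2
  have hfk : ProperHomotopic f₁ k := by
    refine R.properHomotopic_of_pieces hh hf₁p K (2 * h + 2) ?_ (fun p x => (hk2' p x).symm) hKe
      ?_ hk1
    · rintro ⟨i, j⟩ x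
      by_cases hi : M ≤ i
      · obtain ⟨i, rfl⟩ := Nat.exists_eq_add_of_le hi
        rw [Kfar, e₁, ContinuousMap.HomotopyWith.apply_zero,
          ContinuousMap.HomotopyWith.apply_zero]
        rfl
      · exact Knear _ hi 0 x
    · rintro ⟨i, j⟩ t x
      by_cases hi : M ≤ i
      · obtain ⟨i, rfl⟩ := Nat.exists_eq_add_of_le hi
        rw [Kfar, e₁]
        exact R.dist_le_of_mem_piece (Subtype.prop _) (Subtype.prop _)
      · rw [Knear _ hi t x, dist_self]
        positivity
  refine ⟨ρ', fun j => ((R.coreLoops (ρ j) + h * b j : ℕ) : ℤ) - ((R.coreLoops j + h * M : ℕ) : ℤ),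
    ⟨k, hfk.isProperMap_right, ∑ j, (R.coreLoops j + h * M), hu₁.trans (Quotient.sound hfk), ?_⟩,
    fun j => ⟨(b j : ℤ) - M, ?_⟩⟩
  · intro x j hx
    have h1 : R.coreLoops j + h * M ≤ ∑ j, (R.coreLoops j + h * M) :=
      Finset.single_le_sum (f := fun j => R.coreLoops j + h * M) (fun _ _ => Nat.zero_le _)
        (Finset.mem_univ j)
    have h2 : ((R.coreLoops j + h * M : ℕ) : ℝ) ≤ (∑ j, (R.coreLoops j + h * M) : ℕ) := by
      exact_mod_cast h1
    obtain ⟨i, hi⟩ := hfar x j (by linarith)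
    rw [hk2' _ ⟨x, hi⟩, Kfar, ContinuousMap.HomotopyWith.apply_one,
      ContinuousMap.HomotopyWith.apply_one]
    simp only [ContinuousMap.id_apply]
    rw [R.shift_symm_shift_val]
    congr 1
    push_cast
    ring
  · change (R.coreLoops j : ℤ) + _ - R.coreLoops (ρ j) = _
    push_cast
    ring

end GraphRigidStructure

/-! ### Self-maps of the reference piece that are homotopic to the identity are surjective -/

theorem isCompact_raySegment {r : ℕ} (j : Fin r) (a b : ℕ) : IsCompact (raySegment j a b) :=
  Metric.isCompact_of_isClosed_isBounded (isClosed_raySegment j a b)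
    (Metric.isBounded_iff.2 ⟨_, fun _ hx _ hy => dist_le_of_mem_raySegment hx hy⟩)

instance (h : ℕ) : CompactSpace (refPiece h) := by
  have : CompactSpace (raySegment (0 : Fin 1) 0 h) :=
    isCompact_iff_compactSpace.1 (isCompact_raySegment _ _ _)
  exact (segmentHomeo (0 : Fin 1) (a := 0) (b := h) (h := h) (by simp)).compactSpace

/-- The segment, or one of the loops of the reference piece. -/
def refPart (h : ℕ) : Option (Fin h) → Set (refPiece h)
  | none => {z | z.1.im = 0}
  | some k => {z | ‖z.1 - (((2 * (k : ℕ) + 1 : ℝ) : ℝ) + (1 / 2 : ℝ) * Complex.I)‖ = 1 / 2}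

theorem continuous_of_refPart {h : ℕ} {Y : Type*} [TopologicalSpace Y] {f : refPiece h → Y}
    (hf : ∀ o, ContinuousOn f (refPart h o)) : Continuous f := by
  refine LocallyFinite.continuous (f := refPart h) (locallyFinite_of_finite _) ?_ ?_ hf
  · refine Set.eq_univ_of_forall fun z => ?_
    rcases mem_refPiece.1 z.2 with hz | ⟨k, hk, hz⟩
    · exact Set.mem_iUnion.2 ⟨none, hz.1⟩
    · exact Set.mem_iUnion.2 ⟨some ⟨k, hk⟩, hz⟩
  · rintro (_ | k)
    · exact isClosed_eq (Complex.continuous_im.comp continuous_subtype_val) continuous_const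
    · exact isClosed_eq (by fun_prop) continuous_const

theorem re_eq_of_loop {z : ℂ} {a : ℝ} (h : ‖z - ((a : ℝ) + (1 / 2 : ℝ) * Complex.I)‖ = 1 / 2)
    (him : z.im = 0) : z.re = a := by
  have h2 : ‖z - ((a : ℝ) + (1 / 2 : ℝ) * Complex.I)‖ ^ 2 = 1 / 4 := by rw [h]; norm_num
  rw [← Complex.normSq_eq_norm_sq, Complex.normSq_apply] at h2
  simp [him] at h2
  have h3 : (z.re - a) * (z.re - a) = 0 := by linarith
  have := mul_self_eq_zero.1 h3
  linarith

/-- The projection of the reference piece to its segment that collapses the loops. -/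
noncomputable def collapseLoops {h : ℕ} (z : refPiece h) : ℝ :=
  if z.1.im = 0 then z.1.re else 2 * ⌊z.1.re / 2⌋₊ + 1

theorem collapseLoops_of_loop {h : ℕ} {z : refPiece h} {k : Fin h} (hz : z ∈ refPart h (some k)) :
    collapseLoops z = 2 * (k : ℕ) + 1 := by
  unfold collapseLoops
  split_ifs with him
  · exact re_eq_of_loop hz him
  · have h1 := abs_le.1 (re_sub_le_of_loop hz)
    have : ⌊z.1.re / 2⌋₊ = (k : ℕ) := by
      rw [Nat.floor_eq_iff (by linarith [(re_mem_of_mem_refPiece z.2).1])]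
      constructor <;> linarith
    rw [this]

theorem continuous_collapseLoops (h : ℕ) : Continuous (collapseLoops (h := h)) := by
  refine continuous_of_refPart ?_
  rintro (_ | k)
  · exact (Complex.continuous_re.comp continuous_subtype_val).continuousOn.congr
      fun z hz => if_pos hz
  · exact continuousOn_const.congr fun z hz => collapseLoops_of_loop hz

/-- The circle map `z ↦ 2i(z - c)` on the `k`-th loop with center `c`, extended constantly. -/
noncomputable def loopCoord {h : ℕ} (k : Fin h) (z : refPiece h) : ℂ :=
  open Classical in
  if z ∈ refPart h (some k) then
    -- With this factor the attaching point c - i/2 goes to 1, the constant value off the loop.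
    2 * Complex.I * (z.1 - (((2 * (k : ℕ) + 1 : ℝ) : ℝ) + (1 / 2 : ℝ) * Complex.I))
  else 1

theorem norm_loopCoord {h : ℕ} (k : Fin h) (z : refPiece h) : ‖loopCoord k z‖ = 1 := by
  unfold loopCoord
  split_ifs with hz
  · have hz' : ‖z.1 - (((2 * (k : ℕ) + 1 : ℝ) : ℝ) + (1 / 2 : ℝ) * Complex.I)‖ = 1 / 2 := hz
    rw [norm_mul, hz']
    simp
  · simp

theorem loopCoord_of_im {h : ℕ} (k : Fin h) {z : refPiece h} (hz : z.1.im = 0) :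
    loopCoord k z = 1 := by
  unfold loopCoord
  split_ifs with hk
  · have := re_eq_of_loop hk hz
    have e : z.1 = ((2 * (k : ℕ) + 1 : ℝ) : ℂ) := Complex.ext (by simpa using this) (by simpa using hz)
    rw [e]
    have := Complex.I_mul_I
    push_cast
    linear_combination (-1) * this
  · rfl

theorem loopCoord_of_loop_ne {h : ℕ} {k l : Fin h} (hkl : k ≠ l) {z : refPiece h}
    (hz : z ∈ refPart h (some l)) : loopCoord k z = 1 := by
  refine if_neg fun hk => hkl ?_
  have h1 := abs_le.1 (re_sub_le_of_loop hz)
  have h2 := abs_le.1 (re_sub_le_of_loop hk)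
  have h3 : (k : ℝ) < l + 1 := by linarith
  have h4 : (l : ℝ) < k + 1 := by linarith
  norm_cast at h3 h4
  exact Fin.ext (by omega)

theorem continuous_loopCoord {h : ℕ} (k : Fin h) : Continuous (loopCoord k) := by
  refine continuous_of_refPart ?_
  rintro (_ | l)
  · exact continuousOn_const.congr fun z hz => loopCoord_of_im k hz
  · by_cases hkl : k = l
    · subst hkl
      exact Continuous.continuousOn (f := fun z : refPiece h => 2 * Complex.I *
        (z.1 - (((2 * (k : ℕ) + 1 : ℝ) : ℝ) + (1 / 2 : ℝ) * Complex.I))) (by fun_prop) |>.congr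
        fun z hz => if_pos hz
    · exact continuousOn_const.congr fun z hz => loopCoord_of_loop_ne hkl hz

/-- For a section s, the function s(e^{it}) - t takes values in 2πℤ but drops by 2π over a period,
so by the intermediate value theorem it would also take the forbidden value in the middle. -/
theorem not_exists_section_exp : ¬ ∃ s : C(Circle, ℝ), ∀ w, Circle.exp (s w) = w := by
  rintro ⟨s, hs⟩
  let D : ℝ → ℝ := fun t => s (Circle.exp t) - t
  have hD : Continuous D := by fun_prop
  have h1 : ∀ t, Circle.exp (D t) = 1 := fun t => by
    rw [Circle.exp_sub, hs, div_self']
  have h2 : D (2 * Real.pi) = D 0 - 2 * Real.pi := by simp [D]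
  have hpi := Real.pi_pos
  obtain ⟨t, ht⟩ := mem_range_of_exists_le_of_exists_ge (c := D 0 - Real.pi) hD
    ⟨2 * Real.pi, by linarith⟩ ⟨0, by linarith⟩
  have h3 := h1 t
  rw [ht, Circle.exp_sub, h1, one_div, inv_eq_one] at h3
  have h4 : (Circle.exp Real.pi : ℂ) = (1 : Circle) := congrArg Subtype.val h3
  rw [Circle.coe_exp, Complex.exp_pi_mul_I, Circle.coe_one] at h4
  norm_num at h4

theorem neg_mem_slitPlane {u : ℂ} (hu : ‖u‖ = 1) (h1 : u ≠ 1) : -u ∈ Complex.slitPlane := by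
  rw [Complex.mem_slitPlane_iff]
  by_contra! h2
  have h3 : ‖u‖ ^ 2 = 1 := by rw [hu, one_pow]
  have h4 : u.im = 0 := by simpa using h2.2
  have h5 : 0 ≤ u.re := by simpa using h2.1
  rw [← Complex.normSq_eq_norm_sq, Complex.normSq_apply, h4] at h3
  exact h1 (Complex.ext (by simp; nlinarith) (by simpa using h4))

/-- A circle map that is homotopic to the identity is surjective. -/
theorem circle_surjective_of_homotopic {f : C(Circle, Circle)}
    (hf : f.Homotopic (ContinuousMap.id _)) : Function.Surjective f := by
  intro w
  by_contra! hw
  obtain ⟨H⟩ := hf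
  -- A map that misses w lifts to ℝ: -f(z)/w avoids the branch cut of `arg`, and the constant
  -- arg(-w) restores f(z) = (-f(z)/w)(-w).
  let s : C(Circle, ℝ) := ⟨fun z => Complex.arg (-(f z / w : Circle)) + (Complex.arg (-(w : ℂ))), by
    refine Continuous.add ?_ continuous_const
    refine continuous_iff_continuousAt.2 fun z => ?_
    refine ContinuousAt.comp (f := fun z => (-((f z / w : Circle) : ℂ))) (g := Complex.arg) ?_
      (by fun_prop)
    refine Complex.continuousAt_arg ?_
    exact neg_mem_slitPlane (Circle.norm_coe _) fun h1 =>
      hw z (div_eq_one.1 (Circle.ext h1))⟩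
  have hs : ∀ z, H (0, z) = Circle.exp (s z) := by
    intro z
    refine Circle.ext ?_
    have harg : ∀ u : ℂ, ‖u‖ = 1 → Complex.exp (Complex.arg u * Complex.I) = u := by
      intro u hu
      have := Complex.norm_mul_exp_arg_mul_I u
      rwa [hu, Complex.ofReal_one, one_mul] at this
    simp only [ContinuousMap.Homotopy.apply_zero, s, ContinuousMap.coe_mk]
    rw [Circle.coe_exp, Complex.ofReal_add, add_mul, Complex.exp_add,
      harg _ ((norm_neg _).trans (Circle.norm_coe _)),
      harg _ ((norm_neg _).trans (Circle.norm_coe _)), Circle.coe_div]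
    field_simp
  -- Lifting the homotopy from the lift s of f gives at time 1 a lift of the identity.
  refine not_exists_section_exp ⟨⟨fun z => Circle.isCoveringMap_exp.liftHomotopy H.toContinuousMap s
    hs (1, z), by fun_prop⟩, fun z => ?_⟩
  have := congrFun (Circle.isCoveringMap_exp.liftHomotopy_lifts H.toContinuousMap s hs) (1, z)
  exact this.trans (H.apply_one z)

theorem loop_point_mem {h : ℕ} (k : Fin h) (w : Circle) :
    ((((2 * (k : ℕ) + 1 : ℝ) : ℝ) + (1 / 2 : ℝ) * Complex.I) - Complex.I / 2 * w : ℂ) ∈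
      refPiece h := by
  refine mem_refPiece.2 (Or.inr ⟨k, k.2, ?_⟩)
  simp [Circle.norm_coe]

/-- On a loop: restricting to it and projecting to it gives a circle map homotopic to the identity,
hence surjective, and the projection takes values other than 1 only on the loop itself, injectively.
On the segment: `c` fixes both end points, so the intermediate value theorem applies to the
projection that collapses the loops, which is injective over all points that are not attaching
points. Attaching points follow because the image is closed. -/
theorem surjective_of_homotopic_id {h : ℕ} {c : C(refPiece h, refPiece h)}
    (hc : c.Homotopic (ContinuousMap.id _)) (h0 : c (refPieceMinus h) = refPieceMinus h)
    (h1 : c (refPiecePlus h) = refPiecePlus h) : Function.Surjective c := by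
  have hloop : ∀ k : Fin h, ∀ y ∈ refPart h (some k), y.1.im ≠ 0 → y ∈ Set.range c := by
    intro k y hy hy0
    let e : C(refPiece h, Circle) := ⟨fun z => ⟨loopCoord k z, by
      simp [Submonoid.unitSphere, norm_loopCoord]⟩, Continuous.subtype_mk (continuous_loopCoord k) fun z => by
      simp [Submonoid.unitSphere, norm_loopCoord]⟩
    let l : C(Circle, refPiece h) := ⟨fun w => ⟨_, loop_point_mem k w⟩, by fun_prop⟩
    have hl : ∀ w, l w ∈ refPart h (some k) := fun w => by
      simp [refPart, l, Circle.norm_coe]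
    have hel : (e.comp (ContinuousMap.id _)).comp l = ContinuousMap.id _ := by
      ext w
      refine (if_pos (hl w)).trans ?_
      have := Complex.I_mul_I
      simp only [l, ContinuousMap.coe_mk, ContinuousMap.id_apply]
      linear_combination (-w : ℂ) * this
    have hH : ((e.comp c).comp l).Homotopic (ContinuousMap.id _) := by
      rw [← hel]
      exact ((ContinuousMap.Homotopic.refl e).comp hc).comp (ContinuousMap.Homotopic.refl l)
    obtain ⟨w, hw⟩ := circle_surjective_of_homotopic hH (e y)
    refine ⟨l w, ?_⟩
    have hw' : loopCoord k (c (l w)) = loopCoord k y := congrArg Subtype.val hw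
    have hne : loopCoord k y ≠ 1 := by
      intro h1
      have e1 : loopCoord k y = _ := if_pos hy
      rw [e1] at h1
      apply hy0
      have h2 := congrArg Complex.re h1
      simp at h2
      linarith
    have hm : c (l w) ∈ refPart h (some k) := by
      by_contra hm
      exact hne (hw'.symm.trans (if_neg hm))
    have e1 : loopCoord k y = _ := if_pos hy
    have e2 : loopCoord k (c (l w)) = _ := if_pos hm
    rw [e1, e2] at hw'
    exact Subtype.ext (sub_left_injective (mul_left_cancel₀ (by simp) hw'))
  have hseg : ∀ t : ℝ, 0 ≤ t → t ≤ 2 * h → (∀ k : ℕ, t ≠ 2 * k + 1) →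
      ∃ y : refPiece h, y.1 = t ∧ y ∈ Set.range c := by
    intro t ht0 ht1 ht
    let γ : Set.Icc (0 : ℝ) (2 * h) → refPiece h := fun s =>
      ⟨(s.1 : ℂ), Or.inl ⟨by simp, by simpa using s.2.1, by simpa using s.2.2⟩⟩
    have hγ : Continuous γ := by fun_prop
    have hle : (0 : ℝ) ≤ 2 * h := by positivity
    have : PreconnectedSpace (Set.Icc (0 : ℝ) (2 * h)) :=
      isPreconnected_iff_preconnectedSpace.1 isPreconnected_Icc
    obtain ⟨s, hs⟩ := mem_range_of_exists_le_of_exists_ge (c := t)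
      ((continuous_collapseLoops h).comp (c.continuous.comp hγ))
      ⟨⟨0, le_rfl, hle⟩, by
        have e : γ ⟨0, le_rfl, hle⟩ = refPieceMinus h := Subtype.ext (by simp [γ, refPieceMinus])
        simp only [Function.comp_apply, e, h0]
        simpa [collapseLoops, refPieceMinus] using ht0⟩
      ⟨⟨2 * h, hle, le_rfl⟩, by
        have e : γ ⟨2 * h, hle, le_rfl⟩ = refPiecePlus h := Subtype.ext (by simp [γ, refPiecePlus])
        simp only [Function.comp_apply, e, h1]
        simpa [collapseLoops, refPiecePlus] using ht1⟩
    refine ⟨c (γ s), ?_, γ s, rfl⟩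
    simp only [Function.comp_apply, collapseLoops] at hs
    split_ifs at hs with him
    · exact Complex.ext (by simpa using hs) (by simpa using him)
    · exact absurd hs.symm (ht _)
  have hclosed : IsClosed (Set.range c) := (isCompact_range c.continuous).isClosed
  have hreal : ∀ y : refPiece h, y.1.im = 0 → y ∈ Set.range c := by
    intro y hy
    have hyre := re_mem_of_mem_refPiece y.2
    have hy' : y.1 = (y.1.re : ℂ) := Complex.ext (by simp) (by simpa using hy)
    by_cases hodd : ∃ k : ℕ, y.1.re = 2 * k + 1
    · obtain ⟨k, hk⟩ := hodd
      have hkh : 2 * k + 1 ≤ 2 * h := by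
        have := hyre.2
        rw [hk] at this
        exact_mod_cast this
      have hkh' : (2 * k + 2 : ℝ) ≤ 2 * h := by
        have : 2 * k + 2 ≤ 2 * h := by omega
        exact_mod_cast this
      have hx : ∀ n : ℕ, ∃ x : refPiece h, x.1 = ((2 * k + 1 + 1 / ((n : ℝ) + 2) : ℝ) : ℂ) ∧
          x ∈ Set.range c := by
        intro n
        have hn : (0 : ℝ) < 1 / ((n : ℝ) + 2) := by positivity
        have hn' : 1 / ((n : ℝ) + 2) < 1 := by
          rw [div_lt_one (by positivity)]
          have : (0 : ℝ) ≤ n := n.cast_nonneg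
          linarith
        refine hseg _ (by positivity) (by linarith) fun l hl => ?_
        have h3 : (2 * k : ℝ) < 2 * l := by linarith
        have h4 : (2 * l : ℝ) < 2 * k + 1 := by linarith
        norm_cast at h3 h4
        omega
      choose x hx1 hx2 using hx
      refine hclosed.mem_of_tendsto (f := x) (b := Filter.atTop) ?_ (Filter.Eventually.of_forall hx2)
      rw [tendsto_subtype_rng, hy', hk]
      simp only [hx1]
      refine (Complex.continuous_ofReal.tendsto _).comp ?_
      have h5 : Filter.Tendsto (fun n : ℕ => 1 / ((n : ℝ) + 2)) Filter.atTop (𝓝 0) := by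
        have := (tendsto_one_div_add_atTop_nhds_zero_nat (𝕜 := ℝ)).comp (Filter.tendsto_add_atTop_nat 1)
        refine this.congr fun n => ?_
        simp only [Function.comp_apply]
        push_cast
        ring
      simpa using h5.const_add ((2 * k + 1 : ℝ))
    · push Not at hodd
      obtain ⟨x, hx, hx'⟩ := hseg y.1.re hyre.1 hyre.2 hodd
      have : x = y := Subtype.ext (hx.trans hy'.symm)
      exact this ▸ hx'
  intro y
  by_cases hy : y.1.im = 0
  · exact hreal y hy
  · rcases mem_refPiece.1 y.2 with hy' | ⟨k, hk, hy'⟩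
    · exact absurd hy'.1 hy
    · exact hloop ⟨k, hk⟩ y hy' hy

/-! ### Markings and their chosen inverses are surjective -/

namespace GraphRigidStructure

variable {g h r : ℕ} (R : GraphRigidStructure g h r)

/-- Rigidity demands the equality f(Y_p) = Y_q of sets, whereas f = φ_q⁻¹ φ_p is only given up to
homotopy as an equivalence. Surjectivity closes this gap: φ φ⁻¹ and φ⁻¹ φ fix the end points and are
homotopic to the identity, hence onto. -/
theorem mark_surjective (p : ℕ × Fin r) : Function.Surjective (R.mark p) := by
  have := surjective_of_homotopic_id (c := (R.mark p).comp (R.unmark p))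
    ⟨(R.markUnmark p).toHomotopy⟩ (by
      rw [ContinuousMap.comp_apply, R.unmark_minus, R.mark_minus]) (by
      rw [ContinuousMap.comp_apply, R.unmark_plus, R.mark_plus])
  exact Function.Surjective.of_comp this

theorem unmark_surjective (p : ℕ × Fin r) : Function.Surjective (R.unmark p) := by
  let s : C(R.piece p, refPiece h) := R.shift p
  let s' : C(refPiece h, R.piece p) := (R.shift p).symm
  have e : ∀ x, s (s' x) = x := (R.shift p).apply_symm_apply
  have hs : (s.comp (ContinuousMap.id _)).comp s' = ContinuousMap.id _ := ContinuousMap.ext e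
  have := surjective_of_homotopic_id (c := (s.comp ((R.unmark p).comp (R.mark p))).comp s') (by
      rw [← hs]
      exact ((ContinuousMap.Homotopic.refl s).comp ⟨(R.unmarkMark p).toHomotopy⟩).comp
        (ContinuousMap.Homotopic.refl s')) (by
      change R.shift p (R.unmark p (R.mark p ((R.shift p).symm _))) = _
      rw [R.shift_symm_minus, R.mark_minus, R.unmark_minus, R.shift_minus]) (by
      change R.shift p (R.unmark p (R.mark p ((R.shift p).symm _))) = _
      rw [R.shift_symm_plus, R.mark_plus, R.unmark_plus, R.shift_plus])
  intro x
  obtain ⟨y, hy⟩ := this (R.shift p x)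
  exact ⟨_, (R.shift p).injective hy⟩

end GraphRigidStructure

/-! ### Paths that run through a whole set -/

/-- A set is a path image if it is the image of a path. -/
def IsPathImage {X : Type*} [TopologicalSpace X] (A : Set X) : Prop :=
  ∃ γ : C(I, X), Set.range γ = A

section PathImage

variable {X : Type*} [TopologicalSpace X] {A B : Set X}

theorem IsPathImage.isPathConnected (hA : IsPathImage A) : IsPathConnected A := by
  obtain ⟨γ, rfl⟩ := hA
  have : PathConnectedSpace I := isPathConnected_iff_pathConnectedSpace.1
    ((convex_Icc (0 : ℝ) 1).isPathConnected ⟨0, by simp⟩)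
  exact isPathConnected_range γ.continuous

/-- Go inside A from p to the start of the path, follow the path and its reverse, and return to p.
-/
theorem IsPathImage.exists_loop (hA : IsPathImage A) {p : X} (hp : p ∈ A) :
    ∃ γ : Path p p, Set.range γ = A := by
  have hc := hA.isPathConnected
  obtain ⟨γ, rfl⟩ := hA
  let P : Path (γ 0) (γ 1) := ⟨γ, rfl, rfl⟩
  have hP : Set.range P = Set.range γ := rfl
  obtain ⟨Q, hQ⟩ := hc.joinedIn p hp (γ 0) ⟨0, rfl⟩
  have hQ' : Set.range Q ⊆ Set.range γ := by
    rintro _ ⟨t, rfl⟩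
    exact hQ t
  refine ⟨Q.trans (P.trans (P.symm.trans Q.symm)), ?_⟩
  simp only [Path.trans_range, Path.symm_range, hP]
  refine Set.Subset.antisymm (by simp [hQ']) fun x hx => ?_
  simp [hx]

theorem IsPathImage.union (hA : IsPathImage A) (hB : IsPathImage B) (hAB : (A ∩ B).Nonempty) :
    IsPathImage (A ∪ B) := by
  obtain ⟨p, hpA, hpB⟩ := hAB
  obtain ⟨γ, hγ⟩ := hA.exists_loop hpA
  obtain ⟨δ, hδ⟩ := hB.exists_loop hpB
  exact ⟨(γ.trans δ).toContinuousMap, (Path.trans_range γ δ).trans (by rw [hγ, hδ])⟩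

theorem IsPathImage.union_biUnion {ι : Type*} (hA : IsPathImage A) (T : Finset ι) (B : ι → Set X)
    (hB : ∀ i ∈ T, IsPathImage (B i)) (hAB : ∀ i ∈ T, (A ∩ B i).Nonempty) :
    IsPathImage (A ∪ ⋃ i ∈ T, B i) := by
  classical
  induction T using Finset.induction_on with
  | empty => simpa using hA
  | insert i T hi ih =>
    have h1 := ih (fun i hi => hB i (Finset.mem_insert_of_mem hi))
      (fun i hi => hAB i (Finset.mem_insert_of_mem hi))
    have h2 := h1.union (hB i (Finset.mem_insert_self i T))
      ((hAB i (Finset.mem_insert_self i T)).mono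
        (Set.inter_subset_inter_left _ Set.subset_union_left))
    rw [Finset.set_biUnion_insert, Set.union_comm (B i), ← Set.union_assoc]
    exact h2

end PathImage

/-! ### Truncated graphs -/

variable {r : ℕ}

/-- The part of the graph with `L j` loops on the `j`-th ray. -/
def trunc (L : Fin r → ℕ) : Set (Graph r) := {x | ∀ j, (x.1 j).re ≤ 2 * (L j : ℝ) + 1}

theorem ofReal_mem_loopedRay {t : ℝ} (ht : 0 ≤ t) : (t : ℂ) ∈ loopedRay :=
  Or.inl ⟨by simp, by simpa using ht⟩

theorem continuous_rayPt {Y : Type*} [TopologicalSpace Y] (j : Fin r) {z : Y → ℂ}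
    (hz : ∀ y, z y ∈ loopedRay) (hc : Continuous z) : Continuous fun y => rayPt j (z y) (hz y) :=
  Continuous.subtype_mk ((continuous_single j).comp hc) _

theorem rayPt_mem_trunc {L : Fin r → ℕ} {j : Fin r} {z : ℂ} {hz : z ∈ loopedRay} :
    rayPt j z hz ∈ trunc L ↔ z.re ≤ 2 * (L j : ℝ) + 1 := by
  constructor
  · intro h
    simpa using h j
  · intro h k
    by_cases hk : k = j
    · subst hk
      simpa using h
    · simp only [rayPt_val, Pi.single_eq_of_ne hk, Complex.zero_re]
      positivity

theorem isPathImage_segment (j : Fin r) {a : ℝ} (ha : 0 ≤ a) :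
    IsPathImage {x : Graph r | ∃ (t : ℝ) (ht : 0 ≤ t), t ≤ a ∧
      x = rayPt j (t : ℂ) (ofReal_mem_loopedRay ht)} := by
  have h0 : ∀ t : I, 0 ≤ a * (t : ℝ) := fun t => mul_nonneg ha t.2.1
  refine ⟨⟨fun t : I => rayPt j ((a * t : ℝ) : ℂ) (ofReal_mem_loopedRay (h0 t)),
    continuous_rayPt _ _ (by fun_prop)⟩, ?_⟩
  ext x
  constructor
  · rintro ⟨t, rfl⟩
    exact ⟨_, h0 t, mul_le_of_le_one_right ha t.2.2, rfl⟩
  · rintro ⟨t, ht, hta, rfl⟩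
    rcases ha.eq_or_lt with rfl | ha'
    · obtain rfl := le_antisymm hta ht
      exact ⟨0, by simp⟩
    · refine ⟨⟨t / a, div_nonneg ht ha, (div_le_one ha').2 hta⟩, ?_⟩
      have e : a * (t / a) = t := by field_simp
      exact Subtype.ext (by simp only [ContinuousMap.coe_mk, rayPt_val, e])

theorem isPathImage_loop (j : Fin r) (k : ℕ) :
    IsPathImage {x : Graph r | ∃ (z : ℂ) (hz : z ∈ loopedRay),
      ‖z - (((2 * k + 2 : ℝ) : ℝ) + (1 / 2 : ℝ) * Complex.I)‖ = 1 / 2 ∧ x = rayPt j z hz} := by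
  set c : ℂ := ((2 * k + 2 : ℝ) : ℝ) + (1 / 2 : ℝ) * Complex.I with hc
  have hm : ∀ t : ℝ, ‖c + 1 / 2 * Complex.exp (t * Complex.I) - c‖ = 1 / 2 := by
    intro t
    rw [add_sub_cancel_left, norm_mul, Complex.norm_exp_ofReal_mul_I]
    simp
  have hm' : ∀ t : ℝ, c + 1 / 2 * Complex.exp (t * Complex.I) ∈ loopedRay := fun t =>
    mem_loopedRay.2 (Or.inr ⟨k, hm t⟩)
  refine ⟨⟨fun t : I => rayPt j _ (hm' ((2 * (t : ℝ) - 1) * Real.pi)),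
    continuous_rayPt _ _ (by fun_prop)⟩, ?_⟩
  ext x
  constructor
  · rintro ⟨t, rfl⟩
    exact ⟨_, hm' _, hm _, rfl⟩
  · rintro ⟨z, hz, hzc, rfl⟩
    have hpi := Real.pi_pos
    set s := Complex.arg (z - c) with hs
    have h1 := Complex.neg_pi_lt_arg (z - c)
    have h2 := Complex.arg_le_pi (z - c)
    refine ⟨⟨(s / Real.pi + 1) / 2, ?_, ?_⟩, ?_⟩
    · have : -1 ≤ s / Real.pi := by
        rw [le_div_iff₀ hpi]
        linarith
      linarith
    · have : s / Real.pi ≤ 1 := by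
        rw [div_le_one hpi]
        exact h2
      linarith
    · have e : (2 * ((s / Real.pi + 1) / 2) - 1) * Real.pi = s := by
        field_simp
        ring
      refine Subtype.ext ?_
      simp only [ContinuousMap.coe_mk, rayPt_val, e]
      congr 1
      have h3 := Complex.norm_mul_exp_arg_mul_I (z - c)
      rw [hzc] at h3
      push_cast at h3
      rw [h3]
      ring

/-- The center, the r segments through it and the finitely many loops on them are path images, each
meeting the union of the preceding ones. The point is that a single edge can thus be mapped onto an
entire suited subgraph. -/
theorem isPathImage_trunc [NeZero r] (L : Fin r → ℕ) : IsPathImage (trunc L) := by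
  have h0 : (0 : ℂ) ∈ loopedRay := by simpa using ofReal_mem_loopedRay le_rfl
  have hz : ∀ i j : Fin r, rayPt i 0 h0 = rayPt j 0 h0 := fun i j => Subtype.ext (by simp)
  have h1 : IsPathImage ({rayPt 0 0 h0} : Set (Graph r)) :=
    ⟨ContinuousMap.const _ (rayPt 0 0 h0), Set.range_const⟩
  have h2 := h1.union_biUnion Finset.univ _
    (fun j _ => isPathImage_segment j (a := 2 * (L j : ℝ) + 1) (by positivity))
    (fun j _ => ⟨rayPt 0 0 h0, rfl, 0, le_rfl, by positivity, (hz 0 j).trans (by simp)⟩)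
  have h3 := h2.union_biUnion
    (Finset.univ.sigma fun j => Finset.range (L j)) _
    (fun p _ => isPathImage_loop p.1 p.2) (fun p hp => by
      simp only [Finset.mem_sigma, Finset.mem_univ, Finset.mem_range, true_and] at hp
      have hp' : (p.2 : ℝ) + 1 ≤ L p.1 := by exact_mod_cast hp
      refine ⟨rayPt p.1 ((2 * p.2 + 2 : ℝ) : ℂ) (ofReal_mem_loopedRay (by positivity)), Or.inr ?_,
        _, ofReal_mem_loopedRay (by positivity), by simp, rfl⟩
      simp only [Finset.mem_univ, Set.iUnion_true, Set.mem_iUnion]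
      exact ⟨p.1, _, by positivity, by linarith, rfl⟩)
  convert h3 using 1
  ext x
  obtain ⟨j, z, hz', rfl⟩ := exists_rayPt x
  rw [rayPt_mem_trunc]
  constructor
  · intro hL
    rcases mem_loopedRay.1 hz' with h | ⟨k, h⟩
    · refine Or.inl (Or.inr ?_)
      simp only [Finset.mem_univ, Set.iUnion_true, Set.mem_iUnion]
      refine ⟨j, z.re, h.2, hL, Subtype.ext ?_⟩
      have : z = (z.re : ℂ) := Complex.ext (by simp) (by simpa using h.1)
      simp [← this]
    · refine Or.inr ?_
      simp only [Set.mem_iUnion]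
      refine ⟨⟨j, k⟩, ?_, z, hz', h, rfl⟩
      have h4 := abs_le.1 (re_sub_le_of_loop h)
      have h5 : (2 * k : ℝ) < 2 * L j := by linarith
      norm_cast at h5
      simp
      omega
  · rw [← rayPt_mem_trunc (hz := hz')]
    rintro ((h | h) | h)
    · rw [Set.mem_singleton_iff.1 h, rayPt_mem_trunc, Complex.zero_re]
      positivity
    · simp only [Finset.mem_univ, Set.iUnion_true, Set.mem_iUnion] at h
      obtain ⟨i, t, ht, hta, e⟩ := h
      rw [e, rayPt_mem_trunc]
      simpa using hta
    · simp only [Set.mem_iUnion] at h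
      obtain ⟨p, hp, w, hw, h, e⟩ := h
      simp only [Finset.mem_sigma, Finset.mem_univ, Finset.mem_range, true_and] at hp
      have hp' : (p.2 : ℝ) + 1 ≤ L p.1 := by exact_mod_cast hp
      have h4 := abs_le.1 (re_sub_le_of_loop h)
      rw [e, rayPt_mem_trunc]
      linarith

open Classical in
/-- The retraction onto a truncated graph that collapses the rays. -/
noncomputable def truncRetract (L : Fin r → ℕ) (x : Graph r) : Graph r :=
  ⟨fun j => if (x.1 j).re ≤ 2 * (L j : ℝ) + 1 then x.1 j else ((2 * L j + 1 : ℝ) : ℂ), by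
    obtain ⟨j, z, hz, rfl⟩ := exists_rayPt x
    refine ⟨j, if z.re ≤ 2 * (L j : ℝ) + 1 then z else ((2 * L j + 1 : ℝ) : ℂ), ?_, ?_⟩
    · split_ifs
      · exact hz
      · exact ofReal_mem_loopedRay (by positivity)
    · funext k
      by_cases hk : k = j
      · subst hk
        simp
      · have : (0 : ℝ) ≤ 2 * (L k : ℝ) + 1 := by positivity
        simp [Pi.single_eq_of_ne hk, this]⟩

theorem continuous_truncRetract (L : Fin r → ℕ) : Continuous (truncRetract L) := by
  refine Continuous.subtype_mk (continuous_pi fun j => ?_) _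
  refine Continuous.if_le (continuous_coord j) continuous_const (continuous_coord_re j)
    continuous_const fun x hx => ?_
  exact eq_of_re_eq_odd (mem_loopedRay_of_mem x j) hx

theorem truncRetract_of_mem {L : Fin r → ℕ} {x : Graph r} (hx : x ∈ trunc L) :
    truncRetract L x = x :=
  Subtype.ext (funext fun j => if_pos (hx j))

theorem truncRetract_of_le {L : Fin r → ℕ} {x : Graph r} {j : Fin r}
    (hx : 2 * (L j : ℝ) + 1 ≤ (x.1 j).re) : truncRetract L x = cutVertex j (L j) := by
  refine eq_cutVertex_of_re ?_
  simp only [truncRetract]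
  split_ifs with h
  · exact le_antisymm h hx
  · simp

theorem truncRetract_mem (L : Fin r → ℕ) (x : Graph r) : truncRetract L x ∈ trunc L := by
  intro j
  simp only [truncRetract]
  split_ifs with h
  · exact h
  · simp

/-! ### Homotopy equivalences of subspaces -/

/-- A homotopy equivalence that is compatible with retractions onto a subspace and its image
restricts to a homotopy equivalence. -/
theorem exists_homotopyEquiv_image {X : Type*} [TopologicalSpace X] {f k : C(X, X)}
    (hfk : (f.comp k).Homotopic (ContinuousMap.id X))
    (hkf : (k.comp f).Homotopic (ContinuousMap.id X)) {Z : Set X} {ρ ρ' : C(X, X)}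
    (hρ : ∀ x, ρ x ∈ Z) (hρZ : ∀ x ∈ Z, ρ x = x) (hρ' : ∀ x, ρ' x ∈ f '' Z)
    (hρZ' : ∀ x ∈ f '' Z, ρ' x = x) (hf : ∀ x, f (ρ x) = ρ' (f x)) :
    ∃ e : Z ≃ₕ (f '' Z), ∀ x : Z, (e x : X) = f x := by
  let i : C(Z, X) := ⟨Subtype.val, continuous_subtype_val⟩
  let i' : C(f '' Z, X) := ⟨Subtype.val, continuous_subtype_val⟩
  let s : C(X, Z) := ⟨fun x => ⟨ρ x, hρ x⟩, by fun_prop⟩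
  let s' : C(X, f '' Z) := ⟨fun x => ⟨ρ' x, hρ' x⟩, by fun_prop⟩
  refine ⟨⟨⟨fun x => ⟨f x, x, x.2, rfl⟩, by fun_prop⟩, s.comp (k.comp i'), ?_, ?_⟩, fun x => rfl⟩
  · have h1 := ((ContinuousMap.Homotopic.refl s).comp hkf).comp (ContinuousMap.Homotopic.refl i)
    have h2 : (s.comp (ContinuousMap.id X)).comp i = ContinuousMap.id Z :=
      ContinuousMap.ext fun x => Subtype.ext (hρZ x x.2)
    rw [h2] at h1
    exact h1
  · have h1 := ((ContinuousMap.Homotopic.refl s').comp hfk).comp (ContinuousMap.Homotopic.refl i')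
    have h2 : (s'.comp (ContinuousMap.id X)).comp i' = ContinuousMap.id _ :=
      ContinuousMap.ext fun x => Subtype.ext (hρZ' x x.2)
    rw [h2] at h1
    convert h1 using 1
    exact ContinuousMap.ext fun x => Subtype.ext (hf _)

/-! ### Making a map surjective onto a path image -/

/-- The first edge of a ray. -/
def firstEdge (j : Fin r) : Set (Graph r) := {x | (x.1 j).re ≤ 1 ∧ ∀ k, k ≠ j → x.1 k = 0}

/-- A proper map is properly homotopic to one that maps the first edge of a ray onto a given path
image that contains the image of this edge, and that agrees with the given map elsewhere. -/
theorem exists_surjective_edge (j : Fin r) {f : C(Graph r, Graph r)} (hf : IsProperMap f)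
    {W : Set (Graph r)} (hW : IsPathImage W) (hfW : Set.MapsTo f (firstEdge j) W) :
    ∃ k : C(Graph r, Graph r), ProperHomotopic f k ∧ k '' firstEdge j = W ∧
      ∀ x, (x ∉ firstEdge j ∨ 1 ≤ (x.1 j).re) → k x = f x := by
  have hE : ∀ t : I, ((t : ℝ) : ℂ) ∈ loopedRay := fun t => ofReal_mem_loopedRay t.2.1
  let E : C(I, Graph r) := ⟨fun t => rayPt j (t : ℝ) (hE t), continuous_rayPt _ _ (by fun_prop)⟩
  have hEm : ∀ t, E t ∈ firstEdge j := fun t => by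
    refine ⟨by simpa [E] using t.2.2, fun k hk => ?_⟩
    simp [E, Pi.single_eq_of_ne hk]
  let τ : Graph r → I := fun x => Set.projIcc 0 1 zero_le_one (x.1 j).re
  have hτ : Continuous τ := continuous_projIcc.comp (continuous_coord_re j)
  have hEτ : ∀ x ∈ firstEdge j, E (τ x) = x := by
    intro x hx
    have h0 := re_nonneg_of_mem_loopedRay (mem_loopedRay_of_mem x j)
    have him : (x.1 j).im = 0 := by
      rcases mem_loopedRay.1 (mem_loopedRay_of_mem x j) with h | ⟨k, h⟩
      · exact h.1
      · have h4 := abs_le.1 (re_sub_le_of_loop h)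
        have : (0 : ℝ) ≤ k := k.cast_nonneg
        linarith [hx.1]
    refine Subtype.ext (funext fun k => ?_)
    by_cases hk : k = j
    · subst hk
      have : Set.projIcc (0 : ℝ) 1 zero_le_one (x.1 k).re = ⟨_, h0, hx.1⟩ :=
        Set.projIcc_of_mem zero_le_one ⟨h0, hx.1⟩
      simp only [E, τ, ContinuousMap.coe_mk, rayPt_val, Pi.single_eq_same, this]
      exact Complex.ext (by simp) (by simpa using him.symm)
    · simp [E, Pi.single_eq_of_ne hk, hx.2 k hk]
  have hτE : ∀ t, τ (E t) = t := fun t => by simp [E, τ]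
  -- A loop δ through all of W is run forth and back before the path p that f makes of the edge. As
  -- δ δ⁻¹ p is homotopic to p relative to the end points, nothing changes at the ends of the edge.
  obtain ⟨δ, hδ⟩ := hW.exists_loop (hfW (hEm 0))
  let p : Path (f (E 0)) (f (E 1)) := ⟨f.comp E, rfl, rfl⟩
  let P : p.Homotopy ((δ.trans δ.symm).trans p) := (Path.Homotopy.reflTrans p).symm.trans
    ((Path.Homotopy.reflTransSymm δ).hcomp (Path.Homotopy.refl p))
  classical
  let H : I × Graph r → Graph r := fun y => if y.2 ∈ firstEdge j then P (y.1, τ y.2) else f y.2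
  have hclosed : IsClosed (firstEdge j) := by
    have : firstEdge j = {x : Graph r | (x.1 j).re ≤ 1} ∩
        ⋂ (k : Fin r) (_ : k ≠ j), {x : Graph r | x.1 k = 0} := by
      ext x
      simp [firstEdge]
    rw [this]
    exact (isClosed_le (continuous_coord_re j) continuous_const).inter
      (isClosed_iInter fun k => isClosed_iInter fun _ =>
        isClosed_eq (continuous_coord k) continuous_const)
  have hHA : ∀ y : I × Graph r, y.2 ∈ firstEdge j → H y = P (y.1, τ y.2) := fun y hy => if_pos hy
  have hHB : ∀ y : I × Graph r, (y.2 ∉ firstEdge j ∨ (1 ≤ (y.2.1 j).re ∨ y.2.1 j = 0)) →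
      H y = f y.2 := by
    intro y hy
    by_cases hm : y.2 ∈ firstEdge j
    · rw [hHA y hm]
      rcases hy.resolve_left (not_not.2 hm) with h | h
      · have h1 : τ y.2 = 1 := by
          simp only [τ]
          rw [le_antisymm hm.1 h]
          exact Set.projIcc_right zero_le_one
        have := hEτ _ hm
        rw [h1] at this ⊢
        rw [P.target, this]
      · have h1 : τ y.2 = 0 := by
          simp only [τ]
          rw [h, Complex.zero_re]
          exact Set.projIcc_left zero_le_one
        have := hEτ _ hm
        rw [h1] at this ⊢
        rw [P.source, this]
    · exact if_neg hm
  have hHc : Continuous H := by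
    let S : Bool → Set (I × Graph r) := fun b => Prod.snd ⁻¹'
      (if b then firstEdge j else {x | 1 ≤ (x.1 j).re ∨ x.1 j = 0})
    refine LocallyFinite.continuous (f := S) (locallyFinite_of_finite _) ?_ ?_ ?_
    · refine Set.eq_univ_of_forall fun y => Set.mem_iUnion.2 ?_
      by_cases h1 : 1 ≤ (y.2.1 j).re ∨ y.2.1 j = 0
      · exact ⟨false, h1⟩
      · refine ⟨true, ?_⟩
        push Not at h1
        obtain ⟨i, z, hz, e⟩ := exists_rayPt y.2
        have hij : i = j := by
          by_contra hij
          exact h1.2 (by rw [e, rayPt_val, Pi.single_eq_of_ne (Ne.symm hij)])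
        subst hij
        refine ⟨h1.1.le, fun k hk => ?_⟩
        rw [e, rayPt_val, Pi.single_eq_of_ne hk]
    · rintro (_ | _)
      · exact (IsClosed.union (isClosed_le continuous_const (continuous_coord_re j))
          (isClosed_eq (continuous_coord j) continuous_const)).preimage continuous_snd
      · exact hclosed.preimage continuous_snd
    · rintro (_ | _)
      · exact (f.continuous.comp continuous_snd).continuousOn.congr fun y hy => hHB y (Or.inr hy)
      · have : Continuous fun y : I × Graph r => P (y.1, τ y.2) :=
          (map_continuous P).comp (continuous_fst.prodMk (hτ.comp continuous_snd))
        exact this.continuousOn.congr fun y hy => hHA y hy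
  -- The homotopy is constant off the compact edge, so it has bounded displacement and is proper.
  have hcomp : IsCompact (firstEdge j) := by
    have : firstEdge j = Set.range E := by
      ext x
      exact ⟨fun hx => ⟨_, hEτ x hx⟩, by rintro ⟨t, rfl⟩; exact hEm t⟩
    rw [this]
    exact isCompact_range E.continuous
  obtain ⟨B, hB⟩ := (isCompact_univ.prod hcomp).bddAbove_image
    (f := fun y : I × Graph r => dist (H y) (f y.2)) (by fun_prop)
  refine ⟨⟨fun x => H (1, x), by fun_prop⟩, ProperHomotopic.of_dist_le hf ⟨H, hHc⟩ (fun x => ?_)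
    (fun x => rfl) (B := max B 0) (fun y => ?_), ?_, fun x hx => ?_⟩
  · by_cases hx : x ∈ firstEdge j
    · refine (hHA (0, x) hx).trans ?_
      simp only [ContinuousMap.HomotopyWith.apply_zero]
      exact congrArg f (hEτ x hx)
    · exact hHB (0, x) (Or.inl hx)
  · by_cases hy : y.2 ∈ firstEdge j
    · exact (hB ⟨y, ⟨trivial, hy⟩, rfl⟩).trans (le_max_left _ _)
    · change dist (H y) (f y.2) ≤ _
      rw [hHB y (Or.inl hy), dist_self]
      exact le_max_right _ _
  · have hr : Set.range ((δ.trans δ.symm).trans p) = W := by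
      rw [Path.trans_range, Path.trans_range, Path.symm_range, hδ, Set.union_self]
      refine Set.union_eq_self_of_subset_right ?_
      rintro _ ⟨t, rfl⟩
      exact hfW (hEm t)
    rw [← hr]
    ext y
    constructor
    · rintro ⟨x, hx, rfl⟩
      refine ⟨τ x, ?_⟩
      refine Eq.trans ?_ (hHA (1, x) hx).symm
      simp only [ContinuousMap.HomotopyWith.apply_one]
      rfl
    · rintro ⟨t, rfl⟩
      refine ⟨E t, hEm t, (hHA (1, E t) (hEm t)).trans ?_⟩
      simp only [hτE, ContinuousMap.HomotopyWith.apply_one]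
      rfl
  · exact hHB (1, x) (hx.imp_right Or.inl)

/-! ### Congruent eventual translations of the graph are asymptotically rigid -/

namespace GraphRigidStructure

variable {g h r : ℕ} (R : GraphRigidStructure g h r)

/-- The union of the core and the first `b j` pieces of the `j`-th ray. -/
def suited (b : Fin r → ℕ) : Set (Graph r) := trunc fun j => R.coreLoops j + h * b j

theorem level_mono {i i' : ℕ} (hi : i ≤ i') (j : Fin r) :
    ((R.coreLoops j + h * i : ℕ) : ℝ) ≤ (R.coreLoops j + h * i' : ℕ) := by
  have : R.coreLoops j + h * i ≤ R.coreLoops j + h * i' := by gcongr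
  exact_mod_cast this

theorem core_subset_suited (b : Fin r → ℕ) : R.core ⊆ R.suited b := fun x hx j => by
  have := hx j
  have h2 := R.level_mono (Nat.zero_le (b j)) j
  rw [mul_zero, add_zero] at h2
  linarith

theorem eq_zero_of_mem_piece {x : Graph r} {p : ℕ × Fin r} (hx : x ∈ R.piece p) {k : Fin r}
    (hk : k ≠ p.2) : x.1 k = 0 := by
  rw [eq_single_of_re_pos (x := x) (j := p.2)
    (lt_of_lt_of_le (by positivity) (R.mem_piece.1 hx).1), Pi.single_eq_of_ne hk]

theorem mem_suited_of_mem_piece {b : Fin r → ℕ} {x : Graph r} {p : ℕ × Fin r}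
    (hx : x ∈ R.piece p) : x ∈ R.suited b ↔
      (x.1 p.2).re ≤ 2 * ((R.coreLoops p.2 + h * b p.2 : ℕ) : ℝ) + 1 := by
  refine ⟨fun hb => hb p.2, fun hb k => ?_⟩
  by_cases hk : k = p.2
  · subst hk
    exact hb
  · rw [R.eq_zero_of_mem_piece hx hk, Complex.zero_re]
    positivity

theorem isSuited_suited [NeZero r] (hh : 1 ≤ h) (b : Fin r → ℕ) : R.IsSuited (R.suited b) := by
  refine ⟨(isPathImage_trunc _).isPathConnected.isConnected,
    Finset.univ.biUnion fun j => (Finset.range (b j)).image fun i => (i, j), ?_⟩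
  ext x
  constructor
  · revert x
    refine R.forall_of_part hh (fun x hx _ => Or.inl hx) fun p x hx hb => ?_
    rw [R.mem_suited_of_mem_piece hx] at hb
    rcases lt_or_ge p.1 (b p.2) with hp | hp
    · refine Or.inr (Set.mem_iUnion₂.2 ⟨p, ?_, hx⟩)
      simp only [Finset.mem_biUnion, Finset.mem_univ, Finset.mem_image, Finset.mem_range, true_and]
      exact ⟨p.2, p.1, hp, rfl⟩
    · have h1 := R.level_mono hp p.2
      have h2 := (R.mem_piece.1 hx).1
      have h3 : (x.1 p.2).re = 2 * ((R.coreLoops p.2 + h * b p.2 : ℕ) : ℝ) + 1 := by linarith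
      rw [eq_cutVertex_of_re h3]
      rcases Nat.eq_zero_or_pos (b p.2) with h0 | h0
      · refine Or.inl fun k => ?_
        rw [h0, mul_zero, add_zero]
        by_cases hk : k = p.2
        · subst hk
          simp
        · simp only [cutVertex, Pi.single_eq_of_ne hk, Complex.zero_re]
          positivity
      · obtain ⟨i, hi⟩ := Nat.exists_eq_add_of_lt h0
        have hi' : b p.2 = i + 1 := by omega
        refine Or.inr (Set.mem_iUnion₂.2 ⟨(i, p.2), ?_, ?_⟩)
        · simp only [Finset.mem_biUnion, Finset.mem_univ, Finset.mem_image, Finset.mem_range,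
            true_and]
          exact ⟨p.2, i, by omega, rfl⟩
        · rw [hi']
          exact (R.plusPt (i, p.2)).2
  · rintro (hx | hx)
    · exact R.core_subset_suited b hx
    · obtain ⟨p, hp, hx⟩ := Set.mem_iUnion₂.1 hx
      simp only [Finset.mem_biUnion, Finset.mem_univ, Finset.mem_image, Finset.mem_range,
        true_and] at hp
      obtain ⟨j, i, hi, rfl⟩ := hp
      rw [R.mem_suited_of_mem_piece hx]
      have h1 := R.level_mono (Nat.succ_le_of_lt hi) j
      have h2 := (R.mem_piece.1 hx).2
      simp only at h2 ⊢
      linarith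

/-- At most the first vertex of the piece belongs to the suited subgraph, and it is a limit of
points farther out on the ray. -/
theorem piece_subset_closure_compl {b : Fin r → ℕ} {p : ℕ × Fin r} (hp : b p.2 ≤ p.1) :
    R.piece p ⊆ closure (R.suited b)ᶜ := by
  intro x hx
  by_cases hb : x ∈ R.suited b
  · have h1 := R.level_mono hp p.2
    have h2 := (R.mem_piece.1 hx).1
    rw [R.mem_suited_of_mem_piece hx] at hb
    set L := R.coreLoops p.2 + h * b p.2 with hL
    have h3 : (x.1 p.2).re = 2 * (L : ℝ) + 1 := by linarith
    let γ : ℝ → Graph r := fun s => rayPt p.2 ((2 * (L : ℝ) + 1 + |s| : ℝ) : ℂ)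
      (ofReal_mem_loopedRay (by positivity))
    have hγ : Continuous γ := continuous_rayPt _ _ (by fun_prop)
    have h0 : γ 0 = x := by
      rw [eq_cutVertex_of_re h3]
      simp [γ, rayPt, cutVertex]
    have ht : Filter.Tendsto γ (𝓝[>] 0) (𝓝 x) := h0 ▸ hγ.continuousAt.continuousWithinAt
    refine mem_closure_of_tendsto ht ?_
    filter_upwards [self_mem_nhdsWithin] with s hs hs'
    have h4 := hs' p.2
    simp only [γ, rayPt_val, Pi.single_eq_same, Complex.ofReal_re] at h4
    have h5 : 0 < |s| := abs_pos.2 (ne_of_gt hs)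
    rw [← hL] at h4
    linarith
  · exact subset_closure hb

theorem le_of_piece_subset_closure_compl (hh : 1 ≤ h) {b : Fin r → ℕ} {p : ℕ × Fin r}
    (hp : R.piece p ⊆ closure (R.suited b)ᶜ) : b p.2 ≤ p.1 := by
  by_contra! hlt
  set L := R.coreLoops p.2 + h * p.1 with hL
  -- The attaching point of the first loop of the piece lies in its interior, hence has a
  -- neighborhood inside the suited subgraph if the piece belongs to it.
  let x : Graph r := rayPt p.2 ((2 * (L : ℝ) + 2 : ℝ) : ℂ) (ofReal_mem_loopedRay (by positivity))
  have hxre : (x.1 p.2).re = 2 * (L : ℝ) + 2 := by simp [x]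
  have h1 := R.level_mono (Nat.succ_le_of_lt hlt) p.2
  have h2 : ((R.coreLoops p.2 + h * (p.1 + 1) : ℕ) : ℝ) = L + h := by
    rw [hL]
    push_cast
    ring
  have hh' : (1 : ℝ) ≤ h := by exact_mod_cast hh
  have hx : x ∈ R.piece p := by
    rw [mem_piece, hxre, h2, ← hL]
    constructor <;> linarith
  rw [Nat.succ_eq_add_one, h2] at h1
  have hU : IsOpen {y : Graph r | 0 < (y.1 p.2).re ∧
      (y.1 p.2).re < 2 * ((R.coreLoops p.2 + h * b p.2 : ℕ) : ℝ) + 1} :=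
    (isOpen_lt continuous_const (continuous_coord_re _)).inter
      (isOpen_lt (continuous_coord_re _) continuous_const)
  obtain ⟨y, ⟨hy0, hy1⟩, hy⟩ := mem_closure_iff.1 (hp hx) _ hU
    ⟨by rw [hxre]; positivity, by rw [hxre]; linarith⟩
  refine hy fun k => ?_
  by_cases hk : k = p.2
  · subst hk
    exact hy1.le
  · rw [eq_single_of_re_pos hy0, Pi.single_eq_of_ne hk, Complex.zero_re]
    positivity

theorem image_piece_eq {f : Graph r → Graph r} {p q : ℕ × Fin r}
    (hf : ∀ x : R.piece p, f x = (R.unmark q (R.mark p x)).1) : f '' R.piece p = R.piece q := by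
  ext y
  constructor
  · rintro ⟨x, hx, rfl⟩
    rw [hf ⟨x, hx⟩]
    exact Subtype.prop _
  · intro hy
    obtain ⟨z, hz⟩ := R.unmark_surjective q ⟨y, hy⟩
    obtain ⟨x, rfl⟩ := R.mark_surjective p z
    exact ⟨x, x.2, by rw [hf, hz]⟩

/-- Conjugated with the standardizer, the translation acts on distant pieces by φ_q⁻¹ φ_p on the
nose. What happens near the core is uncontrolled, so Z is taken large enough for its image to lie in
the expected suited subgraph, and then f is changed on one edge so that it maps Z onto this
subgraph. -/
theorem exists_rigid_of_mem_congruentTranslations [NeZero r] (hh : 1 ≤ h) {u : MapGraph (Graph r)}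
    (hu : u ∈ congruentTranslations IsGraphTranslation h R.coreLoops) :
    ∃ (f : C(Graph r, Graph r)) (hf : IsProperMap f),
      (R.standardizer hh * u * (R.standardizer hh)⁻¹ : MapGraph (Graph r)).1 =
        ProperHomotopyClass.mk f hf ∧ R.IsAsymptoticallyRigid f := by
  obtain ⟨ρ, n, ⟨f, hf, m, hu, ht⟩, hn⟩ := hu
  choose d hd using hn
  -- From c_j + n_j - c_{ρ j} = h d_j, the piece (i, j) moves to (i + d_j, ρ j). The bound M₀ makes
  -- these indices nonnegative and, as h ≥ 1, puts the pieces beyond the level m.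
  set M₀ := m + ∑ j, (d j).natAbs with hM₀
  have hM₀d : ∀ j, 0 ≤ (M₀ : ℤ) + d j := fun j => by
    have := Finset.single_le_sum (f := fun j => (d j).natAbs) (fun _ _ => Nat.zero_le _)
      (Finset.mem_univ j)
    omega
  set b₀ : Fin r → ℕ := fun j => ((M₀ : ℤ) + d j).toNat with hb₀
  have hb₀' : ∀ j, (b₀ j : ℤ) = M₀ + d j := fun j => Int.toNat_of_nonneg (hM₀d j)
  set f₁ : C(Graph r, Graph r) := ((R.fromStandard hh).comp f).comp (R.toStandard hh) with hf₁
  have hf₁p : IsProperMap f₁ :=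
    ((R.isProperMap_fromStandard hh).comp hf).comp (R.isProperMap_toStandard hh)
  have hu₁ : (R.standardizer hh * u * (R.standardizer hh)⁻¹ : MapGraph (Graph r)).1 =
      ProperHomotopyClass.mk f₁ hf₁p := by
    rw [Units.val_mul, Units.val_mul, hu]
    rfl
  have e₁ : ∀ i j (x : R.piece (M₀ + i, j)),
      f₁ x = (R.unmark (b₀ j + i, ρ j) (R.mark (M₀ + i, j) x)).1 := by
    intro i j x
    simp only [hf₁, ContinuousMap.comp_apply]
    rw [R.toStandard_piece]
    set y := (R.shift (M₀ + i, j)).symm (R.mark (M₀ + i, j) x) with hy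
    have h1 := (R.mem_piece.1 y.2).1
    have h2 : (m : ℝ) ≤ (R.coreLoops j + h * (M₀ + i) : ℕ) := by
      have h3 : m ≤ 1 * (M₀ + i) := by omega
      have h4 : m ≤ R.coreLoops j + h * (M₀ + i) :=
        h3.trans ((Nat.mul_le_mul_right _ hh).trans (Nat.le_add_left _ _))
      exact_mod_cast h4
    have h5 : f y.1 = ((R.shift (b₀ j + i, ρ j)).symm (R.shift (M₀ + i, j) y)).1 := by
      refine Subtype.ext ?_
      rw [R.shift_symm_shift_val, ht y.1 j (by simp only at h1; linarith)]
      congr 3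
      have h6 := hd j
      have h7 := hb₀' j
      have h8 : n j = (((R.coreLoops (ρ j) + h * (b₀ j + i) : ℕ) : ℤ) -
          ((R.coreLoops j + h * (M₀ + i) : ℕ) : ℤ)) := by
        push_cast
        rw [h7]
        linear_combination h6
      exact_mod_cast h8
    rw [h5, R.fromStandard_piece, Homeomorph.apply_symm_apply, hy, Homeomorph.apply_symm_apply]
  -- K bounds the image of the compact part before M₀. Since each piece has a loop, K further pieces
  -- on every ray of source and target make the target contain this image.
  obtain ⟨K, hK⟩ : ∃ K : ℕ, ∀ x ∈ R.suited fun _ => M₀, ∀ k, ((f₁ x).1 k).re ≤ K := by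
    have : ∀ k, ∃ B, ∀ x ∈ R.suited fun _ => M₀, ((f₁ x).1 k).re ≤ B := fun k => by
      obtain ⟨B, hB⟩ := (isCompact_trunc fun j => 2 * ((R.coreLoops j + h * M₀ : ℕ) : ℝ) +
        1).bddAbove_image (f := fun x => ((f₁ x).1 k).re)
        ((continuous_coord_re k).comp f₁.continuous).continuousOn
      exact ⟨B, fun x hx => hB ⟨x, hx, rfl⟩⟩
    choose B hB using this
    obtain ⟨K, hK⟩ := exists_nat_ge (∑ k, |B k|)
    refine ⟨K, fun x hx k => (hB k x hx).trans ((le_abs_self _).trans (le_trans ?_ hK))⟩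
    exact Finset.single_le_sum (f := fun k => |B k|) (fun _ _ => abs_nonneg _) (Finset.mem_univ k)
  set Z := R.suited fun _ => M₀ + K with hZ
  set b : Fin r → ℕ := fun k => b₀ (ρ.symm k) + K with hb
  have hbρ : ∀ j, b (ρ j) = b₀ j + K := fun j => by simp [hb]
  have hmaps : Set.MapsTo f₁ Z (R.suited b) := by
    intro x hx
    by_cases hx₀ : x ∈ R.suited fun _ => M₀
    · intro k
      have h1 := hK x hx₀ k
      have h2 : K ≤ R.coreLoops k + h * b k := by
        have h3 : 1 * K ≤ h * b k := Nat.mul_le_mul hh (Nat.le_add_left _ _)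
        omega
      have h4 : (K : ℝ) ≤ (R.coreLoops k + h * b k : ℕ) := by exact_mod_cast h2
      have h5 : (0 : ℝ) ≤ K := K.cast_nonneg
      linarith
    · simp only [suited, trunc, Set.mem_ofPred_eq, not_forall, not_le] at hx₀
      obtain ⟨j, hj⟩ := hx₀
      obtain ⟨i, hi, hxi⟩ := R.exists_mem_piece_of_re hh hj.le
      obtain ⟨i, rfl⟩ := Nat.exists_eq_add_of_le hi
      have h6 := e₁ i j ⟨x, hxi⟩
      have h7 : f₁ x ∈ R.piece (b₀ j + i, ρ j) := by
        rw [h6]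
        exact Subtype.prop _
      rw [R.mem_suited_of_mem_piece h7]
      rcases lt_or_ge i K with hiK | hiK
      · refine (R.mem_piece.1 h7).2.trans ?_
        have := R.level_mono (i := b₀ j + i + 1) (i' := b (ρ j)) (by rw [hbρ]; omega) (ρ j)
        simp only
        linarith
      · have h8 : (x.1 j).re = 2 * ((R.coreLoops j + h * (M₀ + i) : ℕ) : ℝ) + 1 := by
          refine le_antisymm ((hx j).trans ?_) (R.mem_piece.1 hxi).1
          have := R.level_mono (i := M₀ + K) (i' := M₀ + i) (by omega) j
          linarith
        have h9 : i = K := by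
          have := hx j
          rw [h8] at this
          have h10 : R.coreLoops j + h * (M₀ + i) ≤ R.coreLoops j + h * (M₀ + K) := by
            have : ((R.coreLoops j + h * (M₀ + i) : ℕ) : ℝ) ≤
              (R.coreLoops j + h * (M₀ + K) : ℕ) := by linarith
            exact_mod_cast this
          have := Nat.le_of_mul_le_mul_left (Nat.le_of_add_le_add_left h10) hh
          omega
        subst h9
        have h11 : (⟨x, hxi⟩ : R.piece (M₀ + i, j)) = R.minusPt (M₀ + i, j) :=
          Subtype.ext (eq_cutVertex_of_re h8)
        rw [h6, h11, R.mark_minus, R.unmark_minus]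
        simp only [minusPt, cutVertex_re]
        rw [hbρ]
  have hedge : firstEdge (0 : Fin r) ⊆ Z := fun x hx k => by
    have h1 : (x.1 k).re ≤ 1 := by
      by_cases hk : k = 0
      · subst hk
        exact hx.1
      · rw [hx.2 k hk]
        simp
    refine h1.trans ?_
    have : (0 : ℝ) ≤ 2 * ((R.coreLoops k + h * (M₀ + K) : ℕ) : ℝ) := by positivity
    linarith
  -- So far f maps Z into the target, perhaps not onto it. The first edge lies in the core and meets
  -- pieces at most in its outer end point, where f is not changed, so rigidity on the distant
  -- pieces persists.
  obtain ⟨f₂, hf₁₂, him, heq⟩ := exists_surjective_edge 0 hf₁p (W := R.suited b)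
    (isPathImage_trunc _) (hmaps.mono_left hedge)
  have hf₂p := hf₁₂.isProperMap_right
  have hu₂ : (R.standardizer hh * u * (R.standardizer hh)⁻¹ : MapGraph (Graph r)).1 =
      ProperHomotopyClass.mk f₂ hf₂p := hu₁.trans (Quotient.sound hf₁₂)
  have himZ : f₂ '' Z = R.suited b := by
    refine Set.Subset.antisymm ?_ (him ▸ Set.image_mono hedge)
    rintro _ ⟨x, hx, rfl⟩
    by_cases hx' : x ∈ firstEdge (0 : Fin r)
    · rw [← him]
      exact ⟨x, hx', rfl⟩
    · rw [heq x (Or.inl hx')]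
      exact hmaps hx
  have e₂ : ∀ i j (x : R.piece (M₀ + i, j)),
      f₂ x = (R.unmark (b₀ j + i, ρ j) (R.mark (M₀ + i, j) x)).1 := by
    intro i j x
    rw [← e₁]
    refine heq _ ?_
    have h1 := (R.mem_piece.1 x.2).1
    have h2 : (0 : ℝ) ≤ ((R.coreLoops j + h * (M₀ + i) : ℕ) : ℝ) := Nat.cast_nonneg _
    by_cases hj : j = 0
    · subst hj
      right
      simp only at h1
      linarith
    · left
      intro hx
      have h3 := hx.2 j hj
      simp only at h1
      rw [h3, Complex.zero_re] at h1
      linarith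
  refine ⟨f₂, hf₂p, hu₂, Z, R.isSuited_suited hh _, himZ ▸ R.isSuited_suited hh b, ?_, ?_⟩
  · set v := R.standardizer hh * u * (R.standardizer hh)⁻¹ with hv
    obtain ⟨⟨k, hk⟩, hk'⟩ := Quotient.exists_rep (v⁻¹ : MapGraph (Graph r)).1
    have h1 : ProperHomotopyClass.mk (f₂.comp k) (hf₂p.comp hk) =
        ProperHomotopyClass.mk (ContinuousMap.id _) isProperMap_id := by
      have := v.mul_inv
      rw [hu₂, ← hk'] at this
      exact this
    have h2 : ProperHomotopyClass.mk (k.comp f₂) (hk.comp hf₂p) =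
        ProperHomotopyClass.mk (ContinuousMap.id _) isProperMap_id := by
      have := v.inv_mul
      rw [hu₂, ← hk'] at this
      exact this
    have h1' : ProperHomotopic (f₂.comp k) (ContinuousMap.id _) := Quotient.exact h1
    have h2' : ProperHomotopic (k.comp f₂) (ContinuousMap.id _) := Quotient.exact h2
    -- The retractions that collapse the rays beyond Z and beyond f(Z) are intertwined by f, because
    -- f maps the tail of the j-th ray into that of the ρ j-th ray and its first vertex to the first
    -- vertex. Hence a homotopy inverse on all of Γ_r descends.
    refine exists_homotopyEquiv_image ⟨h1'.choose⟩ ⟨h2'.choose⟩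
      (ρ := ⟨_, continuous_truncRetract fun j => R.coreLoops j + h * (M₀ + K)⟩)
      (ρ' := ⟨_, continuous_truncRetract fun j => R.coreLoops j + h * b j⟩)
      (truncRetract_mem _) (fun x hx => truncRetract_of_mem hx)
      (fun x => himZ ▸ truncRetract_mem _ x) (fun x hx => truncRetract_of_mem (himZ ▸ hx :)) ?_
    intro x
    simp only [ContinuousMap.coe_mk]
    by_cases hx : x ∈ Z
    · rw [truncRetract_of_mem hx, truncRetract_of_mem]
      have : f₂ x ∈ f₂ '' Z := ⟨x, hx, rfl⟩
      rw [himZ] at this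
      exact this
    · simp only [hZ, suited, trunc, Set.mem_ofPred_eq, not_forall, not_le] at hx
      obtain ⟨j, hj⟩ := hx
      rw [truncRetract_of_le hj.le]
      obtain ⟨i, hi, hxi⟩ := R.exists_mem_piece_of_re hh hj.le
      obtain ⟨i, rfl⟩ := Nat.exists_eq_add_of_le hi
      rw [add_assoc] at hxi
      have h6 := e₂ (K + i) j ⟨x, hxi⟩
      have h7 : f₂ x ∈ R.piece (b₀ j + (K + i), ρ j) := by
        rw [h6]
        exact Subtype.prop _
      have h8 := R.level_mono (i := b (ρ j)) (i' := b₀ j + (K + i)) (by rw [hbρ]; omega) (ρ j)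
      rw [truncRetract_of_le (j := ρ j)]
      · have h9 := e₂ K j (R.minusPt (M₀ + K, j))
        rw [R.mark_minus, R.unmark_minus] at h9
        rw [hbρ]
        exact h9
      · refine le_trans ?_ (R.mem_piece.1 h7).1
        simp only
        linarith
  · intro p hp
    have hMp := R.le_of_piece_subset_closure_compl hh hp
    obtain ⟨i, j⟩ := p
    obtain ⟨i, rfl⟩ : ∃ i', i = M₀ + (K + i') := ⟨i - (M₀ + K), by simp only at hMp; omega⟩
    refine ⟨(b₀ j + (K + i), ρ j), ?_, R.image_piece_eq (e₂ (K + i) j), e₂ (K + i) j⟩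
    rw [himZ]
    exact R.piece_subset_closure_compl (by simp only [hbρ]; omega)

end GraphRigidStructure

/-! ### Commensurability of graph Houghton groups -/

theorem commensurable_graphHoughtonGroup {g h g' h' r : ℕ} (hh : 1 ≤ h) (hh' : 1 ≤ h') (hr : 1 ≤ r)
    (R : GraphRigidStructure g h r) (R' : GraphRigidStructure g' h' r) :
    Commensurable R.houghtonGroup R'.houghtonGroup := by
  have : NeZero r := ⟨by omega⟩
  exact commensurable_closure_of_conj IsGraphTranslation isGraphTranslation_one
    isGraphTranslation_mul hh hh' R.coreLoops R'.coreLoops (R.standardizer hh) (R'.standardizer hh')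
    (fun u => ⟨fun ⟨_, _, hu, hf⟩ => R.mem_congruentTranslations_of_rigid hh hu hf,
      R.exists_rigid_of_mem_congruentTranslations hh⟩)
    (fun u => ⟨fun ⟨_, _, hu, hf⟩ => R'.mem_congruentTranslations_of_rigid hh' hu hf,
      R'.exists_rigid_of_mem_congruentTranslations hh'⟩)

/-! ### Gluing homeomorphisms -/

/-- The preimage of a closed set is a locally finite union of continuous images of compact sets,
hence closed. -/
theorem continuous_of_cover {X X' ι : Type*} [TopologicalSpace X] [TopologicalSpace X']
    [T2Space X] (A : ι → Type*) [∀ i, TopologicalSpace (A i)] [∀ i, CompactSpace (A i)]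
    {e : ∀ i, A i → X} {e' : ∀ i, A i → X'} {F : X → X'} (he : ∀ i, Continuous (e i))
    (he' : ∀ i, Continuous (e' i)) (lf : LocallyFinite fun i => Set.range (e i))
    (cov : ⋃ i, Set.range (e i) = Set.univ) (hF : ∀ i x, F (e i x) = e' i x) : Continuous F := by
  rw [continuous_iff_isClosed]
  intro C hC
  have h1 : F ⁻¹' C = ⋃ i, e i '' (e' i ⁻¹' C) := by
    ext x
    simp only [Set.mem_preimage, Set.mem_iUnion, Set.mem_image]
    constructor
    · intro hx
      obtain ⟨i, y, rfl⟩ := Set.mem_iUnion.1 ((Set.ext_iff.1 cov x).2 trivial)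
      exact ⟨i, y, by rwa [← hF], rfl⟩
    · rintro ⟨i, y, hy, rfl⟩
      rwa [hF]
  rw [h1]
  refine LocallyFinite.isClosed_iUnion (lf.subset fun i => Set.image_subset_range _ _) fun i => ?_
  exact ((hC.preimage (he' i)).isCompact.image (he i)).isClosed

/-- Two spaces that are covered in the same way by locally finite families of images of compact
spaces are homeomorphic. -/
theorem exists_homeomorph_of_cover {X X' ι : Type*} [TopologicalSpace X] [TopologicalSpace X']
    [T2Space X] [T2Space X'] (A : ι → Type*) [∀ i, TopologicalSpace (A i)]
    [∀ i, CompactSpace (A i)] {e : ∀ i, A i → X} {e' : ∀ i, A i → X'} (he : ∀ i, Continuous (e i))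
    (he' : ∀ i, Continuous (e' i)) (lf : LocallyFinite fun i => Set.range (e i))
    (lf' : LocallyFinite fun i => Set.range (e' i)) (cov : ⋃ i, Set.range (e i) = Set.univ)
    (cov' : ⋃ i, Set.range (e' i) = Set.univ)
    (compat : ∀ i k x y, e i x = e k y ↔ e' i x = e' k y) :
    ∃ F : X ≃ₜ X', ∀ i x, F (e i x) = e' i x := by
  have hs : ∀ x, ∃ p : Σ i, A i, e p.1 p.2 = x := fun x => by
    obtain ⟨i, y, hy⟩ := Set.mem_iUnion.1 ((Set.ext_iff.1 cov x).2 trivial)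
    exact ⟨⟨i, y⟩, hy⟩
  have hs' : ∀ x, ∃ p : Σ i, A i, e' p.1 p.2 = x := fun x => by
    obtain ⟨i, y, hy⟩ := Set.mem_iUnion.1 ((Set.ext_iff.1 cov' x).2 trivial)
    exact ⟨⟨i, y⟩, hy⟩
  choose s hs using hs
  choose s' hs' using hs'
  have hF : ∀ i x, e' (s (e i x)).1 (s (e i x)).2 = e' i x := fun i x =>
    (compat _ _ _ _).1 (hs _)
  have hF' : ∀ i x, e (s' (e' i x)).1 (s' (e' i x)).2 = e i x := fun i x =>
    (compat _ _ _ _).2 (hs' _)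
  refine ⟨⟨⟨fun x => e' (s x).1 (s x).2, fun x => e (s' x).1 (s' x).2, fun x => ?_, fun x => ?_⟩,
    continuous_of_cover A he he' lf cov hF,
    continuous_of_cover A he' he lf' cov' hF'⟩, hF⟩
  · exact (hF' _ _).trans (hs x)
  · exact (hF _ _).trans (hs' x)

/-! ### The ray of the doubled handlebody -/

theorem profile_add_even (t y : ℝ) (n : ℤ) : profile (t + 2 * n) y = profile t y := by
  have : Real.cos (Real.pi * (t + 2 * n)) = Real.cos (Real.pi * t) := by
    rw [show Real.pi * (t + 2 * n) = Real.pi * t + n * (2 * Real.pi) by ring]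
    exact Real.cos_add_int_mul_two_pi _ n
  rw [profile, profile, this]

theorem continuous_profile : Continuous fun p : ℝ × ℝ => profile p.1 p.2 := by
  unfold profile
  fun_prop

theorem profile_le (t y : ℝ) : profile t y ≤ 1 - y ^ 2 := min_le_left _ _

theorem profile_one (t : ℝ) : profile t 1 = 0 := by
  rw [profile, min_eq_left]
  · norm_num
  · have := Real.neg_one_le_cos (Real.pi * t)
    linarith

/-- Near t = 0 the double is a product of a sphere and an interval, so a boundary sphere can be
pushed into its piece without changing the sphere coordinates. -/
theorem profile_of_abs_le {t : ℝ} (ht : |t| ≤ 1 / 2) (y : ℝ) : profile t y = 1 - y ^ 2 := by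
  rw [profile, min_eq_left]
  have hpi := Real.pi_pos
  have h1 := abs_le.1 ht
  have : 0 ≤ Real.cos (Real.pi * t) :=
    Real.cos_nonneg_of_neg_pi_div_two_le_of_le (by nlinarith) (by nlinarith)
  nlinarith [sq_nonneg y]

theorem edge_mem_rayDouble {t : ℝ} (ht : 0 ≤ t) : ((t, 1, 0) : ℝ × ℝ × ℂ) ∈ rayDouble :=
  ⟨ht, by simp [profile_one]⟩

theorem add_mem_rayDouble {q : ℝ × ℝ × ℂ} (hq : q ∈ rayDouble) {n : ℤ} (hn : 0 ≤ q.1 + 2 * n) :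
    (q.1 + 2 * n, q.2) ∈ rayDouble :=
  ⟨hn, by
    rw [profile_add_even]
    exact hq.2⟩

theorem sphere_of_mem_rayDouble {q : ℝ × ℝ × ℂ} (hq : q ∈ rayDouble) {k : ℕ}
    (hk : q.1 = 2 * k) : q.2 ∈ UnitSphere := by
  have h1 := hq.2
  rw [hk, profile_even] at h1
  change q.2.1 ^ 2 + ‖q.2.2‖ ^ 2 = 1
  linarith

theorem isClosed_rayDouble : IsClosed rayDouble := by
  refine (isClosed_le continuous_const continuous_fst).inter (isClosed_eq (by fun_prop) ?_)
  exact continuous_profile.comp (continuous_fst.prodMk (continuous_fst.comp continuous_snd))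

theorem abs_le_of_mem_rayDouble {q : ℝ × ℝ × ℂ} (hq : q ∈ rayDouble) :
    |q.2.1| ≤ 1 ∧ ‖q.2.2‖ ≤ 1 := by
  have h1 := hq.2
  have h2 := profile_le q.1 q.2.1
  have h3 := sq_nonneg ‖q.2.2‖
  have h4 := sq_nonneg q.2.1
  exact ⟨abs_le_one_iff_mul_self_le_one.2 (by nlinarith),
    (sq_le_one_iff₀ (norm_nonneg _)).1 (by linarith)⟩

theorem isCompact_refDoublePiece (h : ℕ) : IsCompact (refDoublePiece h) := by
  refine Metric.isCompact_of_isClosed_isBounded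
    (isClosed_rayDouble.inter (isClosed_le continuous_fst continuous_const)) ?_
  refine ((isCompact_Icc (a := (0 : ℝ)) (b := 2 * h)).isBounded.prod
    ((Metric.isBounded_closedBall (x := (0 : ℝ)) (r := 1)).prod
      (Metric.isBounded_closedBall (x := (0 : ℂ)) (r := 1)))).subset ?_
  rintro q ⟨hq, hq'⟩
  have := abs_le_of_mem_rayDouble hq
  exact ⟨⟨hq.1, hq'⟩, by simpa using this.1, by simpa using this.2⟩

instance (h : ℕ) : CompactSpace (refDoublePiece h) :=
  isCompact_iff_compactSpace.1 (isCompact_refDoublePiece h)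

theorem isConnected_unitCircle : IsConnected {v : ℂ | ‖v‖ = 1} := by
  have : {v : ℂ | ‖v‖ = 1} = Set.range fun t : ℝ => Complex.exp (t * Complex.I) := by
    ext v
    constructor
    · intro hv
      have hv' : ‖v‖ = 1 := hv
      have := Complex.norm_mul_exp_arg_mul_I v
      rw [hv', Complex.ofReal_one, one_mul] at this
      exact ⟨_, this⟩
    · rintro ⟨t, rfl⟩
      exact Complex.norm_exp_ofReal_mul_I t
  rw [this]
  exact isConnected_range (by fun_prop)

theorem exists_eq_sqrt_mul {w : ℂ} {a : ℝ} (h : ‖w‖ ^ 2 = a) :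
    ∃ v : ℂ, ‖v‖ = 1 ∧ w = (Real.sqrt a : ℂ) * v := by
  rw [← h, Real.sqrt_sq (norm_nonneg _)]
  exact ⟨Complex.exp (Complex.arg w * Complex.I), Complex.norm_exp_ofReal_mul_I _,
    (Complex.norm_mul_exp_arg_mul_I w).symm⟩

/-- The profile condition in the holes relaxes as y² grows. So every point can be moved vertically
away from y = 0 to an edge y = ±1, which runs along the whole strip to t = 0, where all |y| ≤ 1 are
allowed. -/
theorem isConnected_profile_nonneg (h : ℕ) :
    IsConnected {p : ℝ × ℝ | (0 ≤ p.1 ∧ p.1 ≤ 2 * h) ∧ 0 ≤ profile p.1 p.2} := by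
  set D := {p : ℝ × ℝ | (0 ≤ p.1 ∧ p.1 ≤ 2 * h) ∧ 0 ≤ profile p.1 p.2} with hD
  have h0 : (0 : ℝ) ≤ 2 * h := by positivity
  have vert : ∀ t y y' : ℝ, (t, y) ∈ D → y ^ 2 ≤ y' ^ 2 → 0 ≤ y * y' → y' ^ 2 ≤ 1 →
      JoinedIn D (t, y) (t, y') := by
    intro t y y' hy hyy h1 h2
    refine JoinedIn.of_segment_subset ?_
    rintro _ ⟨a, b, ha, hb, hab, rfl⟩
    have e : a • (t, y) + b • (t, y') = (t, a * y + b * y') := by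
      ext
      · simp only [Prod.fst_add, Prod.smul_fst, smul_eq_mul]
        rw [← add_mul, hab, one_mul]
      · simp
    rw [e]
    refine ⟨hy.1, ?_⟩
    have h3 := hy.2
    simp only [profile, le_min_iff] at h3 ⊢
    have hb' : b = 1 - a := by linarith
    have h4 : y ^ 2 ≤ (a * y + b * y') ^ 2 := by
      have : (a * y + b * y') ^ 2 - y ^ 2 =
        b ^ 2 * (y' ^ 2 - y ^ 2) + 2 * a * b * (y * y') + (a ^ 2 + b ^ 2 - 1) * y ^ 2 := by ring
      have h5 : (a ^ 2 + b ^ 2 - 1) = -2 * a * b := by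
        rw [hb']
        ring
      have h6 : y ^ 2 ≤ y * y' := by
        have h7 := sq_le_sq.1 hyy
        have h8 : |y| * |y| ≤ |y| * |y'| := mul_le_mul_of_nonneg_left h7 (abs_nonneg _)
        rwa [abs_mul_abs_self, ← abs_mul, abs_of_nonneg h1, ← sq] at h8
      rw [h5] at this
      have h9 : 0 ≤ a * b * (y * y' - y ^ 2) :=
        mul_nonneg (mul_nonneg ha hb) (by linarith)
      have h10 : 0 ≤ b ^ 2 * (y' ^ 2 - y ^ 2) := mul_nonneg (sq_nonneg _) (by linarith)
      linarith
    have h5 : (a * y + b * y') ^ 2 ≤ 1 := by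
      have h6 : (a * y + b * y') ^ 2 ≤ a * y ^ 2 + b * y' ^ 2 := by
        have : a * y ^ 2 + b * y' ^ 2 - (a * y + b * y') ^ 2 = a * b * (y - y') ^ 2 := by
          rw [hb']
          ring
        have := mul_nonneg (mul_nonneg ha hb) (sq_nonneg (y - y'))
        linarith
      have h7 := mul_le_mul_of_nonneg_left (hyy.trans h2) ha
      have h8 := mul_le_mul_of_nonneg_left h2 hb
      linarith
    constructor <;> linarith [h3.1, h3.2]
  have horiz : ∀ t y : ℝ, 0 ≤ t → t ≤ 2 * h → y ^ 2 = 1 → JoinedIn D (0, y) (t, y) := by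
    intro t y ht0 ht1 hy
    refine JoinedIn.of_segment_subset ?_
    rintro _ ⟨a, b, ha, hb, hab, rfl⟩
    have e : a • ((0 : ℝ), y) + b • (t, y) = (b * t, y) := by
      ext
      · simp
      · simp only [Prod.snd_add, Prod.smul_snd, smul_eq_mul]
        rw [← add_mul, hab, one_mul]
    rw [e]
    have hb1 : b ≤ 1 := by linarith
    refine ⟨⟨mul_nonneg hb ht0, (mul_le_of_le_one_left ht0 hb1).trans ht1⟩, ?_⟩
    have := Real.neg_one_le_cos (Real.pi * (b * t))
    simp only [profile, le_min_iff, hy]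
    constructor <;> linarith
  have h00 : ((0 : ℝ), (0 : ℝ)) ∈ D := by
    refine ⟨⟨le_rfl, h0⟩, ?_⟩
    rw [profile_of_abs_le (by norm_num)]
    norm_num
  refine IsPathConnected.isConnected ⟨(0, 0), h00, fun {p} hp => ?_⟩
  obtain ⟨t, y⟩ := p
  obtain ⟨s, hs, hs'⟩ : ∃ s : ℝ, s ^ 2 = 1 ∧ 0 ≤ y * s := by
    rcases le_total 0 y with hy | hy
    · exact ⟨1, by norm_num, by simpa using hy⟩
    · exact ⟨-1, by norm_num, by simpa using hy⟩
  have hy1 : y ^ 2 ≤ 1 := by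
    have := hp.2.trans (profile_le t y)
    linarith
  exact (vert 0 0 s h00 (by rw [hs]; norm_num) (by simp) hs.le).trans
    ((horiz t s hp.1.1 hp.1.2 hs).trans (vert t y s hp (hs ▸ hy1) hs' hs.le).symm)

/-- The double is the image of region × circle under scaling the circle by the square root of the
profile. The star is treated in the same way over a convex region in the plane. -/
theorem isConnected_refDoublePiece (h : ℕ) : IsConnected (refDoublePiece h) := by
  have h1 := ((isConnected_profile_nonneg h).prod isConnected_unitCircle).image
    (fun p : (ℝ × ℝ) × ℂ => ((p.1.1, p.1.2, (Real.sqrt (profile p.1.1 p.1.2) : ℂ) * p.2) :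
      ℝ × ℝ × ℂ)) (by
      have := continuous_profile
      fun_prop)
  convert h1 using 1
  ext ⟨t, y, w⟩
  constructor
  · rintro ⟨⟨ht, hw⟩, ht'⟩
    obtain ⟨v, hv, e⟩ := exists_eq_sqrt_mul hw
    refine ⟨((t, y), v), ⟨⟨⟨ht, ht'⟩, ?_⟩, hv⟩, ?_⟩
    · simp only at hw ⊢
      rw [← hw]
      positivity
    · simp only at e ⊢
      rw [e]
  · rintro ⟨⟨⟨t', y'⟩, v⟩, ⟨⟨ht, hp⟩, hv⟩, e⟩
    simp only [Prod.mk.injEq] at e ht hp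
    obtain ⟨rfl, rfl, rfl⟩ := e
    refine ⟨⟨ht.1, ?_⟩, ht.2⟩
    have hv' : ‖v‖ = 1 := hv
    simp only [norm_mul, hv', mul_one, Complex.norm_real, Real.norm_eq_abs, sq_abs]
    exact Real.sq_sqrt hp

/-! ### The star -/

variable {r : ℕ}

theorem norm_rootOfUnity (j : Fin r) : ‖rootOfUnity j‖ = 1 := by
  have : rootOfUnity j = Complex.exp (((2 * Real.pi * (j : ℕ) / r : ℝ) : ℂ) * Complex.I) := by
    unfold rootOfUnity
    congr 1
    push_cast
    ring
  rw [this, Complex.norm_exp_ofReal_mul_I]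

theorem isCompact_star (r : ℕ) : IsCompact (star r) := by
  refine Metric.isCompact_of_isClosed_isBounded ?_ ?_
  · have e : star r = {x | x.2.2 = 0} ∩ {x | ‖x.1‖ ^ 2 + ‖x.2.1‖ ^ 2 = (r : ℝ) ^ 2 + 1} ∩
        ⋂ j : Fin r, {x | (x.1 * (starRingEnd ℂ) (rootOfUnity j)).re ≤ r} := by
      ext x
      simp [star, and_assoc]
    rw [e]
    refine ((isClosed_eq (by fun_prop) continuous_const).inter
      (isClosed_eq (by fun_prop) continuous_const)).inter (isClosed_iInter fun j => ?_)
    exact isClosed_le (Complex.continuous_re.comp (by fun_prop)) continuous_const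
  · refine ((Metric.isBounded_closedBall (x := (0 : ℂ)) (r := r + 1)).prod
      ((Metric.isBounded_closedBall (x := (0 : ℂ)) (r := r + 1)).prod
        (Bornology.isBounded_singleton (x := (0 : Fin r → ℝ))))).subset ?_
    rintro x ⟨h0, h1, -⟩
    have hr : (0 : ℝ) ≤ r := r.cast_nonneg
    refine ⟨?_, ?_, h0⟩
    · rw [mem_closedBall_zero_iff]
      refine abs_le_of_sq_le_sq' ?_ (by positivity) |>.2
      nlinarith [sq_nonneg ‖x.2.1‖]
    · rw [mem_closedBall_zero_iff]
      refine abs_le_of_sq_le_sq' ?_ (by positivity) |>.2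
      nlinarith [sq_nonneg ‖x.1‖]

theorem isConnected_star (r : ℕ) : IsConnected (star r) := by
  have hr : (0 : ℝ) ≤ r := r.cast_nonneg
  have hconv : Convex ℝ (Metric.closedBall (0 : ℂ) (Real.sqrt (r ^ 2 + 1)) ∩
      ⋂ j : Fin r, {a : ℂ | (a * (starRingEnd ℂ) (rootOfUnity j)).re ≤ r}) := by
    refine (convex_closedBall _ _).inter (convex_iInter fun j => ?_)
    exact convex_halfSpace_le ⟨fun a b => by simp [add_mul], fun a b => by simp; ring⟩ _
  have hK : IsConnected (Metric.closedBall (0 : ℂ) (Real.sqrt (r ^ 2 + 1)) ∩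
      ⋂ j : Fin r, {a : ℂ | (a * (starRingEnd ℂ) (rootOfUnity j)).re ≤ r}) :=
    ⟨⟨0, by simp, by simp⟩, hconv.isPreconnected⟩
  have h1 := (hK.prod isConnected_unitCircle).image
    (fun p : ℂ × ℂ => ((p.1, (Real.sqrt (r ^ 2 + 1 - ‖p.1‖ ^ 2) : ℂ) * p.2, 0) :
      ℂ × ℂ × (Fin r → ℝ))) (by fun_prop)
  convert h1 using 1
  ext ⟨a, b, s⟩
  constructor
  · rintro ⟨h0, h2, h3⟩
    simp only at h0 h2 h3
    obtain ⟨v, hv, e⟩ := exists_eq_sqrt_mul (w := b) (a := (r : ℝ) ^ 2 + 1 - ‖a‖ ^ 2) (by linarith)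
    refine ⟨(a, v), ⟨⟨?_, Set.mem_iInter.2 h3⟩, hv⟩, ?_⟩
    · rw [mem_closedBall_zero_iff]
      exact Real.le_sqrt_of_sq_le (by nlinarith [sq_nonneg ‖b‖])
    · simp only
      rw [← e, h0]
  · rintro ⟨⟨a', v⟩, ⟨⟨ha, ha'⟩, hv⟩, e⟩
    simp only [Prod.mk.injEq] at e ha ha'
    obtain ⟨rfl, rfl, rfl⟩ := e
    refine ⟨rfl, ?_, fun j => Set.mem_iInter.1 ha' j⟩
    have hv' : ‖v‖ = 1 := hv
    rw [mem_closedBall_zero_iff] at ha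
    have h5 : ‖a'‖ ^ 2 ≤ (r : ℝ) ^ 2 + 1 := by
      have := pow_le_pow_left₀ (norm_nonneg _) ha 2
      rwa [Real.sq_sqrt (by positivity)] at this
    simp only [norm_mul, hv', mul_one, Complex.norm_real, Real.norm_eq_abs, sq_abs]
    rw [Real.sq_sqrt (by linarith)]
    ring

end Houghton

namespace Houghton

variable {r : ℕ}

/-! ### The standard decomposition of the doubled handlebody -/

/-- The point `q` of the `j`-th ray of the doubled handlebody. -/
noncomputable def handleRay (j : Fin r) (q : ℝ × ℝ × ℂ) (hq : q ∈ rayDouble) : DoubledHandlebody r :=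
  ⟨rayPoint j q, Or.inr ⟨j, q, hq, rfl⟩⟩

theorem continuous_rayPoint (j : Fin r) : Continuous (rayPoint j) := by
  unfold rayPoint
  refine Continuous.prodMk (by fun_prop) (Continuous.prodMk (by fun_prop) ?_)
  exact (continuous_single j).comp continuous_fst

theorem rayPoint_injective (j : Fin r) : Function.Injective (rayPoint j) := by
  rintro ⟨t, y, w⟩ ⟨t', y', w'⟩ e
  simp only [rayPoint, Prod.mk.injEq] at e
  obtain ⟨e1, e2, e3⟩ := e
  have hω : rootOfUnity j ≠ 0 := norm_ne_zero_iff.1 (by rw [norm_rootOfUnity]; norm_num)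
  have e4 := mul_left_cancel₀ hω e1
  have e5 := congrArg Complex.im e4
  simp at e5
  have e6 := Pi.single_injective j e3
  rw [e5, e2, e6]

@[simp] theorem height_rayPoint (j : Fin r) (q : ℝ × ℝ × ℂ) : (rayPoint j q).2.2 j = q.1 := by
  simp [rayPoint]

theorem height_rayPoint_of_ne {j k : Fin r} (hk : k ≠ j) (q : ℝ × ℝ × ℂ) :
    (rayPoint j q).2.2 k = 0 := by
  simp [rayPoint, Pi.single_eq_of_ne hk]

theorem continuous_height (j : Fin r) : Continuous fun x : DoubledHandlebody r => x.1.2.2 j :=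
  (continuous_apply j).comp ((continuous_snd.comp continuous_snd).comp continuous_subtype_val)

theorem exists_handleRay_of_height_pos {x : DoubledHandlebody r} {j : Fin r}
    (hx : 0 < x.1.2.2 j) : ∃ q hq, x = handleRay j q hq := by
  obtain ⟨x, hx' | ⟨k, q, hq, rfl⟩⟩ := x
  · exfalso
    have := hx'.1
    simp only [this, Pi.zero_apply, lt_self_iff_false] at hx
  · by_cases hk : j = k
    · subst hk
      exact ⟨q, hq, rfl⟩
    · simp only [height_rayPoint_of_ne hk, lt_self_iff_false] at hx

theorem height_eq_zero {x : DoubledHandlebody r} {j k : Fin r}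
    (hx : 0 < x.1.2.2 j) (hk : k ≠ j) : x.1.2.2 k = 0 := by
  obtain ⟨q, hq, rfl⟩ := exists_handleRay_of_height_pos hx
  exact height_rayPoint_of_ne hk q

/-- The part of the doubled handlebody with `L j` loops on the `j`-th ray. -/
def truncDouble (L : Fin r → ℕ) : Set (DoubledHandlebody r) :=
  {x | ∀ j, x.1.2.2 j ≤ 2 * (L j : ℝ)}

theorem handleRay_mem_truncDouble {L : Fin r → ℕ} {j : Fin r} {q : ℝ × ℝ × ℂ} {hq} :
    handleRay j q hq ∈ truncDouble L ↔ q.1 ≤ 2 * (L j : ℝ) := by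
  constructor
  · intro h
    simpa [handleRay] using h j
  · intro h k
    by_cases hk : k = j
    · subst hk
      simpa [handleRay] using h
    · change (rayPoint j q).2.2 k ≤ _
      rw [height_rayPoint_of_ne hk]
      positivity

theorem image_val_truncDouble (L : Fin r → ℕ) : Subtype.val '' truncDouble L =
    star r ∪ ⋃ j, rayPoint j '' refDoublePiece (L j) := by
  ext x
  constructor
  · rintro ⟨⟨x, hx⟩, hL, rfl⟩
    rcases hx with hx | ⟨j, q, hq, rfl⟩
    · exact Or.inl hx
    · exact Or.inr (Set.mem_iUnion.2
        ⟨j, q, ⟨hq, (handleRay_mem_truncDouble (hq := hq)).1 hL⟩, rfl⟩)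
  · rintro (hx | hx)
    · refine ⟨⟨x, Or.inl hx⟩, fun j => ?_, rfl⟩
      have := hx.1
      simp only [this, Pi.zero_apply]
      positivity
    · obtain ⟨j, q, hq, rfl⟩ := Set.mem_iUnion.1 hx
      exact ⟨handleRay j q hq.1, handleRay_mem_truncDouble.2 hq.2, rfl⟩

theorem isCompact_truncDouble (L : Fin r → ℕ) : IsCompact (truncDouble L) := by
  rw [Topology.IsInducing.subtypeVal.isCompact_iff, image_val_truncDouble]
  exact (isCompact_star r).union
    (isCompact_iUnion fun j => (isCompact_refDoublePiece _).image (continuous_rayPoint j))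

theorem isConnected_truncDouble [NeZero r] (L : Fin r → ℕ) : IsConnected (truncDouble L) := by
  have h1 : IsConnected (star r ∪ ⋃ j, rayPoint j '' refDoublePiece (L j)) := by
    obtain ⟨x, hx⟩ := (isConnected_star r).nonempty
    refine ⟨⟨x, Or.inl hx⟩, ?_⟩
    rw [Set.union_iUnion]
    refine isPreconnected_iUnion ⟨x, Set.mem_iInter.2 fun j => Or.inl hx⟩ fun j => ?_
    have h0 : ((0, 0, 1) : ℝ × ℝ × ℂ) ∈ rayDouble := ⟨le_rfl, by
      rw [profile_of_abs_le (by norm_num)]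
      norm_num⟩
    refine ((isConnected_star r).isPreconnected).union (rayPoint j (0, 0, 1)) ⟨?_, ?_, fun k => ?_⟩
      ⟨_, ⟨h0, by simp⟩, rfl⟩
      ((isConnected_refDoublePiece _).isPreconnected.image _ (continuous_rayPoint j).continuousOn)
    · simp [rayPoint]
    · simp [rayPoint, norm_rootOfUnity]
    · refine (Complex.re_le_norm _).trans ?_
      simp [rayPoint, norm_rootOfUnity]
  rw [← image_val_truncDouble] at h1
  exact ⟨Set.image_nonempty.1 h1.1, (Topology.IsInducing.subtypeVal.isPreconnected_image).1 h1.2⟩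

/-- The level at which the `i`-th standard piece on the `j`-th ray begins. -/
def stdLevel (g h : ℕ) (p : ℕ × Fin r) : ℕ := refCoreLoops g p.2 + h * p.1

theorem stdLevel_succ (g h i : ℕ) (j : Fin r) :
    stdLevel g h (i + 1, j) = stdLevel g h (i, j) + h := by
  simp [stdLevel]
  ring

theorem stdLevel_mono (g h : ℕ) (j : Fin r) {i i' : ℕ} (hi : i ≤ i') :
    (stdLevel g h (i, j) : ℝ) ≤ stdLevel g h (i', j) := by
  have : stdLevel g h (i, j) ≤ stdLevel g h (i', j) := by
    unfold stdLevel
    simp only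
    gcongr
  exact_mod_cast this

theorem stdLevel_strictMono (g : ℕ) {h : ℕ} (hh : 1 ≤ h) (j : Fin r) {i i' : ℕ} (hi : i < i') :
    stdLevel g h (i, j) < stdLevel g h (i', j) := by
  unfold stdLevel
  simp only
  have : h * i < h * i' := Nat.mul_lt_mul_of_pos_left hi hh
  omega

theorem shift_mem_rayDouble {q : ℝ × ℝ × ℂ} (hq : q ∈ rayDouble) (L : ℕ) :
    (q.1 + 2 * (L : ℝ), q.2) ∈ rayDouble := by
  have h0 := hq.1
  have := add_mem_rayDouble hq (n := L) (by push_cast; positivity)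
  simpa using this

/-- The standard embeddings of the reference piece. -/
noncomputable def stdEmb (g h : ℕ) (p : ℕ × Fin r) (y : refDoublePiece h) : DoubledHandlebody r :=
  handleRay p.2 (y.1.1 + 2 * (stdLevel g h p : ℝ), y.1.2) (shift_mem_rayDouble y.2.1 _)

theorem continuous_stdEmb (g h : ℕ) (p : ℕ × Fin r) : Continuous (stdEmb g h p) :=
  Continuous.subtype_mk ((continuous_rayPoint _).comp (by fun_prop)) _

theorem stdEmb_injective (g h : ℕ) (p : ℕ × Fin r) : Function.Injective (stdEmb g h p) := by
  intro x y e
  have e1 := rayPoint_injective _ (congrArg Subtype.val e)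
  simp only [Prod.mk.injEq, add_left_inj] at e1
  exact Subtype.ext (Prod.ext e1.1 e1.2)

/-- The standard pieces. -/
def stdPiece (g h : ℕ) (p : ℕ × Fin r) : Set (DoubledHandlebody r) := Set.range (stdEmb g h p)

theorem mem_stdPiece {g h : ℕ} {p : ℕ × Fin r} {q : ℝ × ℝ × ℂ} {hq}
    (h1 : 2 * (stdLevel g h p : ℝ) ≤ q.1) (h2 : q.1 ≤ 2 * (stdLevel g h p + h : ℝ)) :
    ∃ y, stdEmb g h p y = handleRay p.2 q hq := by
  refine ⟨⟨(q.1 - 2 * (stdLevel g h p : ℝ), q.2), ?_, ?_⟩, ?_⟩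
  · have := add_mem_rayDouble hq (n := -(stdLevel g h p : ℤ)) (by push_cast; linarith)
    convert this using 2
    push_cast
    ring
  · simp only
    linarith
  · refine Subtype.ext ?_
    simp [stdEmb, handleRay]

theorem exists_mem_stdPiece {g h : ℕ} (hh : 1 ≤ h) {j : Fin r} {q : ℝ × ℝ × ℂ} {hq}
    {m : ℕ} (hm : 2 * (stdLevel g h (m, j) : ℝ) < q.1) :
    ∃ i y, m ≤ i ∧ 2 * (stdLevel g h (i, j) : ℝ) < q.1 ∧ stdEmb g h (i, j) y = handleRay j q hq := by
  have hpos : (0 : ℝ) < 2 * h := by positivity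
  set s := (q.1 - 2 * (stdLevel g h (m, j) : ℝ)) / (2 * h) with hs
  have hs0 : 0 < s := div_pos (by linarith) hpos
  have hqs : q.1 = s * (2 * h) + 2 * (stdLevel g h (m, j) : ℝ) := by
    rw [hs]
    field_simp
    ring
  -- The ceiling instead of the floor assigns points of a boundary sphere to the inner piece. This
  -- gives the strict inequality by which `stdSuited_eq` bounds the index of the piece.
  obtain ⟨l, hl⟩ : ∃ l, ⌈s⌉₊ = l + 1 := ⟨⌈s⌉₊ - 1, by have := Nat.ceil_pos.2 hs0; omega⟩
  have h1 : (l : ℝ) < s := by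
    have := Nat.lt_ceil (n := l) (a := s)
    rw [← this, hl]
    omega
  have h2 : s ≤ l + 1 := by
    have := Nat.le_ceil s
    rw [hl] at this
    exact_mod_cast this
  have hlev : (stdLevel g h (m + l, j) : ℝ) = stdLevel g h (m, j) + h * l := by
    unfold stdLevel
    push_cast
    ring
  have h3 := mul_lt_mul_of_pos_right h1 hpos
  have h4 := mul_le_mul_of_nonneg_right h2 hpos.le
  have h5 : 2 * (stdLevel g h (m + l, j) : ℝ) < q.1 := by
    rw [hlev, hqs]
    linarith
  obtain ⟨y, hy⟩ := mem_stdPiece (p := (m + l, j)) (hq := hq) h5.le (by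
    rw [hlev, hqs]
    linarith)
  exact ⟨m + l, y, Nat.le_add_right _ _, h5, hy⟩

/-- The union of the standard core and the first `b j` standard pieces of the `j`-th ray. -/
def stdSuited (g h : ℕ) (b : Fin r → ℕ) : Set (DoubledHandlebody r) :=
  truncDouble fun j => stdLevel g h (b j, j)

theorem stdSuited_eq {g h : ℕ} (hh : 1 ≤ h) (b : Fin r → ℕ) : stdSuited g h b =
    refDoubleCore g r ∪
      ⋃ p ∈ Finset.univ.biUnion fun j : Fin r => (Finset.range (b j)).image fun i => (i, j),
        stdPiece g h p := by
  have hlev0 : ∀ j : Fin r, stdLevel g h (0, j) = refCoreLoops g j := fun j => by simp [stdLevel]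
  ext x
  constructor
  · intro hx
    by_cases hc : x ∈ refDoubleCore g r
    · exact Or.inl hc
    · simp only [refDoubleCore, Set.mem_ofPred_eq, not_forall, not_le] at hc
      obtain ⟨j, hj⟩ := hc
      obtain ⟨q, hq, rfl⟩ := exists_handleRay_of_height_pos (lt_of_le_of_lt (by positivity) hj)
      simp only [handleRay, height_rayPoint] at hj
      obtain ⟨i, y, -, hi, hy⟩ := exists_mem_stdPiece (g := g) hh (q := q) (hq := hq) (j := j)
        (m := 0) (by rwa [hlev0])
      refine Or.inr (Set.mem_iUnion₂.2 ⟨(i, j), ?_, y, hy⟩)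
      simp only [Finset.mem_biUnion, Finset.mem_univ, Finset.mem_image, Finset.mem_range, true_and]
      refine ⟨j, i, ?_, rfl⟩
      by_contra! hb
      have h1 := stdLevel_mono g h j hb
      have h2 := handleRay_mem_truncDouble.1 hx
      linarith
  · rintro (hx | hx)
    · intro j
      refine (hx j).trans ?_
      have := stdLevel_mono g h j (Nat.zero_le (b j))
      rw [hlev0] at this
      linarith
    · obtain ⟨p, hp, y, rfl⟩ := Set.mem_iUnion₂.1 hx
      simp only [Finset.mem_biUnion, Finset.mem_univ, Finset.mem_image, Finset.mem_range,
        true_and] at hp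
      obtain ⟨j, i, hi, rfl⟩ := hp
      refine handleRay_mem_truncDouble.2 ?_
      have h1 := stdLevel_mono g h j (Nat.succ_le_of_lt hi)
      rw [Nat.succ_eq_add_one, stdLevel_succ] at h1
      push_cast at h1
      have h2 := y.2.2
      simp only
      linarith

theorem stdPiece_subset_closure_compl {g h : ℕ} {b : Fin r → ℕ} {p : ℕ × Fin r}
    (hp : b p.2 ≤ p.1) : stdPiece g h p ⊆ closure (stdSuited g h b)ᶜ := by
  rintro _ ⟨y, rfl⟩
  have h1 := stdLevel_mono g h p.2 hp
  have hy0 := y.2.1.1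
  rcases hy0.eq_or_lt with h0 | h0
  -- The first sphere of the piece may lie in the suited part. It is approached from farther out
  -- along the product collar |t| ≤ 1/2.
  · have hq : ∀ s : ℝ, (min |s| (1 / 2), y.1.2) ∈ rayDouble := by
      intro s
      refine ⟨le_min (abs_nonneg s) (by norm_num), ?_⟩
      have h3 := y.2.1.2
      rw [← h0, profile_of_abs_le (by norm_num)] at h3
      rw [profile_of_abs_le, h3]
      rw [abs_of_nonneg (le_min (abs_nonneg s) (by norm_num))]
      exact min_le_right _ _
    let γ : ℝ → DoubledHandlebody r := fun s =>
      handleRay p.2 (min |s| (1 / 2) + 2 * (stdLevel g h p : ℝ), y.1.2)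
        (shift_mem_rayDouble (hq s) _)
    have hγ : Continuous γ := Continuous.subtype_mk ((continuous_rayPoint _).comp (by fun_prop)) _
    have h0 : γ 0 = stdEmb g h p y := by
      refine Subtype.ext ?_
      simp [γ, stdEmb, handleRay, ← h0]
    have ht : Filter.Tendsto γ (𝓝[>] 0) (𝓝 (stdEmb g h p y)) :=
      h0 ▸ hγ.continuousAt.continuousWithinAt
    refine mem_closure_of_tendsto ht ?_
    filter_upwards [self_mem_nhdsWithin] with s hs hs'
    have h4 := handleRay_mem_truncDouble.1 hs'
    have h5 : 0 < min |s| (1 / 2) := lt_min (abs_pos.2 (ne_of_gt hs)) (by norm_num)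
    simp only [Prod.mk.eta] at h4 h1
    linarith
  · refine subset_closure fun hs => ?_
    have h4 := handleRay_mem_truncDouble.1 hs
    simp only [Prod.mk.eta] at h4 h1
    linarith

theorem le_of_stdPiece_subset_closure_compl {g h : ℕ} (hh : 1 ≤ h) {b : Fin r → ℕ}
    {p : ℕ × Fin r} (hp : stdPiece g h p ⊆ closure (stdSuited g h b)ᶜ) : b p.2 ≤ p.1 := by
  by_contra! hlt
  obtain ⟨i, j⟩ := p
  have hh' : (1 : ℝ) ≤ h := by exact_mod_cast hh
  -- A point between the boundary spheres, on the edge y = 1, which no hole reaches.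
  let y : refDoublePiece h := ⟨(1, 1, 0), edge_mem_rayDouble zero_le_one, by simp only; linarith⟩
  have h1 := stdLevel_mono g h j (Nat.succ_le_of_lt hlt)
  rw [Nat.succ_eq_add_one, stdLevel_succ] at h1
  push_cast at h1
  have hU : IsOpen {x : DoubledHandlebody r | 0 < x.1.2.2 j ∧
      x.1.2.2 j < 2 * (stdLevel g h (b j, j) : ℝ)} :=
    (isOpen_lt continuous_const (continuous_height _)).inter
      (isOpen_lt (continuous_height _) continuous_const)
  have hy : (stdEmb g h (i, j) y).1.2.2 j = 1 + 2 * (stdLevel g h (i, j) : ℝ) :=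
    height_rayPoint _ _
  obtain ⟨x, ⟨hx0, hx1⟩, hx⟩ := mem_closure_iff.1 (hp ⟨y, rfl⟩) _ hU
    ⟨by rw [hy]; positivity, by rw [hy]; linarith⟩
  refine hx fun k => ?_
  by_cases hk : k = j
  · subst hk
    exact hx1.le
  · rw [height_eq_zero hx0 hk]
    positivity

theorem isCompact_refDoubleCore (g r : ℕ) : IsCompact (refDoubleCore g r) :=
  isCompact_truncDouble _

instance (g r : ℕ) : CompactSpace (refDoubleCore g r) :=
  isCompact_iff_compactSpace.1 (isCompact_refDoubleCore g r)

/-- The models of the core and of the pieces. -/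
def DoublePart (g h r : ℕ) : Option (ℕ × Fin r) → Type
  | none => refDoubleCore g r
  | some _ => refDoublePiece h

instance (g h r : ℕ) (o) : TopologicalSpace (DoublePart g h r o) :=
  match o with
  | none => inferInstanceAs (TopologicalSpace (refDoubleCore g r))
  | some _ => inferInstanceAs (TopologicalSpace (refDoublePiece h))

instance (g h r : ℕ) (o) : CompactSpace (DoublePart g h r o) :=
  match o with
  | none => inferInstanceAs (CompactSpace (refDoubleCore g r))
  | some _ => inferInstanceAs (CompactSpace (refDoublePiece h))

/-- The standard embeddings of the models. -/
noncomputable def stdPart (g h : ℕ) : ∀ o, DoublePart g h r o → DoubledHandlebody r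
  | none => Subtype.val
  | some p => stdEmb g h p

theorem locallyFinite_stdPart (g : ℕ) {h : ℕ} (hh : 1 ≤ h) :
    LocallyFinite fun o => Set.range (stdPart (r := r) g h o) := by
  intro x
  have hU : IsOpen {y : DoubledHandlebody r | ∀ j, y.1.2.2 j < x.1.2.2 j + 1} := by
    have : {y : DoubledHandlebody r | ∀ j, y.1.2.2 j < x.1.2.2 j + 1} =
        ⋂ j, {y : DoubledHandlebody r | y.1.2.2 j < x.1.2.2 j + 1} := by
      ext y
      simp
    rw [this]
    exact isOpen_iInter_of_finite fun j => isOpen_lt (continuous_height j) continuous_const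
  refine ⟨_, hU.mem_nhds (by simp), ?_⟩
  have hfin : (Set.insert none (some '' {p : ℕ × Fin r | p.1 < ⌈x.1.2.2 p.2 + 1⌉₊})).Finite := by
    refine Set.Finite.insert _ (Set.Finite.image _ ?_)
    refine (Set.finite_iUnion fun j : Fin r =>
      ((Set.finite_lt_nat ⌈x.1.2.2 j + 1⌉₊).image fun i => (i, j))).subset ?_
    rintro ⟨i, j⟩ hi
    exact Set.mem_iUnion.2 ⟨j, i, hi, rfl⟩
  refine hfin.subset ?_
  rintro (_ | ⟨i, j⟩) ⟨_, ⟨y, rfl⟩, hy'⟩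
  · exact Or.inl rfl
  · refine Or.inr ⟨_, ?_, rfl⟩
    have h1 : (stdEmb g h (i, j) y).1.2.2 j = y.1.1 + 2 * (stdLevel g h (i, j) : ℝ) :=
      height_rayPoint _ _
    have h2 : (stdEmb g h (i, j) y).1.2.2 j < _ := hy' j
    have hy0 := y.2.1.1
    have h3 : (i : ℝ) ≤ (stdLevel g h (i, j) : ℝ) := by
      have : i ≤ stdLevel g h (i, j) := (Nat.le_mul_of_pos_left i hh).trans (Nat.le_add_left _ _)
      exact_mod_cast this
    rw [Set.mem_ofPred_eq, Nat.lt_ceil]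
    have : (0 : ℝ) ≤ i := i.cast_nonneg
    simp only
    linarith

theorem iUnion_stdPart (g : ℕ) {h : ℕ} (hh : 1 ≤ h) :
    ⋃ o, Set.range (stdPart (r := r) g h o) = Set.univ := by
  refine Set.eq_univ_of_forall fun x => Set.mem_iUnion.2 ?_
  by_cases hc : x ∈ refDoubleCore g r
  · exact ⟨none, ⟨x, hc⟩, rfl⟩
  · simp only [refDoubleCore, Set.mem_ofPred_eq, not_forall, not_le] at hc
    obtain ⟨j, hj⟩ := hc
    obtain ⟨q, hq, rfl⟩ := exists_handleRay_of_height_pos (lt_of_le_of_lt (by positivity) hj)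
    simp only [handleRay, height_rayPoint] at hj
    obtain ⟨i, y, -, hi, hy⟩ := exists_mem_stdPiece (g := g) hh (q := q) (hq := hq) (j := j)
      (m := 0) (by simpa [stdLevel] using hj)
    exact ⟨some (i, j), y, hy⟩

theorem continuous_stdPart (g h : ℕ) (o : Option (ℕ × Fin r)) : Continuous (stdPart g h o) :=
  match o with
  | none => continuous_subtype_val
  | some p => continuous_stdEmb g h p

theorem stdEmb_eq_core_iff (g : ℕ) {h : ℕ} (hh : 1 ≤ h) (i : ℕ) (j : Fin r)
    (x : refDoubleCore g r) (y : refDoublePiece h) : x.1 = stdEmb g h (i, j) y ↔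
      i = 0 ∧ ∃ u, x = refDoubleCoreBoundary g j u ∧ y = refDoublePieceMinus h u := by
  constructor
  · intro e
    have h1 := x.2 j
    rw [e] at h1
    have h2 : (stdEmb g h (i, j) y).1.2.2 j = y.1.1 + 2 * (stdLevel g h (i, j) : ℝ) :=
      height_rayPoint _ _
    rw [h2] at h1
    have hy0 := y.2.1.1
    have hi : i = 0 := by
      by_contra hi
      have h3 := stdLevel_strictMono g hh j (Nat.pos_of_ne_zero hi)
      have h4 : ((stdLevel g h (0, j) : ℕ) : ℝ) < stdLevel g h (i, j) := by exact_mod_cast h3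
      simp only [stdLevel, mul_zero, add_zero] at h4 h1
      linarith
    subst hi
    have hlev : stdLevel g h (0, j) = refCoreLoops g j := by simp [stdLevel]
    rw [hlev] at h1
    have hy : y.1.1 = 0 := by linarith
    have hu := sphere_of_mem_rayDouble y.2.1 (k := 0) (by simpa using hy)
    refine ⟨rfl, ⟨y.1.2, hu⟩, ?_, ?_⟩
    · refine Subtype.ext (e.trans (Subtype.ext ?_))
      simp [stdEmb, handleRay, refDoubleCoreBoundary, hy, hlev]
    · exact Subtype.ext (Prod.ext hy rfl)
  · rintro ⟨rfl, u, rfl, rfl⟩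
    refine Subtype.ext ?_
    simp [stdEmb, handleRay, refDoubleCoreBoundary, refDoublePieceMinus, stdLevel]

theorem eq_of_stdEmb_eq_of_lt (g : ℕ) {h : ℕ} (hh : 1 ≤ h) {i i' : ℕ} (hi : i < i') (j : Fin r)
    {x y : refDoublePiece h} (e : stdEmb g h (i, j) x = stdEmb g h (i', j) y) :
    i' = i + 1 ∧ ∃ u, x = refDoublePiecePlus h u ∧ y = refDoublePieceMinus h u := by
  have e1 := rayPoint_injective _ (congrArg Subtype.val e)
  simp only [Prod.mk.injEq] at e1
  obtain ⟨e1, e2⟩ := e1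
  have h1 := stdLevel_mono g h j (Nat.succ_le_of_lt hi)
  rw [Nat.succ_eq_add_one, stdLevel_succ] at h1
  push_cast at h1
  have hx := x.2.2
  have hy := y.2.1.1
  have hi' : i' = i + 1 := by
    by_contra hne
    have h3 := stdLevel_strictMono g hh j (show i + 1 < i' by omega)
    have h4 : ((stdLevel g h (i + 1, j) : ℕ) : ℝ) < stdLevel g h (i', j) := by exact_mod_cast h3
    rw [stdLevel_succ] at h4
    push_cast at h4
    linarith
  have hx' : x.1.1 = 2 * h := by linarith
  have hy' : y.1.1 = 0 := by linarith
  refine ⟨hi', ⟨x.1.2, sphere_of_mem_rayDouble x.2.1 hx'⟩, ?_, ?_⟩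
  · exact Subtype.ext (Prod.ext hx' rfl)
  · exact Subtype.ext (Prod.ext hy' e2.symm)

theorem stdEmb_plus (g h i : ℕ) (j : Fin r) (u : UnitSphere) :
    stdEmb g h (i, j) (refDoublePiecePlus h u) = stdEmb g h (i + 1, j) (refDoublePieceMinus h u) := by
  refine Subtype.ext ?_
  simp only [stdEmb, handleRay, refDoublePiecePlus, refDoublePieceMinus, stdLevel_succ]
  congr 2
  push_cast
  ring

theorem stdEmb_eq_iff (g : ℕ) {h : ℕ} (hh : 1 ≤ h) {i i' : ℕ} (hi : i ≠ i') (j : Fin r)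
    (x y : refDoublePiece h) : stdEmb g h (i, j) x = stdEmb g h (i', j) y ↔
      ((i' = i + 1 ∧ ∃ u, x = refDoublePiecePlus h u ∧ y = refDoublePieceMinus h u) ∨
          (i = i' + 1 ∧ ∃ u, x = refDoublePieceMinus h u ∧ y = refDoublePiecePlus h u)) := by
  constructor
  · intro e
    rcases lt_or_gt_of_ne hi with hi | hi
    · exact Or.inl (eq_of_stdEmb_eq_of_lt g hh hi j e)
    · obtain ⟨h1, u, h2, h3⟩ := eq_of_stdEmb_eq_of_lt g hh hi j e.symm
      exact Or.inr ⟨h1, u, h3, h2⟩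
  · rintro (⟨rfl, u, rfl, rfl⟩ | ⟨rfl, u, rfl, rfl⟩)
    · exact stdEmb_plus g h i j u
    · exact (stdEmb_plus g h i' j u).symm

theorem height_of_stdEmb_eq_of_ne {g h i i' : ℕ} {j j' : Fin r} (hj : j ≠ j')
    {x y : refDoublePiece h} (e : stdEmb g h (i, j) x = stdEmb g h (i', j') y) :
    ∀ k, (stdEmb g h (i, j) x).1.2.2 k = 0 := by
  intro k
  by_cases hk : k = j
  · subst hk
    rw [e]
    exact height_rayPoint_of_ne hj _
  · exact height_rayPoint_of_ne hk _

/-! ### The standardizing homeomorphism -/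

namespace DoubledRigidStructure

variable {g h r : ℕ} (R : DoubledRigidStructure g h r)

/-- The embeddings of the models given by a rigid structure. -/
def partMap : ∀ o, DoublePart g h r o → DoubledHandlebody r
  | none => R.coreMap
  | some p => R.pieceMap p

theorem continuous_partMap (o : Option (ℕ × Fin r)) : Continuous (R.partMap o) :=
  match o with
  | none => R.coreMap_isEmbedding.continuous
  | some p => (R.pieceMap_isEmbedding p).continuous

theorem locallyFinite_partMap : LocallyFinite fun o => Set.range (R.partMap o) := by
  intro x
  obtain ⟨U, hU, hf⟩ := R.locallyFinite x
  refine ⟨U, hU, ((hf.image some).insert none).subset ?_⟩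
  rintro (_ | p) hp
  · exact Or.inl rfl
  · exact Or.inr ⟨p, hp, rfl⟩

theorem iUnion_partMap : ⋃ o, Set.range (R.partMap o) = Set.univ := by
  refine Set.eq_univ_of_forall fun x => Set.mem_iUnion.2 ?_
  rcases (Set.ext_iff.1 R.cover x).2 trivial with hx | hx
  · exact ⟨none, hx⟩
  · obtain ⟨p, hp⟩ := Set.mem_iUnion.1 hx
    exact ⟨some p, hp⟩

theorem stdPart_eq_iff (hh : 1 ≤ h) (o o' : Option (ℕ × Fin r)) (x : DoublePart g h r o)
    (y : DoublePart g h r o') :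
    stdPart g h o x = stdPart g h o' y ↔ R.partMap o x = R.partMap o' y := by
  have hcp : ∀ (p : ℕ × Fin r) (x : refDoubleCore g r) (y : refDoublePiece h),
      x.1 = stdEmb g h p y ↔ R.coreMap x = R.pieceMap p y := by
    rintro ⟨i, j⟩ x y
    rw [stdEmb_eq_core_iff g hh, R.core_inter_piece]
  have hpp : ∀ (p p' : ℕ × Fin r) (x y : refDoublePiece h),
      stdEmb g h p x = stdEmb g h p' y ↔ R.pieceMap p x = R.pieceMap p' y := by
    rintro ⟨i, j⟩ ⟨i', j'⟩ x y
    by_cases hp : (i, j) = (i', j')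
    · obtain ⟨rfl, rfl⟩ := Prod.mk.inj hp
      exact (stdEmb_injective g h _).eq_iff.trans (R.pieceMap_isEmbedding _).injective.eq_iff.symm
    rw [R.piece_inter_piece _ _ _ _ _ _ hp]
    by_cases hj : j = j'
    · subst hj
      rw [stdEmb_eq_iff g hh (fun hi => hp (by rw [hi]))]
      simp
    · refine ⟨fun e => ?_, fun e => absurd e.1 hj⟩
      -- Disjointness of standard pieces on different rays is inherited from `R`: a common point
      -- would have height 0, so it would lie in the standard core, and by `hcp` applied twice the
      -- corresponding pieces of `R` would meet.
      have h0 : stdEmb g h (i, j) x ∈ refDoubleCore g r := fun k => by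
        rw [height_of_stdEmb_eq_of_ne hj e k]
        positivity
      have e1 := (hcp (i, j) ⟨_, h0⟩ x).1 rfl
      have e2 := (hcp (i', j') ⟨_, h0⟩ y).1 e
      rw [e1, R.piece_inter_piece _ _ _ _ _ _ hp] at e2
      exact absurd e2.1 hj
  match o, o', x, y with
  | none, none, x, y =>
    exact Iff.trans Subtype.ext_iff.symm R.coreMap_isEmbedding.injective.eq_iff.symm
  | none, some p, x, y => exact hcp p x y
  | some p, none, x, y => exact eq_comm.trans ((hcp p y x).trans eq_comm)
  | some p, some p', x, y => exact hpp p p' x y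

/-- A rigid structure prescribes which points of the core and the pieces are identified, and the
standard decomposition realizes the same identifications. Hence the parametrizations glue to a
homeomorphism. -/
theorem exists_standardizer (hh : 1 ≤ h) : ∃ F : DoubledHandlebody r ≃ₜ DoubledHandlebody r,
    (∀ x : refDoubleCore g r, F x = R.coreMap x) ∧
      ∀ p y, F (stdEmb g h p y) = R.pieceMap p y := by
  obtain ⟨F, hF⟩ := exists_homeomorph_of_cover (DoublePart g h r) (continuous_stdPart g h)
    R.continuous_partMap (locallyFinite_stdPart g hh) R.locallyFinite_partMap
    (iUnion_stdPart g hh) R.iUnion_partMap (R.stdPart_eq_iff hh)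
  exact ⟨F, hF none, fun p => hF (some p)⟩

end DoubledRigidStructure

end Houghton

namespace Houghton

variable {r : ℕ}

/-! ### Homeomorphisms translating along the rays -/

/-- `f` maps the part of the `j`-th ray beyond level `m` to the `ρ j`-th ray, translating it by
`n j` loops. -/
def TranslatesHandles (f : DoubledHandlebody r → DoubledHandlebody r) (ρ : Fin r → Fin r)
    (n : Fin r → ℤ) (m : ℕ) : Prop :=
  ∀ j q (hq : q ∈ rayDouble), 2 * (m : ℝ) ≤ q.1 →
    (f (handleRay j q hq)).1 = rayPoint (ρ j) (q.1 + 2 * n j, q.2)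

/-- Isotopy classes of homeomorphisms that translate along the rays. -/
def IsHandlebodyTranslation (u : MapManifold (DoubledHandlebody r)) (ρ : Equiv.Perm (Fin r))
    (n : Fin r → ℤ) : Prop :=
  ∃ (f : DoubledHandlebody r ≃ₜ DoubledHandlebody r) (m : ℕ), u = QuotientGroup.mk f ∧
    TranslatesHandles f ρ n m

theorem isHandlebodyTranslation_one :
    IsHandlebodyTranslation (1 : MapManifold (DoubledHandlebody r)) 1 0 :=
  ⟨1, 0, rfl, fun j q hq _ => by simp [handleRay]⟩

theorem isHandlebodyTranslation_mul (u v : MapManifold (DoubledHandlebody r))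
    (ρ τ : Equiv.Perm (Fin r)) (n k : Fin r → ℤ) (hu : IsHandlebodyTranslation u ρ n)
    (hv : IsHandlebodyTranslation v τ k) :
    IsHandlebodyTranslation (u * v) (ρ * τ) fun j => k j + n (τ j) := by
  obtain ⟨f, m, rfl, h⟩ := hu
  obtain ⟨f', m', rfl, h'⟩ := hv
  refine ⟨f * f', m + m' + ∑ j, (k j).natAbs, rfl, fun j q hq hm => ?_⟩
  have h0 : (0 : ℝ) ≤ m := m.cast_nonneg
  have h0' : (0 : ℝ) ≤ m' := m'.cast_nonneg
  have hk : |(k j : ℝ)| ≤ ((∑ j, (k j).natAbs : ℕ) : ℝ) := by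
    have := Finset.single_le_sum (f := fun j => (k j).natAbs) (fun _ _ => Nat.zero_le _)
      (Finset.mem_univ j)
    rw [← Int.cast_abs, ← Nat.cast_natAbs]
    exact_mod_cast this
  rw [Nat.cast_add, Nat.cast_add] at hm
  have hk' := (abs_nonneg _).trans hk
  have hk'' := abs_le.1 hk
  have hq' : (q.1 + 2 * (k j : ℝ), q.2) ∈ rayDouble := add_mem_rayDouble hq (by linarith)
  have e : f' (handleRay j q hq) = handleRay (τ j) _ hq' := Subtype.ext (h' j q hq (by linarith))
  have h1 := h (τ j) _ hq' (by simp only; linarith)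
  rw [Homeomorph.mul_apply, e, h1]
  simp only [Equiv.Perm.mul_apply]
  congr 2
  push_cast
  ring

/-- The tails of the rays are translated onto tails. A point f x in a tail of the target is also the
image of the point translated back, so by injectivity x lies in a tail; thus the complements of the
tails correspond as well. No correction near the core is needed, in contrast to the graph. -/
theorem TranslatesHandles.image_truncDouble {f : DoubledHandlebody r ≃ₜ DoubledHandlebody r}
    {ρ : Equiv.Perm (Fin r)} {n : Fin r → ℤ} {m : ℕ} (hf : TranslatesHandles f ρ n m)
    {L L' : Fin r → ℕ} (hm : ∀ j, m ≤ L j) (hL : ∀ j, (L' (ρ j) : ℤ) = L j + n j) :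
    f '' truncDouble L = truncDouble L' := by
  have hm' : ∀ j, (m : ℝ) ≤ L j := fun j => by exact_mod_cast hm j
  have hL' : ∀ j, (L' (ρ j) : ℝ) = L j + n j := fun j => by exact_mod_cast hL j
  have key : ∀ x, f x ∈ truncDouble L' ↔ x ∈ truncDouble L := by
    intro x
    constructor
    · intro hx k
      by_contra! hk
      obtain ⟨q, hq, rfl⟩ := exists_handleRay_of_height_pos (lt_of_le_of_lt (by positivity) hk)
      simp only [handleRay, height_rayPoint] at hk
      have h1 := hx (ρ k)
      rw [hf k q hq (by linarith [hm' k]), height_rayPoint, hL'] at h1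
      simp only at h1
      linarith
    · intro hx k
      by_contra! hk
      obtain ⟨q, hq, e⟩ := exists_handleRay_of_height_pos (lt_of_le_of_lt (by positivity) hk)
      obtain ⟨j, rfl⟩ := ρ.surjective k
      rw [e] at hk
      simp only [handleRay, height_rayPoint] at hk
      rw [hL'] at hk
      have h0 : (0 : ℝ) ≤ L j := (L j).cast_nonneg
      have hq' : (q.1 + 2 * ((-n j : ℤ) : ℝ), q.2) ∈ rayDouble :=
        add_mem_rayDouble hq (by push_cast; linarith)
      have e' : f (handleRay j _ hq') = f x := by
        refine Subtype.ext ?_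
        rw [hf j _ hq' (by push_cast; linarith [hm' j]), e]
        simp [handleRay]
      rw [← f.injective e', handleRay_mem_truncDouble] at hx
      push_cast at hx
      linarith
  ext y
  constructor
  · rintro ⟨x, hx, rfl⟩
    exact (key x).2 hx
  · intro hy
    refine ⟨f.symm y, (key _).1 ?_, f.apply_symm_apply y⟩
    rwa [f.apply_symm_apply]

namespace DoubledRigidStructure

variable {g h r : ℕ} (R : DoubledRigidStructure g h r)

/-! ### Asymptotically rigid homeomorphisms are translations -/

theorem exists_bound_of_isSuited {Z : Set (DoubledHandlebody r)} (hZ : R.IsSuited Z) :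
    ∃ M, ∀ p : ℕ × Fin r, M ≤ p.1 → R.piece p ⊆ closure Zᶜ := by
  obtain ⟨-, T, rfl⟩ := hZ
  -- Pieces meet only if their indices differ by at most one, so two steps beyond `T` the piece is
  -- disjoint from Z.
  refine ⟨T.sup Prod.fst + 2, ?_⟩
  rintro ⟨i, j⟩ hi _ ⟨y, rfl⟩
  refine subset_closure ?_
  simp only at hi
  rintro (⟨x, hx⟩ | hx)
  · have := ((R.core_inter_piece _ _ _ _).1 hx).1
    omega
  · simp only [Set.mem_iUnion] at hx
    obtain ⟨⟨i', j'⟩, hq, x, hx⟩ := hx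
    have h0 : i' ≤ T.sup Prod.fst := Finset.le_sup (f := Prod.fst) hq
    have hne : (i', j') ≠ (i, j) := fun e => by
      have := congrArg Prod.fst e
      simp only at this
      omega
    rcases ((R.piece_inter_piece _ _ _ _ _ _ hne).1 hx).2 with h | h
    · have := h.1
      omega
    · have := h.1
      omega

theorem refDoublePiecePlus_ne_minus (hh : 1 ≤ h) (u v : UnitSphere) :
    refDoublePiecePlus h u ≠ refDoublePieceMinus h v := by
  intro e
  have h1 : (2 * h : ℝ) = 0 := congrArg (fun y : refDoublePiece h => y.1.1) e
  have h2 : (1 : ℝ) ≤ h := by exact_mod_cast hh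
  linarith

theorem eq_succ_of_pieceMap_plus_eq (hh : 1 ≤ h) {p q : ℕ × Fin r} {u : UnitSphere}
    (e : R.pieceMap p (refDoublePiecePlus h u) = R.pieceMap q (refDoublePieceMinus h u)) :
    q = (p.1 + 1, p.2) := by
  by_cases hpq : p = q
  · subst hpq
    exact absurd ((R.pieceMap_isEmbedding p).injective e) (refDoublePiecePlus_ne_minus hh u u)
  · obtain ⟨h1, ⟨h2, -⟩ | ⟨-, v, h3, -⟩⟩ := (R.piece_inter_piece _ _ _ _ _ _ hpq).1 e
    · exact Prod.ext h2 h1.symm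
    · exact absurd h3 (refDoublePiecePlus_ne_minus hh u v)

theorem pieceMap_plus (i : ℕ) (j : Fin r) (u : UnitSphere) :
    R.pieceMap (i, j) (refDoublePiecePlus h u) =
      R.pieceMap (i + 1, j) (refDoublePieceMinus h u) :=
  (R.piece_inter_piece i (i + 1) j j _ _ (by simp)).2 ⟨rfl, Or.inl ⟨rfl, u, rfl, rfl⟩⟩

/-- The sphere shared by two consecutive pieces is ∂₊ of one image and ∂₋ of the other, with the
same parameter, so the images are consecutive. -/
theorem exists_eventual_pieces (hh : 1 ≤ h) {f : DoubledHandlebody r ≃ₜ DoubledHandlebody r}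
    (hf : R.IsAsymptoticallyRigid f) :
    ∃ (M : ℕ) (ρ : Equiv.Perm (Fin r)) (b : Fin r → ℕ),
      ∀ i j y, f (R.pieceMap (M + i, j) y) = R.pieceMap (b j + i, ρ j) y := by
  obtain ⟨Z, hZ, -, hp⟩ := hf
  obtain ⟨M, hM⟩ := R.exists_bound_of_isSuited hZ
  choose q hq using fun p : {p : ℕ × Fin r // M ≤ p.1} => hp p.1 (hM p.1 p.2)
  have hq' : ∀ p (hp : M ≤ p.1) y, f (R.pieceMap p y) = R.pieceMap (q ⟨p, hp⟩) y :=
    fun p hp => (hq ⟨p, hp⟩).2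
  let u : UnitSphere := ⟨(1, 0), by simp [UnitSphere]⟩
  have hstep : ∀ i j (hi : M ≤ i), q ⟨(i + 1, j), by simp; omega⟩ =
      ((q ⟨(i, j), hi⟩).1 + 1, (q ⟨(i, j), hi⟩).2) := by
    intro i j hi
    apply R.eq_succ_of_pieceMap_plus_eq hh (u := u)
    rw [← hq', ← hq', R.pieceMap_plus]
  set ρ : Fin r → Fin r := fun j => (q ⟨(M, j), le_rfl⟩).2 with hρ
  set b : Fin r → ℕ := fun j => (q ⟨(M, j), le_rfl⟩).1 with hb
  have hi : ∀ i j, q ⟨(M + i, j), by simp⟩ = (b j + i, ρ j) := by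
    intro i j
    induction i with
    | zero => rfl
    | succ i ih =>
      have := hstep (M + i) j (by omega)
      rw [ih] at this
      exact this
  have hfar : ∀ i j y, f (R.pieceMap (M + i, j) y) = R.pieceMap (b j + i, ρ j) y :=
    fun i j y => by rw [← hi]; exact hq' _ _ y
  -- If two rays had tails with images in one ray, some pieces of these tails would have the same
  -- image, contrary to injectivity of f.
  have hinj : Function.Injective ρ := by
    have aux : ∀ j j', ρ j = ρ j' → b j ≤ b j' → j = j' := by
      intro j j' hj hbj
      by_contra hne
      have h1 := hfar (b j' - b j) j (refDoublePieceMinus h u)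
      have h2 := hfar 0 j' (refDoublePieceMinus h u)
      rw [hj, Nat.add_sub_cancel' hbj] at h1
      have h3 := f.injective (h1.trans h2.symm)
      exact hne ((R.piece_inter_piece _ _ _ _ _ _ fun e => hne (congrArg Prod.snd e)).1 h3).1
    intro j j' hj
    rcases le_total (b j) (b j') with hbj | hbj
    · exact aux j j' hj hbj
    · exact (aux j' j hj.symm hbj).symm
  exact ⟨M, Equiv.ofBijective ρ (Finite.injective_iff_bijective.1 hinj), b, hfar⟩

/-- In standard coordinates a distant piece goes to another piece with unchanged reference
coordinates. This is already a translation, without any isotopy, and its length is a difference of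
levels at which standard pieces begin. -/
theorem mem_congruentTranslations_of_rigid (hh : 1 ≤ h)
    {F : DoubledHandlebody r ≃ₜ DoubledHandlebody r}
    (hF : ∀ p y, F (stdEmb g h p y) = R.pieceMap p y)
    {f : DoubledHandlebody r ≃ₜ DoubledHandlebody r} (hf : R.IsAsymptoticallyRigid f) :
    (QuotientGroup.mk (F⁻¹ * f * F) : MapManifold (DoubledHandlebody r)) ∈
      congruentTranslations IsHandlebodyTranslation h (refCoreLoops g) := by
  obtain ⟨M, ρ, b, hb⟩ := R.exists_eventual_pieces hh hf
  have hb' : ∀ i j y, (F⁻¹ * f * F) (stdEmb g h (M + i, j) y) = stdEmb g h (b j + i, ρ j) y := by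
    intro i j y
    rw [Homeomorph.mul_apply, Homeomorph.mul_apply, hF, hb, ← hF]
    exact F.symm_apply_apply _
  refine ⟨ρ, fun j => (stdLevel g h (b j, ρ j) : ℤ) - stdLevel g h (M, j),
    -- The additional 1 provides the strict inequality that `exists_mem_stdPiece` requires.
    ⟨_, ∑ j : Fin r, stdLevel g h (M, j) + 1, rfl, fun j q hq hm => ?_⟩,
    fun j => ⟨b j - M, by simp only [stdLevel]; push_cast; ring⟩⟩
  have h1 : (stdLevel g h (M, j) : ℝ) ≤ ((∑ j : Fin r, stdLevel g h (M, j) : ℕ) : ℝ) := by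
    exact_mod_cast Finset.single_le_sum (f := fun j : Fin r => stdLevel g h (M, j))
      (fun _ _ => Nat.zero_le _) (Finset.mem_univ j)
  obtain ⟨i, y, hi, -, hy⟩ := exists_mem_stdPiece hh (hq := hq) (m := M) (g := g) (j := j) (by
    push_cast at hm h1
    linarith)
  obtain ⟨i, rfl⟩ := Nat.exists_eq_add_of_le hi
  have h2 := rayPoint_injective _ (congrArg Subtype.val hy)
  rw [← hy, hb', ← h2]
  simp only [stdEmb, handleRay, stdLevel]
  congr 2
  push_cast
  ring

/-! ### Congruent translations are asymptotically rigid -/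

theorem range_stdEmb_image {F : DoubledHandlebody r ≃ₜ DoubledHandlebody r}
    (hF : ∀ p y, F (stdEmb g h p y) = R.pieceMap p y) (p : ℕ × Fin r) :
    F '' stdPiece g h p = R.piece p := by
  rw [stdPiece, ← Set.range_comp]
  exact congrArg Set.range (funext (hF p))

theorem isSuited_image_stdSuited [NeZero r] (hh : 1 ≤ h)
    {F : DoubledHandlebody r ≃ₜ DoubledHandlebody r}
    (hF₀ : ∀ x : refDoubleCore g r, F x = R.coreMap x)
    (hF : ∀ p y, F (stdEmb g h p y) = R.pieceMap p y) (b : Fin r → ℕ) :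
    R.IsSuited (F '' stdSuited g h b) := by
  refine ⟨(isConnected_truncDouble _).image _ F.continuous.continuousOn,
    Finset.univ.biUnion fun j => (Finset.range (b j)).image fun i => (i, j), ?_⟩
  rw [stdSuited_eq hh, Set.image_union, Set.image_iUnion₂]
  congr 1
  · rw [core, ← funext hF₀]
    exact (Subtype.range_coe ▸ Set.range_comp F Subtype.val).symm
  · simp only [R.range_stdEmb_image hF]

theorem exists_rigid_of_mem_congruentTranslations [NeZero r] (hh : 1 ≤ h)
    {F : DoubledHandlebody r ≃ₜ DoubledHandlebody r}
    (hF₀ : ∀ x : refDoubleCore g r, F x = R.coreMap x)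
    (hF : ∀ p y, F (stdEmb g h p y) = R.pieceMap p y)
    {u : MapManifold (DoubledHandlebody r)}
    (hu : u ∈ congruentTranslations IsHandlebodyTranslation h (refCoreLoops g)) :
    ∃ f : DoubledHandlebody r ≃ₜ DoubledHandlebody r,
      (QuotientGroup.mk F : MapManifold (DoubledHandlebody r)) * u * (QuotientGroup.mk F)⁻¹ =
        QuotientGroup.mk f ∧ R.IsAsymptoticallyRigid f := by
  obtain ⟨ρ, n, ⟨f, m, rfl, ht⟩, hn⟩ := hu
  choose d hd using hn
  -- As for graphs, the piece (i, j) moves to (i + d_j, ρ j), and from M on this index is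
  -- nonnegative and the piece lies beyond the level m.
  set M := m + ∑ j, (d j).natAbs with hM
  have hMd : ∀ j, 0 ≤ (M : ℤ) + d j := fun j => by
    have := Finset.single_le_sum (f := fun j => (d j).natAbs) (fun _ _ => Nat.zero_le _)
      (Finset.mem_univ j)
    omega
  set b : Fin r → ℕ := fun j => ((M : ℤ) + d j).toNat with hb
  have hb' : ∀ j, (b j : ℤ) = M + d j := fun j => Int.toNat_of_nonneg (hMd j)
  have hlev : ∀ i j, (stdLevel g h (b j + i, ρ j) : ℤ) = stdLevel g h (M + i, j) + n j := by
    intro i j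
    simp only [stdLevel]
    push_cast
    rw [hb']
    linear_combination -hd j
  have hmlev : ∀ i (j : Fin r), m ≤ stdLevel g h (M + i, j) := fun i j => by
    have h1 : 1 * (M + i) ≤ h * (M + i) := Nat.mul_le_mul_right _ hh
    simp only [stdLevel]
    omega
  have hemb : ∀ i j y, f (stdEmb g h (M + i, j) y) = stdEmb g h (b j + i, ρ j) y := by
    intro i j y
    have h1 : (m : ℝ) ≤ stdLevel g h (M + i, j) := by exact_mod_cast hmlev i j
    have h2 : (stdLevel g h (b j + i, ρ j) : ℝ) = stdLevel g h (M + i, j) + n j := by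
      exact_mod_cast hlev i j
    refine Subtype.ext ?_
    simp only [stdEmb]
    rw [ht _ _ _ (by have := y.2.1.1; simp only; linarith)]
    simp only [handleRay, h2]
    congr 2
    ring
  have him : f '' stdSuited g h (fun _ => M) = stdSuited g h fun k => b (ρ.symm k) :=
    ht.image_truncDouble (fun j => hmlev 0 j) fun j => by simpa using hlev 0 j
  have hFim : ∀ Z, (F * f * F⁻¹) '' (F '' Z) = F '' (f '' Z) := fun Z => by
    rw [← Set.image_comp, ← Set.image_comp]
    exact Set.image_congr fun x _ => congrArg (F ∘ f) (F.symm_apply_apply x)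
  -- F is a homeomorphism, so which pieces lie outside a suited submanifold can be decided in the
  -- standard decomposition.
  have hcl : ∀ p (b : Fin r → ℕ), R.piece p ⊆ closure (F '' stdSuited g h b)ᶜ ↔
      stdPiece g h p ⊆ closure (stdSuited g h b)ᶜ := fun p b => by
    rw [← R.range_stdEmb_image hF, ← Set.image_compl_eq F.bijective, ← F.image_closure,
      Set.image_subset_image_iff F.injective]
  refine ⟨F * f * F⁻¹, rfl, F '' stdSuited g h fun _ => M, R.isSuited_image_stdSuited hh hF₀ hF _,
    ?_, ?_⟩
  · rw [hFim, him]
    exact R.isSuited_image_stdSuited hh hF₀ hF _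
  · rintro ⟨i, j⟩ hp
    rw [hcl] at hp
    obtain ⟨i, rfl⟩ := Nat.exists_eq_add_of_le (le_of_stdPiece_subset_closure_compl hh hp)
    refine ⟨(b j + i, ρ j), ?_, fun y => ?_⟩
    · rw [hFim, him, hcl]
      exact stdPiece_subset_closure_compl (by simp)
    · rw [Homeomorph.mul_apply, Homeomorph.mul_apply, ← hF, ← hF, ← hemb]
      exact congrArg (F ∘ f) (F.symm_apply_apply _)

end DoubledRigidStructure

/-! ### Commensurability of doubled handlebody Houghton groups -/

theorem commensurable_doubledHoughtonGroup {g h g' h' r : ℕ} (hh : 1 ≤ h) (hh' : 1 ≤ h')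
    (hr : 1 ≤ r) (R : DoubledRigidStructure g h r) (R' : DoubledRigidStructure g' h' r) :
    Commensurable R.houghtonGroup R'.houghtonGroup := by
  have : NeZero r := ⟨by omega⟩
  have aux : ∀ {g h : ℕ} (_ : 1 ≤ h) (R : DoubledRigidStructure g h r),
      ∃ F : MapManifold (DoubledHandlebody r), ∀ u,
        F * u * F⁻¹ ∈ {u | ∃ f : DoubledHandlebody r ≃ₜ DoubledHandlebody r,
          u = QuotientGroup.mk f ∧ R.IsAsymptoticallyRigid f} ↔
        u ∈ congruentTranslations IsHandlebodyTranslation h (refCoreLoops g) := by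
    intro g h hh R
    obtain ⟨F, hF₀, hF⟩ := R.exists_standardizer hh
    refine ⟨QuotientGroup.mk F, fun u => ⟨?_, R.exists_rigid_of_mem_congruentTranslations hh hF₀ hF⟩⟩
    rintro ⟨f, hu, hf⟩
    have e : u = QuotientGroup.mk (F⁻¹ * f * F) := by
      rw [QuotientGroup.mk_mul, QuotientGroup.mk_mul, QuotientGroup.mk_inv, ← hu]
      group
    rw [e]
    exact R.mem_congruentTranslations_of_rigid hh hF hf
  obtain ⟨F, hF⟩ := aux hh R
  obtain ⟨F', hF'⟩ := aux hh' R'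
  exact commensurable_closure_of_conj IsHandlebodyTranslation isHandlebodyTranslation_one
    isHandlebodyTranslation_mul hh hh' (refCoreLoops g) (refCoreLoops g') F F' hF hF'

end Houghton

/-- Graph and doubled handlebody Houghton groups with the same number of ends are commensurable,
for all ranks of the cores and of the pieces and all choices of rigid structures. -/
theorem lemma5p1 (g h r g' h' r' : ℕ) (hh : 1 ≤ h) (hh' : 1 ≤ h') (hr : 2 ≤ r) (hrr : r = r') :
    (∀ (R : Houghton.GraphRigidStructure g h r) (R' : Houghton.GraphRigidStructure g' h' r'),
      Houghton.Commensurable R.houghtonGroup R'.houghtonGroup) ∧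
    (∀ (R : Houghton.DoubledRigidStructure g h r) (R' : Houghton.DoubledRigidStructure g' h' r'),
      Houghton.Commensurable R.houghtonGroup R'.houghtonGroup) := by
  subst hrr
  exact ⟨Houghton.commensurable_graphHoughtonGroup hh hh' (by omega),
    Houghton.commensurable_doubledHoughtonGroup hh hh' (by omega)⟩
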